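/- **Setting.** A horizontal circular pipe of radius $R>0$ has cross-sectional area $A=\pi R^2$. It carries an upper layer (area $A_1$, solid fraction $\alpha$, velocity $U$) and a lower layer (area $A_2=A-A_1$, constant solid fraction $\beta\in(0,1)$, velocity $V$). The solid and liquid densities satisfy $\rho_s>\rho_w>0$, and $\psi>0$ is the transfer rate constant. The discharge $Q\in C^1$ is a given function of time. Put $$V=\frac{Q-A_1U}{A_2},\qquad \rho_1=\alpha\rho_s+(1-\alpha)\rho_w,\qquad \rho_2=\beta\rho_s+(1-\beta)\rho_w .$$ Let $\varphi\in[0,\pi]$ be the solution of $A_2=R^2(\varphi-\sin\varphi\cos\varphi)$. The outer perimeters and the interface length are $S_1=2R(\pi-\varphi)$, $S_2=2R\varphi$, $S_i=2R\sin\varphi$. The viscosity is $\eta(a)=\eta_w(\eta_2/\eta_w)^{(a/\beta)^b}$ with $\eta_w,\eta_2,b>0$. For given friction constants $c_j,n_j>0$ $(j=1,2)$, with $v_1=U$, $v_2=V$, $\nu_1=\eta(\alpha)/\rho_1$, $\nu_2=\eta(\beta)/\rho_2$, let $$\lambda_j=c_j\Big(\frac{D_jv_j}{\nu_j}\Big)^{-n_j},\qquad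 \tau_j=\frac{\lambda_j}{2}\rho_jv_j^2,$$ where $D_j=4A_j/(S_j+S_i)$ if layer $j$ is strictly the faster one and $D_j=4A_j/S_j$ otherwise. Let $\tau_i=\frac{\lambda_k}{2}\rho_k(U-V)^2$, where $k$ is the faster layer. The unknown $\Omega=(\alpha,A_1,U)$ is a function of $x\ge 0$ and $t\ge0$ and satisfies $M\partial_t\Omega+N\partial_x\Omega=F$ with $$M=\begin{pmatrix}1&0&0\\0&1&0\\0&0&A_2\rho_1+A_1\rho_2\end{pmatrix},\quad N=\begin{pmatrix}U&0&0\\0&U&A_1\\0&0&A_2\rho_1U+A_1\rho_2V\end{pmatrix},\quad F=\begin{pmatrix}-\alpha(1-\frac{\alpha}{\beta})\psi\\-A_1\frac{\alpha}{\beta}\psi\\f\end{pmatrix},$$ $$f=\rho_2\dot Q-\frac{A_2}{A_1}\tau_1S_1+\tau_2S_2-\operatorname{sgn}(U-V)\,\tau_iS_i\Big(\frac{A_2}{A_1}+1\Big).$$ A state $\Omega$ is *physical* for the discharge value $q$ (i.e. with $Q=q$ in the formula for $V$) if $0<\alpha<\beta$, $0<A_1<A$, $U>0$ and $V>0$. A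 *solution* on $[0,\infty)\times[0,T]$ with initial values $g$ and boundary values $d$ is a Lipschitz function $\Omega(x,t)$ there such that $\Omega(x,t)$ is physical for $Q(t)$ at every point, $\Omega(x,0)=g(x)$ for $x\ge0$, $\Omega(0,t)=d(t)$ for $0\le t\le T$, and $M\partial_t\Omega+N\partial_x\Omega=F$ holds almost everywhere. **Theorem (Well-posedness).** 1. *Hyperbolicity.* At every physical state (for any discharge value), $M$ and $N$ are invertible, so that neither data line is characteristic. The eigenvalues of $L=M^{-1}N$, with multiplicity, are $$U,\quad U,\quad \frac{A_2\rho_1U+A_1\rho_2V}{A_2\rho_1+A_1\rho_2},$$ and they are all positive. If $U\ne V$, then $L$ is diagonalizable over $\mathbb R$. 2. *Well-posedness.* Let $\Omega^0$ be a constant state that is physical for $Q(0)$, with $U^0\neq V^0=(Q(0)-A_1^0U^0)/(A-A_1^0)$. Then the problem with boundary-Cauchy data $\Omega(0,t)=\Omega(x,0)=\Omega^0$ is well-posed locally in time, in the following sense. There is $r>0$ such that for every $K\ge0$ there is $T_0>0$ such that for every $T\in(0,T_0]$ the following holds. Consider all data $(g,d)$, with $g$ on $[0,\infty)$ and $d$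 on $[0,T]$, that are $K$-Lipschitz, satisfy $g(0)=d(0)$, and take values at distance at most $r$ from $\Omega^0$; the constant data $g=d=\Omega^0$ are among them. For each such pair there is exactly one solution on $[0,\infty)\times[0,T]$. The solutions depend continuously on the data, uniformly: for every $\varepsilon>0$ there is $\delta>0$ such that whenever two such data pairs differ by at most $\delta$ in the supremum norm, the corresponding solutions differ by at most $\varepsilon$ everywhere on $[0,\infty)\times[0,T]$. -/

import Mathlib

open MeasureTheory Set

open scoped NNReal

namespace TwoLayerFlow

/-- Physical constants of the two-layer flow in a circular pipe of radius `R`. -/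
structure Params where
  /-- pipe radius -/
  R : ℝ
  /-- density of the solid -/
  ρs : ℝ
  /-- density of the liquid (water) -/
  ρw : ℝ
  /-- constant solid volume fraction of the lower layer -/
  β : ℝ
  /-- solid transfer rate constant -/
  ψ : ℝ
  /-- viscosity of water -/
  ηw : ℝ
  /-- viscosity of the mixture with solid fraction `β` -/
  η₂ : ℝ
  /-- exponent of the viscosity law -/
  b : ℝ
  /-- friction coefficient and exponent of the upper layer -/
  c₁ : ℝ
  n₁ : ℝ
  /-- friction coefficient and exponent of the lower layer -/
  c₂ : ℝ
  n₂ : ℝ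
  R_pos : 0 < R
  ρw_pos : 0 < ρw
  ρw_lt_ρs : ρw < ρs
  β_pos : 0 < β
  β_lt_one : β < 1
  ψ_pos : 0 < ψ
  ηw_pos : 0 < ηw
  η₂_pos : 0 < η₂
  b_pos : 0 < b
  c₁_pos : 0 < c₁
  n₁_pos : 0 < n₁
  c₂_pos : 0 < c₂
  n₂_pos : 0 < n₂

/-- Hydraulic diameter of a layer with area `a`, wall perimeter `s` and speed `v`, when the
interface has length `si` and the other layer has speed `w`: the interface counts as a part of the
wetted perimeter of the faster layer only. -/
noncomputable def hydraulicDiameter (a s si v w : ℝ) : ℝ :=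
  if w < v then 4 * a / (s + si) else 4 * a / s

/-- Friction factor `c (D v / ν)^(-n)`. -/
noncomputable def frictionFactor (c n D v ν : ℝ) : ℝ := c * (D * v / ν) ^ (-n)

namespace Params

noncomputable section

/-! A state is a vector `Ω = (α, A₁, U)`, with entries `Ω 0`, `Ω 1`, `Ω 2`; `q` is the value of the
discharge, `q'` the value of its time derivative. -/

variable (P : Params) (q q' : ℝ) (Ω : Fin 3 → ℝ)

/-- Total cross-sectional area of the pipe. -/
def A : ℝ := Real.pi * P.R ^ 2

/-- Area of the lower layer. -/
def A₂ : ℝ := P.A - Ω 1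

/-- Velocity of the lower layer. -/
def V : ℝ := (q - Ω 1 * Ω 2) / P.A₂ Ω

/-- Average density of the upper layer. -/
def ρ₁ : ℝ := Ω 0 * P.ρs + (1 - Ω 0) * P.ρw

/-- Average density of the lower layer. -/
def ρ₂ : ℝ := P.β * P.ρs + (1 - P.β) * P.ρw

/-- Area of the circular segment below a chord seen from the centre under the angle `2 φ`. -/
def segmentArea (φ : ℝ) : ℝ := P.R ^ 2 * (φ - Real.sin φ * Real.cos φ)

/-- The half-angle in `[0, π]` of the segment occupied by the lower layer. -/
def φ : ℝ := Function.invFunOn P.segmentArea (Icc 0 Real.pi) (P.A₂ Ω)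

/-- Length of the outer boundary of the upper layer. -/
def S₁ : ℝ := 2 * P.R * (Real.pi - P.φ Ω)

/-- Length of the outer boundary of the lower layer. -/
def S₂ : ℝ := 2 * P.R * P.φ Ω

/-- Length of the interface. -/
def Sᵢ : ℝ := 2 * P.R * Real.sin (P.φ Ω)

/-- Viscosity of the mixture with solid fraction `a`. -/
def η (a : ℝ) : ℝ := P.ηw * (P.η₂ / P.ηw) ^ ((a / P.β) ^ P.b)

/-- Friction factor of the upper layer. -/
def friction₁ : ℝ :=
  frictionFactor P.c₁ P.n₁ (hydraulicDiameter (Ω 1) (P.S₁ Ω) (P.Sᵢ Ω) (Ω 2) (P.V q Ω)) (Ω 2)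
    (P.η (Ω 0) / P.ρ₁ Ω)

/-- Friction factor of the lower layer. -/
def friction₂ : ℝ :=
  frictionFactor P.c₂ P.n₂ (hydraulicDiameter (P.A₂ Ω) (P.S₂ Ω) (P.Sᵢ Ω) (P.V q Ω) (Ω 2))
    (P.V q Ω) (P.η P.β / P.ρ₂)

/-- Wall stress of the upper layer. -/
def τ₁ : ℝ := P.friction₁ q Ω / 2 * P.ρ₁ Ω * Ω 2 ^ 2

/-- Wall stress of the lower layer. -/
def τ₂ : ℝ := P.friction₂ q Ω / 2 * P.ρ₂ * P.V q Ω ^ 2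

/-- Interfacial stress: friction factor and density are those of the faster layer, the velocity is
the relative one. -/
def τᵢ : ℝ :=
  (if P.V q Ω < Ω 2 then P.friction₁ q Ω / 2 * P.ρ₁ Ω else P.friction₂ q Ω / 2 * P.ρ₂) *
    (Ω 2 - P.V q Ω) ^ 2

/-- Right-hand side of the momentum equation; the interfacial stress slows down the upper layer
exactly if this is the faster one. -/
def f : ℝ :=
  P.ρ₂ * q' - P.A₂ Ω / Ω 1 * P.τ₁ q Ω * P.S₁ Ω + P.τ₂ q Ω * P.S₂ Ω
    - SignType.sign (Ω 2 - P.V q Ω) * (P.τᵢ q Ω * P.Sᵢ Ω * (P.A₂ Ω / Ω 1 + 1))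

/-- The source vector. -/
def F : Fin 3 → ℝ :=
  ![-(Ω 0 * (1 - Ω 0 / P.β) * P.ψ), -(Ω 1 * (Ω 0 / P.β) * P.ψ), P.f q q' Ω]

/-- The coefficient matrix of the time derivative. -/
def M : Matrix (Fin 3) (Fin 3) ℝ :=
  !![1, 0, 0;
     0, 1, 0;
     0, 0, P.A₂ Ω * P.ρ₁ Ω + Ω 1 * P.ρ₂]

/-- The coefficient matrix of the space derivative. -/
def N : Matrix (Fin 3) (Fin 3) ℝ :=
  !![Ω 2, 0, 0;
     0, Ω 2, Ω 1;
     0, 0, P.A₂ Ω * P.ρ₁ Ω * Ω 2 + Ω 1 * P.ρ₂ * P.V q Ω]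

/-- The third characteristic speed. -/
def speed₃ : ℝ :=
  (P.A₂ Ω * P.ρ₁ Ω * Ω 2 + Ω 1 * P.ρ₂ * P.V q Ω) / (P.A₂ Ω * P.ρ₁ Ω + Ω 1 * P.ρ₂)

/-- The states of a two-layer flow with discharge `q`: both layers are present and move forward,
and the upper one is more dilute than the lower one, but not free of solid. -/
structure Physical : Prop where
  α_pos : 0 < Ω 0
  α_lt : Ω 0 < P.β
  A₁_pos : 0 < Ω 1
  A₁_lt : Ω 1 < P.A
  U_pos : 0 < Ω 2
  V_pos : 0 < P.V q Ω

/-- At the state `Ω`, no coordinate line is characteristic, the eigenvalues of the matrix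
`M⁻¹ N` of the normal form are `U`, `U` and `speed₃` (with multiplicity), all of them are positive,
and `M⁻¹ N` has a basis of eigenvectors as soon as the two layers have distinct velocities. -/
structure Hyperbolic : Prop where
  det_M : (P.M Ω).det ≠ 0
  det_N : (P.N q Ω).det ≠ 0
  charpoly : ((P.M Ω)⁻¹ * P.N q Ω).charpoly =
    (Polynomial.X - Polynomial.C (Ω 2)) ^ 2 * (Polynomial.X - Polynomial.C (P.speed₃ q Ω))
  U_pos : 0 < Ω 2
  speed₃_pos : 0 < P.speed₃ q Ω
  diagonalizable : Ω 2 ≠ P.V q Ω → ∃ B : Matrix (Fin 3) (Fin 3) ℝ, IsUnit B.det ∧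
    ((P.M Ω)⁻¹ * P.N q Ω) * B = B * Matrix.diagonal ![Ω 2, Ω 2, P.speed₃ q Ω]

/-- The domain `x ≥ 0`, `0 ≤ t ≤ T`; its points are pairs `(x, t)`. -/
def slab (T : ℝ) : Set (ℝ × ℝ) := Ici 0 ×ˢ Icc 0 T

variable (Q : ℝ → ℝ) (Ω₀ : Fin 3 → ℝ)

/-- `Y` is a (Lipschitz continuous, almost everywhere) solution of `M ∂ₜΩ + N ∂ₓΩ = F` on the slab,
with initial values `g` on `t = 0` and boundary values `d` on `x = 0`. -/
structure IsSolution (T : ℝ) (g d : ℝ → Fin 3 → ℝ) (Y : ℝ × ℝ → Fin 3 → ℝ) : Prop where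
  lipschitz : ∃ K : ℝ≥0, LipschitzOnWith K Y (slab T)
  physical : ∀ p ∈ slab T, P.Physical (Q p.2) (Y p)
  initial : ∀ x ∈ Ici (0 : ℝ), Y (x, 0) = g x
  boundary : ∀ t ∈ Icc 0 T, Y (0, t) = d t
  pde : ∀ᵐ p ∂(volume.restrict (slab T)), ∃ Yx Yt : Fin 3 → ℝ,
    HasDerivAt (fun x => Y (x, p.2)) Yx p.1 ∧ HasDerivAt (fun t => Y (p.1, t)) Yt p.2 ∧
      (P.M (Y p)).mulVec Yt + (P.N (Q p.2) (Y p)).mulVec Yx = P.F (Q p.2) (deriv Q p.2) (Y p)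

/-- Initial values `g` and boundary values `d` which have Lipschitz constant `K`, agree at the
corner, and are at distance at most `r` from the constant `Ω₀`. -/
structure IsData (r : ℝ) (K : ℝ≥0) (T : ℝ) (g d : ℝ → Fin 3 → ℝ) : Prop where
  lipschitz_initial : LipschitzOnWith K g (Ici 0)
  lipschitz_boundary : LipschitzOnWith K d (Icc 0 T)
  corner : g 0 = d 0
  near_initial : ∀ x ∈ Ici (0 : ℝ), dist (g x) Ω₀ ≤ r
  near_boundary : ∀ t ∈ Icc 0 T, dist (d t) Ω₀ ≤ r

/-- Well-posedness, locally in time, of the boundary-Cauchy problem at the constant data `Ω₀`: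
existence, uniqueness and continuous dependence on the data, not only for the constant
data (for which `K = 0` suffices) but for all Lipschitz data in a uniform neighbourhood of them. -/
def WellPosed : Prop :=
  ∃ r > 0, ∀ K : ℝ≥0, ∃ T₀ > 0, ∀ T, 0 < T → T ≤ T₀ →
    (∀ g d, IsData Ω₀ r K T g d → ∃ Y, P.IsSolution Q T g d Y) ∧
    (∀ g d, IsData Ω₀ r K T g d → ∀ Y Z, P.IsSolution Q T g d Y → P.IsSolution Q T g d Z →
      EqOn Y Z (slab T)) ∧
    (∀ ε > 0, ∃ δ > 0, ∀ g d g' d', IsData Ω₀ r K T g d → IsData Ω₀ r K T g' d' →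
      (∀ x ∈ Ici (0 : ℝ), dist (g x) (g' x) ≤ δ) → (∀ t ∈ Icc 0 T, dist (d t) (d' t) ≤ δ) →
      ∀ Y Z, P.IsSolution Q T g d Y → P.IsSolution Q T g' d' Z →
        ∀ p ∈ slab T, dist (Y p) (Z p) ≤ ε)

end

end Params

end TwoLayerFlow

/-! The matrix `M⁻¹ N` is upper triangular with diagonal U, U, c, where c = `speed₃` is the mean of
U and V with weights A₂ρ₁ and A₁ρ₂. This gives invertibility, the spectrum and its positivity. If U
≠ V then c ≠ U, and the eigenvalue U keeps two eigenvectors.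

For well-posedness, put W = (ρ₁ + ρ₂ A₁/A₂)(A U - Q). Since A U - Q = A₂(U - V), W is (A₂ρ₁ +
A₁ρ₂)(U - V). For fixed Q its gradient in Ω lies in the span of the left eigenvectors for the
eigenvalue U, so (α, W, U) diagonalizes the system: α and W travel with speed U, and U travels with
speed c (`pde_iff_diag`). Where U ≠ V, A₁ can be recovered from (α, W, U). There also the switches
in the friction law are locally constant, so speeds and sources are C¹ in (Q, Ω), up to a source
term linear in Q', which is only continuous in time. What remains is a theorem on diagonal systems
∂ₜuᵢ + λᵢ(t,u) ∂ₓuᵢ = Gᵢ(t,u) with positive speeds.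

Existence (`exists_isDiagSolution`): the upwind scheme forms convex combinations, so it has bounds
on values and slopes, uniform in the step, for a short time. At x = 0 the slope is controlled
because the speeds are bounded below. An ultrafilter limit is Lipschitz, hence differentiable almost
everywhere, and at such points a comparison with transport at frozen speed
(`abs_limit_transport_le`) yields the equation.

Stability (`dist_le_mul_exp_of_isDiagSolution`): the difference of two solutions is followed
backwards along short segments of frozen speed. The errors are quadratic in the time step, and a
discrete Gronwall argument leaves an exponential factor which depends on the Lipschitz constant of
only one of the solutions.

An arbitrary solution might leave the domain of the coordinates. It does not: its Lipschitz constant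
prevents this during a fixed time step, within which it agrees with the constructed solution, and
that one stays well inside (`DiagChart.eqOn`). -/

open scoped Topology

namespace TwoLayerFlow

open Params

/-! ### Integration along straight segments -/

/-- Along a segment of slope `μ`, the increment of a Lipschitz function is controlled by an almost
everywhere bound of its derivative in the direction `(μ, 1)`, near the segment. -/
theorem abs_sub_le_of_ae_fderiv {T : ℝ} {w : ℝ × ℝ → ℝ} {K : ℝ≥0}
    (hw : LipschitzOnWith K w (slab T)) {x t μ k M ρ : ℝ} (hk : 0 ≤ k) (hμ : 0 ≤ μ) (hkt : k ≤ t)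
    (htT : t ≤ T) (hx : k * μ ≤ x) (hρ : 0 < ρ)
    (h : ∀ᵐ p ∂(volume.restrict (slab T)), p ∈ Icc (x - k * μ) (x + ρ) ×ˢ Icc (t - k) t →
      ∃ D : ℝ × ℝ →L[ℝ] ℝ, HasFDerivAt w D p ∧ |D (μ, 1)| ≤ M) :
    |w (x, t) - w (x - k * μ, t - k)| ≤ k * M := by
  have hmeas : MeasurableSet (slab T) := measurableSet_Ici.prod measurableSet_Icc
  rw [ae_restrict_iff' hmeas] at h
  -- This shear takes an offset and a time to a point on a line of slope `μ`. It preserves area, so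
  -- by Fubini almost every parallel line meets the exceptional set in a null set of times.
  have hS : MeasurePreserving (fun p : ℝ × ℝ => (x + (p.2 - t) * μ + p.1, p.2)) volume volume := by
    have h1 : MeasurePreserving (fun p : ℝ × ℝ => (p.1, x + (p.1 - t) * μ + p.2))
        (volume.prod volume) (volume.prod volume) := by
      refine (MeasurePreserving.id (volume : Measure ℝ)).skew_product
        (g := fun s h => x + (s - t) * μ + h) (by fun_prop) (Filter.Eventually.of_forall fun s => ?_)
      exact (measurePreserving_add_left volume _).map_eq
    exact (Measure.measurePreserving_swap.comp h1).comp Measure.measurePreserving_swap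
  have h2 := hS.quasiMeasurePreserving.ae h
  rw [Measure.volume_eq_prod] at h2
  have h3 := Measure.ae_ae_of_ae_prod h2
  refine le_of_forall_pos_le_add fun ε hε => ?_
  -- The segment itself may be exceptional, so it is moved to the right by some `y` in (0, δ). A
  -- positive offset keeps it in x ≥ 0, and moving the two end points back costs `2 * K * y ≤ ε`.
  set δ := min ρ (ε / (2 * K + 1)) with hδ
  have hδ0 : 0 < δ := lt_min hρ (by positivity)
  obtain ⟨y, hy, hyδ⟩ : ∃ y, (∀ᵐ s : ℝ, (x + (s - t) * μ + y, s) ∈ slab T →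
      (x + (s - t) * μ + y, s) ∈ Icc (x - k * μ) (x + ρ) ×ˢ Icc (t - k) t →
      ∃ D : ℝ × ℝ →L[ℝ] ℝ, HasFDerivAt w D (x + (s - t) * μ + y, s) ∧ |D (μ, 1)| ≤ M) ∧
      y ∈ Ioo 0 δ := by
    have : (volume (Ioo 0 δ) : ENNReal) ≠ 0 := by simp [hδ0]
    have h4 := frequently_ae_mem_iff.2 this
    obtain ⟨y, hy⟩ := (h4.and_eventually h3).exists
    exact ⟨y, hy.2, hy.1⟩
  have hyρ : y < ρ := hyδ.2.trans_le (min_le_left _ _)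
  have hline : ∀ s ∈ Icc (t - k) t, (x + (s - t) * μ + y, s) ∈ slab T ∧
      (x + (s - t) * μ + y, s) ∈ Icc (x - k * μ) (x + ρ) ×ˢ Icc (t - k) t := by
    rintro s ⟨hs1, hs2⟩
    have e1 : (t - s) * μ ≤ k * μ := mul_le_mul_of_nonneg_right (by linarith) hμ
    have e2 : 0 ≤ (t - s) * μ := mul_nonneg (by linarith) hμ
    have := hyδ.1
    refine ⟨⟨?_, ?_, ?_⟩, ⟨?_, ?_⟩, hs1, hs2⟩ <;> simp only [mem_Ici] <;> nlinarith
  set γ : ℝ → ℝ := fun s => w (x + (s - t) * μ + y, s) with hγ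
  have hcurve : LipschitzWith (Real.toNNReal μ + 1) (fun s : ℝ => (x + (s - t) * μ + y, s)) := by
    refine LipschitzWith.of_dist_le_mul fun a b => ?_
    rw [Prod.dist_eq, Real.dist_eq, Real.dist_eq]
    have : x + (a - t) * μ + y - (x + (b - t) * μ + y) = (a - b) * μ := by ring
    rw [this, abs_mul, abs_of_nonneg hμ]
    have h0 := abs_nonneg (a - b)
    push_cast
    rw [Real.coe_toNNReal _ hμ]
    refine max_le ?_ ?_ <;> nlinarith
  have hγL : LipschitzOnWith (K * (Real.toNNReal μ + 1)) γ (uIcc (t - k) t) := by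
    refine hw.comp (hcurve.lipschitzOnWith) ?_
    intro s hs
    rw [uIcc_of_le (by linarith)] at hs
    exact (hline s hs).1
  have hint := hγL.absolutelyContinuousOnInterval.integral_deriv_eq_sub
  have hbound : ‖∫ s in (t - k)..t, deriv γ s‖ ≤ M * |t - (t - k)| := by
    refine intervalIntegral.norm_integral_le_of_norm_le_const_ae ?_
    filter_upwards [hy] with s hs hst
    rw [uIoc_of_le (by linarith)] at hst
    have hst' : s ∈ Icc (t - k) t := ⟨hst.1.le, hst.2⟩
    obtain ⟨D, hD, hDM⟩ := hs (hline s hst').1 (hline s hst').2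
    have hc : HasDerivAt (fun s : ℝ => (x + (s - t) * μ + y, s)) (μ, 1) s := by
      refine HasDerivAt.prodMk ?_ (hasDerivAt_id s)
      simpa using ((((hasDerivAt_id s).sub_const t).mul_const μ).const_add x).add_const y
    have := HasFDerivAt.comp_hasDerivAt (f := fun s : ℝ => (x + (s - t) * μ + y, s)) s hD hc
    have hd : deriv γ s = D (μ, 1) := this.deriv
    rw [hd]; exact hDM
  rw [hint] at hbound
  have e3 : t - (t - k) = k := by ring
  rw [e3, abs_of_nonneg hk, Real.norm_eq_abs] at hbound
  have hd : ∀ a s, (a, s) ∈ slab T → (a + y, s) ∈ slab T → |w (a, s) - w (a + y, s)| ≤ K * y := by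
    intro a s ha hb
    have := hw.dist_le_mul _ ha _ hb
    rw [Real.dist_eq, Prod.dist_eq] at this
    simpa [abs_of_pos hyδ.1, max_eq_left hyδ.1.le] using this
  have f1 := hd x t ⟨by simp; nlinarith, by linarith, htT⟩
    ⟨by simp; nlinarith [hyδ.1], by linarith, htT⟩
  have f2 := hd (x - k * μ) (t - k) ⟨by simp; nlinarith, by simp; linarith, by simp; linarith⟩
    ⟨by simp; nlinarith [hyδ.1], by simp; linarith, by simp; linarith⟩
  have g1 : γ t = w (x + y, t) := by simp [hγ]
  have g2 : γ (t - k) = w (x - k * μ + y, t - k) := by simp only [hγ]; congr 2; ring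
  rw [g1, g2] at hbound
  have hyε : 2 * K * y ≤ ε := by
    have h5 : y ≤ ε / (2 * K + 1) := hyδ.2.le.trans (min_le_right _ _)
    have hK : (0 : ℝ) ≤ K := K.2
    rw [le_div_iff₀ (by positivity)] at h5
    nlinarith [hyδ.1]
  have := abs_sub_abs_le_abs_sub (w (x, t) - w (x - k * μ, t - k))
    (w (x + y, t) - w (x - k * μ + y, t - k))
  have e4 : w (x, t) - w (x - k * μ, t - k) - (w (x + y, t) - w (x - k * μ + y, t - k)) =
    (w (x, t) - w (x + y, t)) - (w (x - k * μ, t - k) - w (x - k * μ + y, t - k)) := by ring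
  rw [e4] at this
  have := abs_sub (w (x, t) - w (x + y, t)) (w (x - k * μ, t - k) - w (x - k * μ + y, t - k))
  linarith

/-! ### Diagonal systems: stability of Lipschitz solutions -/

/-- Speeds `lam` and sources `G` of a diagonal first-order system, with positive speeds, bounds and
Lipschitz constants which are valid for times in `[0, T₁]` and states in `B`. -/
structure TransportBounds {ι : Type*} [Fintype ι] (lam G : ℝ → (ι → ℝ) → ι → ℝ)
    (B : Set (ι → ℝ)) (T₁ lmin Λ C : ℝ) : Prop where
  lmin_pos : 0 < lmin
  Λ_pos : 0 < Λ
  C_nonneg : 0 ≤ C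
  lam_lower : ∀ t ∈ Icc 0 T₁, ∀ u ∈ B, ∀ i, lmin ≤ lam t u i
  lam_upper : ∀ t ∈ Icc 0 T₁, ∀ u ∈ B, ∀ i, lam t u i ≤ Λ
  lam_lip : ∀ t ∈ Icc 0 T₁, ∀ s ∈ Icc 0 T₁, ∀ u ∈ B, ∀ v ∈ B, ∀ i,
    |lam t u i - lam s v i| ≤ C * (|t - s| + dist u v)
  G_bound : ∀ t ∈ Icc 0 T₁, ∀ u ∈ B, ∀ i, |G t u i| ≤ C
  G_lip : ∀ t ∈ Icc 0 T₁, ∀ u ∈ B, ∀ v ∈ B, ∀ i, |G t u i - G t v i| ≤ C * dist u v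
  G_cont : ∀ u ∈ B, ∀ i, ContinuousOn (fun t => G t u i) (Icc 0 T₁)

/-- A Lipschitz function with values in `B` which solves the diagonal system
`∂ₜ uᵢ + lamᵢ ∂ₓ uᵢ = Gᵢ` almost everywhere on the slab. -/
structure IsDiagSolution {ι : Type*} [Fintype ι] (lam G : ℝ → (ι → ℝ) → ι → ℝ)
    (B : Set (ι → ℝ)) (T : ℝ) (u : ℝ × ℝ → ι → ℝ) : Prop where
  lipschitz : ∃ K : ℝ≥0, LipschitzOnWith K u (slab T)
  mem : ∀ p ∈ slab T, u p ∈ B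
  pde : ∀ᵐ p ∂(volume.restrict (slab T)), ∃ D : ℝ × ℝ →L[ℝ] (ι → ℝ), HasFDerivAt u D p ∧
    ∀ i, D (0, 1) i + lam p.2 (u p) i * D (1, 0) i = G p.2 (u p) i

theorem measurableSet_slab (T : ℝ) : MeasurableSet (slab T) :=
  measurableSet_Ici.prod measurableSet_Icc

/-- The frontier of a convex set is null. Hence the derivative within the slab from Rademacher's
theorem is almost everywhere a full derivative. -/
theorem ae_slab_mem_nhds (T : ℝ) : ∀ᵐ p ∂(volume.restrict (slab T)), slab T ∈ 𝓝 p := by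
  rw [ae_restrict_iff' (measurableSet_slab T)]
  have hc : Convex ℝ (slab T) := (convex_Ici 0).prod (convex_Icc 0 T)
  have h0 := measure_eq_zero_iff_ae_notMem.1 (hc.addHaar_frontier volume)
  filter_upwards [h0] with p hp hps
  rw [← mem_interior_iff_mem_nhds]
  by_contra h
  exact hp ⟨subset_closure hps, h⟩

theorem slab_mono {T T' : ℝ} (h : T ≤ T') : slab T ⊆ slab T' :=
  prod_mono subset_rfl (Icc_subset_Icc_right h)

theorem HasFDerivAt.norm_apply_le_of_lipschitzOn {ι : Type*} [Fintype ι] {T : ℝ}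
    {u : ℝ × ℝ → ι → ℝ} {K : ℝ≥0} (hu : LipschitzOnWith K u (slab T)) {p : ℝ × ℝ}
    (hp : slab T ∈ 𝓝 p) {D : ℝ × ℝ →L[ℝ] (ι → ℝ)} (hD : HasFDerivAt u D p) (i : ι) :
    |D (1, 0) i| ≤ K := by
  have h1 : ‖D‖ ≤ K := hD.le_of_lipschitzOn hp hu
  have h2 := D.le_opNorm (1, 0)
  have h3 := norm_le_pi_norm (D (1, 0)) i
  rw [Real.norm_eq_abs] at h3
  have h4 : ‖((1 : ℝ), (0 : ℝ))‖ = 1 := by simp [Prod.norm_def]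
  rw [h4, mul_one] at h2
  linarith

theorem IsDiagSolution.mono {ι : Type*} [Fintype ι] {lam G : ℝ → (ι → ℝ) → ι → ℝ}
    {B B' : Set (ι → ℝ)} {T T' : ℝ} {u : ℝ × ℝ → ι → ℝ} (h : IsDiagSolution lam G B T u)
    (hB : B ⊆ B') (hT : T' ≤ T) : IsDiagSolution lam G B' T' u where
  lipschitz := h.lipschitz.imp fun _ hK => hK.mono (slab_mono hT)
  mem p hp := hB (h.mem p (slab_mono hT hp))
  pde := ae_restrict_of_ae_restrict_of_subset (slab_mono hT) h.pde

/-- Both equations are read along one direction, the speed μ of `u` frozen at the end point. The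
resulting errors are (λ(u) - μ) ∂ₓu, which is of order h, and (λ(v) - μ) ∂ₓv, which is at most C(e +
O(h)) `Lv`. Thus `Lu` enters only the terms of second order in `h`. -/
theorem dist_le_add_step {ι : Type*} [Fintype ι] {lam G : ℝ → (ι → ℝ) → ι → ℝ}
    {B : Set (ι → ℝ)} {T₁ lmin Λ C : ℝ} (hb : TransportBounds lam G B T₁ lmin Λ C)
    {Lu Lv : ℝ≥0} {T : ℝ} (hT : T ≤ T₁) {u v : ℝ × ℝ → ι → ℝ}
    (hu : IsDiagSolution lam G B T u) (hv : IsDiagSolution lam G B T v)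
    (hLu : LipschitzOnWith Lu u (slab T)) (hLv : LipschitzOnWith Lv v (slab T)) {δ b : ℝ}
    (hδb : δ ≤ b) (hbd : ∀ t ∈ Icc 0 T, dist (u (0, t)) (v (0, t)) ≤ δ) {x t h : ℝ} (hx : 0 ≤ x)
    (hh : 0 < h) (hht : h ≤ t) (htT : t ≤ T)
    (hprev : ∀ y ∈ Ici (0 : ℝ), dist (u (y, t - h)) (v (y, t - h)) ≤ b) :
    dist (u (x, t)) (v (x, t)) ≤ b + h * (C * (1 + Lv) * dist (u (x, t)) (v (x, t)) +
      (C * (Lu + Lv) * (Λ + 1) + C * (1 + Lu * (Λ + 1)) * Lu + C * (1 + Lv * (Λ + 1)) * Lv) * h) := by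
  set e := dist (u (x, t)) (v (x, t)) with he
  have hC := hb.C_nonneg
  have hΛ := hb.Λ_pos
  have hLu0 : (0 : ℝ) ≤ Lu := Lu.2
  have hLv0 : (0 : ℝ) ≤ Lv := Lv.2
  have hP : (x, t) ∈ slab T := ⟨hx, by linarith, htT⟩
  have htt : t ∈ Icc 0 T₁ := ⟨by linarith, by linarith⟩
  have hb0 : 0 ≤ b := le_trans dist_nonneg (hprev 0 (by simp))
  have he0 : 0 ≤ e := dist_nonneg
  rw [he, dist_pi_le_iff (by positivity)]
  intro i
  rw [← he]
  set μ := lam t (u (x, t)) i with hμ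
  have hμ1 : lmin ≤ μ := hb.lam_lower t htt _ (hu.mem _ hP) i
  have hμ2 : μ ≤ Λ := hb.lam_upper t htt _ (hu.mem _ hP) i
  have hμ0 : 0 < μ := hb.lmin_pos.trans_le hμ1
  -- The segment runs back to time `t - h`, or stops earlier where it meets x = 0. In the first case
  -- the previous bound applies at its foot, in the second the boundary bound.
  set k := min h (x / μ) with hk
  have hk0 : 0 ≤ k := le_min hh.le (by positivity)
  have hkh : k ≤ h := min_le_left _ _
  have hkx : k * μ ≤ x := by
    have := min_le_right h (x / μ)
    rwa [← hk, le_div_iff₀ hμ0] at this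
  set M := C * (1 + Lv) * e +
      (C * (Lu + Lv) * (Λ + 1) + C * (1 + Lu * (Λ + 1)) * Lu + C * (1 + Lv * (Λ + 1)) * Lv) * h
    with hM
  have hM0 : 0 ≤ M := by positivity
  have hwL : LipschitzOnWith (Lu + Lv) (fun p => u p i - v p i) (slab T) := by
    have h1 : LipschitzOnWith Lu (fun p => u p i) (slab T) := LipschitzOnWith.of_dist_le_mul
      fun p hp q hq => (dist_le_pi_dist _ _ i).trans (hLu.dist_le_mul p hp q hq)
    have h2 : LipschitzOnWith Lv (fun p => v p i) (slab T) := LipschitzOnWith.of_dist_le_mul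
      fun p hp q hq => (dist_le_pi_dist _ _ i).trans (hLv.dist_le_mul p hp q hq)
    exact h1.sub h2
  have key := abs_sub_le_of_ae_fderiv (M := M) hwL hk0 hμ0.le (hkh.trans hht) htT hkx hh (by
    filter_upwards [hu.pde, hv.pde, ae_slab_mem_nhds T, ae_restrict_mem (measurableSet_slab T)]
      with p hpu hpv hpn hps hpb
    obtain ⟨Du, hDu, eu⟩ := hpu
    obtain ⟨Dv, hDv, ev⟩ := hpv
    refine ⟨(ContinuousLinearMap.proj i).comp (Du - Dv),
      (ContinuousLinearMap.proj (R := ℝ) (φ := fun _ : ι => ℝ) i).hasFDerivAt.comp p (hDu.sub hDv),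
      ?_⟩
    have hpt : p.2 ∈ Icc 0 T₁ := ⟨hps.2.1, hps.2.2.trans hT⟩
    have d1 : |p.2 - t| ≤ h := by
      rw [abs_le]; constructor <;> linarith [hpb.2.1, hpb.2.2]
    have d2 : dist p (x, t) ≤ h * (Λ + 1) := by
      rw [Prod.dist_eq, Real.dist_eq, Real.dist_eq]
      refine max_le ?_ ?_
      · rw [abs_le]
        have : k * μ ≤ h * Λ := mul_le_mul hkh hμ2 hμ0.le hh.le
        have : 0 ≤ h * Λ := by positivity
        constructor <;> linarith [hpb.1.1, hpb.1.2]
      · have : 0 ≤ h * Λ := by positivity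
        linarith
    have du : dist (u p) (u (x, t)) ≤ Lu * (h * (Λ + 1)) :=
      (hLu.dist_le_mul _ hps _ hP).trans (by gcongr)
    have dv : dist (v p) (v (x, t)) ≤ Lv * (h * (Λ + 1)) :=
      (hLv.dist_le_mul _ hps _ hP).trans (by gcongr)
    have duv : dist (u p) (v p) ≤ e + (Lu + Lv) * (h * (Λ + 1)) := by
      have := dist_triangle4 (u p) (u (x, t)) (v (x, t)) (v p)
      rw [dist_comm (v (x, t)) (v p)] at this
      linarith
    have dvu : dist (v p) (u (x, t)) ≤ Lv * (h * (Λ + 1)) + e := by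
      have := dist_triangle (v p) (v (x, t)) (u (x, t))
      rw [dist_comm (v (x, t)) (u (x, t))] at this
      linarith
    have a1 : |G p.2 (u p) i - G p.2 (v p) i| ≤ C * (e + (Lu + Lv) * (h * (Λ + 1))) :=
      (hb.G_lip _ hpt _ (hu.mem _ hps) _ (hv.mem _ hps) i).trans (by gcongr)
    have a2 : |lam p.2 (u p) i - μ| ≤ C * (h + Lu * (h * (Λ + 1))) :=
      (hb.lam_lip _ hpt _ htt _ (hu.mem _ hps) _ (hu.mem _ hP) i).trans (by gcongr)
    have a3 : |lam p.2 (v p) i - μ| ≤ C * (h + (Lv * (h * (Λ + 1)) + e)) :=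
      (hb.lam_lip _ hpt _ htt _ (hv.mem _ hps) _ (hu.mem _ hP) i).trans (by gcongr)
    have b2 := HasFDerivAt.norm_apply_le_of_lipschitzOn hLu hpn hDu i
    have b3 := HasFDerivAt.norm_apply_le_of_lipschitzOn hLv hpn hDv i
    have hval : ((ContinuousLinearMap.proj i).comp (Du - Dv)) ((μ, 1) : ℝ × ℝ) =
        (G p.2 (u p) i - G p.2 (v p) i) - (lam p.2 (u p) i - μ) * Du (1, 0) i
          + (lam p.2 (v p) i - μ) * Dv (1, 0) i := by
      have e0 : ((μ, 1) : ℝ × ℝ) = μ • (1, 0) + (0, 1) := by simp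
      rw [← eu i, ← ev i, e0]
      simp only [ContinuousLinearMap.comp_apply, map_add, map_smul, ContinuousLinearMap.proj_apply,
        sub_apply, Pi.sub_apply, smul_eq_mul]
      ring
    rw [hval]
    have c2 : |(lam p.2 (u p) i - μ) * Du (1, 0) i| ≤ C * (h + Lu * (h * (Λ + 1))) * Lu := by
      rw [abs_mul]; exact mul_le_mul a2 b2 (abs_nonneg _) (by positivity)
    have c3 : |(lam p.2 (v p) i - μ) * Dv (1, 0) i| ≤ C * (h + (Lv * (h * (Λ + 1)) + e)) * Lv := by
      rw [abs_mul]; exact mul_le_mul a3 b3 (abs_nonneg _) (by positivity)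
    refine (abs_add_le _ _).trans ((add_le_add (abs_sub _ _) le_rfl).trans ?_)
    refine (add_le_add (add_le_add a1 c2) c3).trans (le_of_eq ?_)
    rw [hM]; ring)
  have hland : |u (x - k * μ, t - k) i - v (x - k * μ, t - k) i| ≤ b := by
    rw [← Real.dist_eq]
    refine (dist_le_pi_dist _ _ i).trans ?_
    rcases min_choice h (x / μ) with hc | hc
    · rw [← hk] at hc
      rw [hc]
      exact hprev _ (by rw [hc] at hkx; simpa using hkx)
    · rw [← hk] at hc
      have : x - k * μ = 0 := by rw [hc]; field_simp; ring
      rw [this]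
      exact (hbd _ ⟨by linarith, by linarith⟩).trans hδb
  rw [Real.dist_eq]
  have := abs_sub_abs_le_abs_sub (u (x, t) i - v (x, t) i)
    (u (x - k * μ, t - k) i - v (x - k * μ, t - k) i)
  have : k * M ≤ h * M := mul_le_mul_of_nonneg_right hkh hM0
  linarith

/-- The step estimate is implicit, since speed and direction are frozen at the end point. It is
solved by (1 - a)(1 + 2a) ≥ 1 for 0 ≤ a ≤ 1/2. -/
theorem implicit_step_le {e b c h A : ℝ} (he : 0 ≤ e) (hA : 0 ≤ A) (hh : 0 ≤ h)
    (hhA : h * A ≤ 1 / 2) (hs : e ≤ b + h * (A * e + c * h)) :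
    e ≤ (b + c * h ^ 2) * (1 + 2 * A * h) := by
  have h1 : e * (1 - h * A) ≤ b + c * h ^ 2 := by nlinarith
  have h3 : 0 ≤ h * A := by positivity
  have h2 : 1 ≤ (1 - h * A) * (1 + 2 * A * h) := by nlinarith
  calc e = e * 1 := (mul_one e).symm
    _ ≤ e * ((1 - h * A) * (1 + 2 * A * h)) := mul_le_mul_of_nonneg_left h2 he
    _ = (e * (1 - h * A)) * (1 + 2 * A * h) := by ring
    _ ≤ _ := mul_le_mul_of_nonneg_right h1 (by positivity)

/-- Lipschitz solutions of a diagonal system depend continuously on their data. -/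
theorem dist_le_mul_exp_of_isDiagSolution {ι : Type*} [Fintype ι] {lam G : ℝ → (ι → ℝ) → ι → ℝ}
    {B : Set (ι → ℝ)} {T₁ lmin Λ C : ℝ} (hb : TransportBounds lam G B T₁ lmin Λ C)
    {Lv : ℝ≥0} {T : ℝ} (hT : T ≤ T₁) {u v : ℝ × ℝ → ι → ℝ}
    (hu : IsDiagSolution lam G B T u) (hv : IsDiagSolution lam G B T v)
    (hLv : LipschitzOnWith Lv v (slab T)) {δ : ℝ}
    (hin : ∀ x ∈ Ici (0 : ℝ), dist (u (x, 0)) (v (x, 0)) ≤ δ)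
    (hbd : ∀ t ∈ Icc 0 T, dist (u (0, t)) (v (0, t)) ≤ δ) :
    ∀ p ∈ slab T, dist (u p) (v p) ≤ δ * Real.exp (2 * (C * (1 + Lv)) * T) := by
  obtain ⟨Lu, hLu⟩ := hu.lipschitz
  rintro ⟨x, t⟩ ⟨hx, ht0, htT⟩
  simp only [mem_Ici] at hx ht0 htT
  have hC := hb.C_nonneg
  have hΛ := hb.Λ_pos
  have hLu0 : (0 : ℝ) ≤ Lu := Lu.2
  have hLv0 : (0 : ℝ) ≤ Lv := Lv.2
  have hδ0 : 0 ≤ δ := dist_nonneg.trans (hin 0 (by simp))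
  set A := C * (1 + Lv) with hA
  set D := C * (Lu + Lv) * (Λ + 1) + C * (1 + Lu * (Λ + 1)) * Lu + C * (1 + Lv * (Λ + 1)) * Lv
    with hD
  have hA0 : 0 ≤ A := by positivity
  have hD0 : 0 ≤ D := by positivity
  have hexp : δ ≤ δ * Real.exp (2 * A * T) :=
    le_mul_of_one_le_right hδ0 (Real.one_le_exp (by have := ht0.trans htT; positivity))
  rcases ht0.eq_or_lt with h0 | h0
  · subst h0; exact (hin x hx).trans hexp
  -- With `N` equal steps the quadratic errors add up to D t h, which vanishes as `N` grows. The
  -- lower bound on `N` makes the step short enough for `implicit_step_le`.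
  have main : ∀ N : ℕ, 2 * A * t ≤ N → 0 < N →
      dist (u (x, t)) (v (x, t)) ≤ (δ + D * t * (t / N)) * Real.exp (2 * A * T) := by
    intro N hN hN0
    have hN0' : (0 : ℝ) < N := by exact_mod_cast hN0
    set h := t / N with hh
    have hh0 : 0 < h := by positivity
    have hhA : h * A ≤ 1 / 2 := by
      rw [hh, div_mul_eq_mul_div, div_le_iff₀ hN0']; linarith
    have hNh : N * h = t := by rw [hh]; field_simp
    have step : ∀ m : ℕ, m ≤ N → ∀ y ∈ Ici (0 : ℝ),
        dist (u (y, m * h)) (v (y, m * h)) ≤ (δ + m * (D * h ^ 2)) * (1 + 2 * A * h) ^ m := by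
      intro m
      induction m with
      | zero => intro _ y hy; simpa using hin y hy
      | succ m ih =>
        intro hm y hy
        have hmh : ((m + 1 : ℕ) : ℝ) * h ≤ t := by
          rw [← hNh]; exact mul_le_mul_of_nonneg_right (by exact_mod_cast hm) hh0.le
        have hsub : ((m + 1 : ℕ) : ℝ) * h - h = m * h := by push_cast; ring
        set b := (δ + m * (D * h ^ 2)) * (1 + 2 * A * h) ^ m with hbdef
        have hpow : 1 ≤ (1 + 2 * A * h) ^ m := one_le_pow₀ (by
          have : 0 ≤ 2 * A * h := by positivity
          linarith)
        have hδb : δ ≤ b := by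
          have h1 : δ ≤ δ + m * (D * h ^ 2) := le_add_of_nonneg_right (by positivity)
          exact h1.trans (le_mul_of_one_le_right (hδ0.trans h1) hpow)
        have hs := dist_le_add_step hb hT hu hv hLu hLv hδb hbd (x := y) (t := ((m + 1 : ℕ) : ℝ) * h)
          (h := h) hy hh0 (by push_cast; nlinarith [(Nat.cast_nonneg m : (0 : ℝ) ≤ m)])
          (hmh.trans htT) (by rw [hsub]; exact ih (by omega))
        rw [← hA, ← hD] at hs
        have hstep := implicit_step_le dist_nonneg hA0 hh0.le hhA hs
        refine hstep.trans ?_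
        rw [pow_succ (1 + 2 * A * h), ← mul_assoc (δ + ((m + 1 : ℕ) : ℝ) * (D * h ^ 2))]
        refine mul_le_mul_of_nonneg_right ?_ (show 0 ≤ 1 + 2 * A * h by positivity)
        have : D * h ^ 2 ≤ D * h ^ 2 * (1 + 2 * A * h) ^ m :=
          le_mul_of_one_le_right (by positivity) hpow
        have e2 : (δ + ((m + 1 : ℕ) : ℝ) * (D * h ^ 2)) * (1 + 2 * A * h) ^ m =
            b + D * h ^ 2 * (1 + 2 * A * h) ^ m := by rw [hbdef]; push_cast; ring
        rw [e2]
        linarith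
    have := step N le_rfl x hx
    rw [hNh] at this
    refine this.trans ?_
    have e1 : (N : ℝ) * (D * h ^ 2) = D * t * h := by rw [← hNh]; ring
    rw [e1]
    refine mul_le_mul_of_nonneg_left ?_ (by positivity)
    calc (1 + 2 * A * h) ^ N ≤ (Real.exp (2 * A * h)) ^ N := by
          gcongr; linarith [Real.add_one_le_exp (2 * A * h)]
      _ = Real.exp (2 * A * t) := by rw [← Real.exp_nat_mul, ← hNh]; ring_nf
      _ ≤ _ := by gcongr
  have hlim : Filter.Tendsto (fun N : ℕ => (δ + D * t * (t / N)) * Real.exp (2 * A * T)) Filter.atTop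
      (𝓝 ((δ + D * t * 0) * Real.exp (2 * A * T))) :=
    (((tendsto_const_div_atTop_nhds_zero_nat t).const_mul _).const_add _).mul_const _
  simp only [mul_zero, add_zero] at hlim
  refine ge_of_tendsto hlim ?_
  filter_upwards [Filter.eventually_ge_atTop (max 1 ⌈2 * A * t⌉₊)] with N hN
  exact main N (Nat.ceil_le.1 ((le_max_right _ _).trans hN)) (le_of_max_le_left hN)

/-! ### The upwind scheme and its uniform bounds -/

/-- The explicit upwind scheme for `∂ₜ uᵢ + lamᵢ ∂ₓ uᵢ = Gᵢ` with time step `h` and space step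
`Λ h`. -/
noncomputable def upwind {ι : Type*} (lam G : ℝ → (ι → ℝ) → ι → ℝ) (Λ h : ℝ) (g d : ℝ → ι → ℝ) :
    ℕ → ℕ → ι → ℝ
  | 0, j => g (j * (Λ * h))
  | n + 1, 0 => d ((n + 1 : ℕ) * h)
  | n + 1, j + 1 => fun i =>
      (1 - lam (n * h) (upwind lam G Λ h g d n (j + 1)) i / Λ) *
          upwind lam G Λ h g d n (j + 1) i +
        lam (n * h) (upwind lam G Λ h g d n (j + 1)) i / Λ * upwind lam G Λ h g d n j i +
        h * G (n * h) (upwind lam G Λ h g d n (j + 1)) i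

/-- A grid function which satisfies the upwind scheme up to time `T`, with values in `B` and
Lipschitz bounds `L` in space and `M` in time. -/
structure IsUpwind {ι : Type*} (lam G : ℝ → (ι → ℝ) → ι → ℝ) (B : Set (ι → ℝ)) (Λ h T L M : ℝ)
    (U : ℕ → ℕ → ι → ℝ) : Prop where
  mem : ∀ n : ℕ, n * h ≤ T → ∀ j, U n j ∈ B
  space : ∀ n : ℕ, n * h ≤ T → ∀ j i, |U n (j + 1) i - U n j i| ≤ L * (Λ * h)
  time : ∀ n : ℕ, (n + 1 : ℕ) * h ≤ T → ∀ j i, |U (n + 1) j i - U n j i| ≤ M * h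
  update : ∀ n j i, U (n + 1) (j + 1) i = (1 - lam (n * h) (U n (j + 1)) i / Λ) * U n (j + 1) i +
    lam (n * h) (U n (j + 1)) i / Λ * U n j i + h * G (n * h) (U n (j + 1)) i

section Bounds

variable {ι : Type*} [Fintype ι] {lam G : ℝ → (ι → ℝ) → ι → ℝ} {u₀ : ι → ℝ}
  {r T₁ lmin Λ C h T : ℝ} {K : ℝ≥0} {g d : ℝ → ι → ℝ}

/-- Since 0 ≤ lam / Λ ≤ 1, the transport part is a convex combination and moves no value away from
`u₀` beyond its neighbours. Only the source does, by at most `h * C` per step. The condition `T * C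
≤ r / 2` keeps all values in the ball where these bounds are available, so membership and estimate
are proved together. -/
theorem upwind_near (hb : TransportBounds lam G (Metric.closedBall u₀ r) T₁ lmin Λ C)
    (hh : 0 ≤ h) (hT : T ≤ T₁) (hTC : T * C ≤ r / 2) (hg : ∀ x ∈ Ici (0 : ℝ), dist (g x) u₀ ≤ r / 2)
    (hd : ∀ t ∈ Icc 0 T, dist (d t) u₀ ≤ r / 2) :
    ∀ n : ℕ, n * h ≤ T → ∀ j, upwind lam G Λ h g d n j ∈ Metric.closedBall u₀ r ∧
      ∀ i, |upwind lam G Λ h g d n j i - u₀ i| ≤ r / 2 + n * h * C := by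
  have hC := hb.C_nonneg
  have hΛ := hb.Λ_pos
  have hmem : ∀ n : ℕ, n * h ≤ T → ∀ v : ι → ℝ, (∀ i, |v i - u₀ i| ≤ r / 2 + n * h * C) →
      v ∈ Metric.closedBall u₀ r := by
    intro n hn v hv
    have h1 : n * h * C ≤ r / 2 := (mul_le_mul_of_nonneg_right hn hC).trans hTC
    have h0 : 0 ≤ n * h * C := by positivity
    rw [Metric.mem_closedBall, dist_pi_le_iff (by linarith)]
    intro i
    rw [Real.dist_eq]
    linarith [hv i]
  intro n
  induction n with
  | zero =>
    intro hn j
    have h1 : ∀ i, |upwind lam G Λ h g d 0 j i - u₀ i| ≤ r / 2 + (0 : ℕ) * h * C := fun i => by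
      have := hg (j * (Λ * h)) (by simp only [mem_Ici]; positivity)
      simpa [upwind, Real.dist_eq] using (dist_le_pi_dist (g (j * (Λ * h))) u₀ i).trans this
    exact ⟨hmem 0 hn _ h1, h1⟩
  | succ n ih =>
    intro hn j
    have hnn : (n : ℝ) * h ≤ T := by push_cast at hn; nlinarith
    have hnT : (n : ℝ) * h ∈ Icc 0 T₁ := ⟨by positivity, hnn.trans hT⟩
    have h1 : ∀ i, |upwind lam G Λ h g d (n + 1) j i - u₀ i| ≤ r / 2 + (n + 1 : ℕ) * h * C := by
      intro i
      cases j with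
      | zero =>
        have := hd ((n + 1 : ℕ) * h) ⟨by positivity, hn⟩
        have h2 : 0 ≤ (n + 1 : ℕ) * h * C := by positivity
        have h3 := (dist_le_pi_dist (d ((n + 1 : ℕ) * h)) u₀ i).trans this
        rw [Real.dist_eq] at h3
        simp only [upwind]
        linarith
      | succ j =>
        simp only [upwind]
        set a := upwind lam G Λ h g d n (j + 1)
        set b := upwind lam G Λ h g d n j
        have ha := ih hnn (j + 1)
        have hbb := ih hnn j
        set θ := lam (n * h) a i / Λ with hθ
        have θ0 : 0 ≤ θ := div_nonneg (hb.lmin_pos.le.trans (hb.lam_lower _ hnT _ ha.1 i)) hΛ.le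
        have θ1 : θ ≤ 1 := (div_le_one hΛ).2 (hb.lam_upper _ hnT _ ha.1 i)
        have e1 := abs_le.1 (ha.2 i)
        have e2 := abs_le.1 (hbb.2 i)
        have e3 := abs_le.1 (hb.G_bound _ hnT _ ha.1 i)
        push_cast
        rw [abs_le]
        constructor <;> nlinarith
    exact ⟨hmem _ hn _ h1, h1⟩

/-- This is a discrete Riccati estimate. Differences of neighbours again satisfy a convex
combination, with an error quadratic in the slope from the variation of the speed and a linear one
from the source. While the slope is below 2L, it grows at rate at most 4CL² + 2CL, and the time
restriction keeps it there. -/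
theorem abs_upwind_diff_le (hb : TransportBounds lam G (Metric.closedBall u₀ r) T₁ lmin Λ C)
    (hh : 0 < h) (hT : T ≤ T₁) (hg : LipschitzOnWith K g (Ici 0))
    (hd : LipschitzOnWith K d (Icc 0 T)) (hgd : g 0 = d 0) {L : ℝ} (hKL : K ≤ L)
    (hL : K + C ≤ L * lmin) (hTL : T * (4 * C * L ^ 2 + 2 * C * L) ≤ L)
    (hmem : ∀ n : ℕ, n * h ≤ T → ∀ j, upwind lam G Λ h g d n j ∈ Metric.closedBall u₀ r) :
    ∀ n : ℕ, n * h ≤ T → ∀ j i, |upwind lam G Λ h g d n (j + 1) i - upwind lam G Λ h g d n j i| ≤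
      (L + n * h * (4 * C * L ^ 2 + 2 * C * L)) * (Λ * h) := by
  have hC := hb.C_nonneg
  have hΛ := hb.Λ_pos
  have hK0 : (0 : ℝ) ≤ K := K.2
  have hL0 : 0 ≤ L := hK0.trans hKL
  set c := 4 * C * L ^ 2 + 2 * C * L with hc
  have hc0 : 0 ≤ c := by positivity
  intro n
  induction n with
  | zero =>
    intro _ j i
    simp only [upwind]
    have h1 := hg.dist_le_mul ((j + 1 : ℕ) * (Λ * h)) (by simp only [mem_Ici]; positivity)
      (j * (Λ * h)) (by simp only [mem_Ici]; positivity)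
    have h2 := (dist_le_pi_dist _ _ i).trans h1
    have h3 : dist (((j + 1 : ℕ) : ℝ) * (Λ * h)) (j * (Λ * h)) = Λ * h := by
      rw [Real.dist_eq]
      have : ((j + 1 : ℕ) : ℝ) * (Λ * h) - j * (Λ * h) = Λ * h := by push_cast; ring
      rw [this, abs_of_pos (by positivity)]
    rw [h3, Real.dist_eq] at h2
    refine h2.trans ?_
    have : K * (Λ * h) ≤ L * (Λ * h) := mul_le_mul_of_nonneg_right hKL (by positivity)
    simpa using this
  | succ n ih =>
    intro hn j i
    have hnn : (n : ℝ) * h ≤ T := by push_cast at hn; nlinarith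
    have hnT : (n : ℝ) * h ∈ Icc 0 T₁ := ⟨by positivity, hnn.trans hT⟩
    have hLn : n * h * c ≤ L := (mul_le_mul_of_nonneg_right hnn hc0).trans hTL
    have hLn0 : 0 ≤ n * h * c := by positivity
    set Ln := L + n * h * c with hLndef
    have hLn1 : L ≤ Ln := by linarith
    have hLn2 : Ln ≤ 2 * L := by linarith
    have hsucc : L + ((n + 1 : ℕ) : ℝ) * h * c = Ln + h * c := by push_cast; ring
    rw [hsucc]
    have ihd := ih hnn
    have hΔ : 0 ≤ Λ * h := by positivity
    cases j with
    | zero =>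
      have ha := hmem n hnn 1
      have hd0 : |d ((n + 1 : ℕ) * h) i - upwind lam G Λ h g d n 0 i| ≤ K * h := by
        have e0 : upwind lam G Λ h g d n 0 = d (n * h) := by
          cases n with
          | zero => simpa [upwind] using hgd
          | succ n => simp only [upwind]
        have h1 := hd.dist_le_mul ((n + 1 : ℕ) * h) ⟨by positivity, hn⟩ (n * h)
          ⟨by positivity, hnn⟩
        have h2 := (dist_le_pi_dist _ _ i).trans h1
        have h3 : dist (((n + 1 : ℕ) : ℝ) * h) (n * h) = h := by
          rw [Real.dist_eq]
          have : ((n + 1 : ℕ) : ℝ) * h - n * h = h := by push_cast; ring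
          rw [this, abs_of_pos hh]
        rw [h3, Real.dist_eq] at h2
        rw [e0]; exact h2
      have h01 := ihd 0 i
      simp only [upwind, zero_add] at h01 ⊢
      set a := upwind lam G Λ h g d n 1
      set b := upwind lam G Λ h g d n 0
      set l := lam (n * h) a i with hl
      have l0 : lmin ≤ l := hb.lam_lower _ hnT _ ha i
      have l1 : l ≤ Λ := hb.lam_upper _ hnT _ ha i
      have hG := hb.G_bound _ hnT _ ha i
      have θ0 : 0 ≤ l / Λ := div_nonneg (hb.lmin_pos.le.trans l0) hΛ.le
      have θ1 : l / Λ ≤ 1 := (div_le_one hΛ).2 l1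
      have e : (1 - l / Λ) * a i + l / Λ * b i + h * G (n * h) a i - d ((n + 1 : ℕ) * h) i =
        (1 - l / Λ) * (a i - b i) + h * G (n * h) a i - (d ((n + 1 : ℕ) * h) i - b i) := by ring
      rw [e]
      have f1 : |(1 - l / Λ) * (a i - b i)| ≤ (1 - l / Λ) * (Ln * (Λ * h)) := by
        rw [abs_mul, abs_of_nonneg (by linarith)]
        exact mul_le_mul_of_nonneg_left h01 (by linarith)
      have f2 : |h * G (n * h) a i| ≤ h * C := by
        rw [abs_mul, abs_of_pos hh]; exact mul_le_mul_of_nonneg_left hG hh.le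
      -- In the first cell only the share 1 - l/Λ of the old slope survives. The loss `Ln * l * h`
      -- is at least `L * lmin * h`, which absorbs the source and the increment of the boundary
      -- values.
      have f3 : (1 - l / Λ) * (Ln * (Λ * h)) = Ln * (Λ * h) - Ln * l * h := by
        field_simp
      have f4 : L * lmin ≤ Ln * l := mul_le_mul hLn1 l0 hb.lmin_pos.le (by linarith)
      have f5 : (K + C) * h ≤ Ln * l * h := mul_le_mul_of_nonneg_right (hL.trans f4) hh.le
      have f6 : 0 ≤ h * c * (Λ * h) := by positivity
      have := abs_sub ((1 - l / Λ) * (a i - b i) + h * G (n * h) a i) (d ((n + 1 : ℕ) * h) i - b i)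
      have := abs_add_le ((1 - l / Λ) * (a i - b i)) (h * G (n * h) a i)
      linarith
    | succ j =>
      have ha := hmem n hnn (j + 1 + 1)
      have hb' := hmem n hnn (j + 1)
      have D2 := ihd (j + 1)
      have D1 := ihd j i
      simp only [upwind]
      set a := upwind lam G Λ h g d n (j + 1 + 1)
      set b := upwind lam G Λ h g d n (j + 1)
      set z := upwind lam G Λ h g d n j
      set l := lam (n * h) a i with hl
      set l' := lam (n * h) b i with hl'
      have l0 : lmin ≤ l := hb.lam_lower _ hnT _ ha i
      have l1 : l ≤ Λ := hb.lam_upper _ hnT _ ha i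
      have θ0 : 0 ≤ l / Λ := div_nonneg (hb.lmin_pos.le.trans l0) hΛ.le
      have θ1 : l / Λ ≤ 1 := (div_le_one hΛ).2 l1
      have hdist : dist a b ≤ 2 * L * (Λ * h) := by
        rw [dist_pi_le_iff (by positivity)]
        intro i'
        rw [Real.dist_eq]
        exact (D2 i').trans (mul_le_mul_of_nonneg_right hLn2 hΔ)
      have hll : |l - l'| ≤ C * (2 * L * (Λ * h)) := by
        have := hb.lam_lip _ hnT _ hnT _ ha _ hb' i
        rw [sub_self, abs_zero, zero_add] at this
        exact this.trans (mul_le_mul_of_nonneg_left hdist hC)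
      have hGG : |G (n * h) a i - G (n * h) b i| ≤ C * (2 * L * (Λ * h)) :=
        (hb.G_lip _ hnT _ ha _ hb' i).trans (mul_le_mul_of_nonneg_left hdist hC)
      have e : (1 - l / Λ) * a i + l / Λ * b i + h * G (n * h) a i -
          ((1 - l' / Λ) * b i + l' / Λ * z i + h * G (n * h) b i) =
          (1 - l / Λ) * (a i - b i) + l / Λ * (b i - z i) - (l - l') / Λ * (b i - z i) +
            h * (G (n * h) a i - G (n * h) b i) := by ring
      rw [e]
      have f1 : |(1 - l / Λ) * (a i - b i)| ≤ (1 - l / Λ) * (Ln * (Λ * h)) := by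
        rw [abs_mul, abs_of_nonneg (by linarith)]
        exact mul_le_mul_of_nonneg_left (D2 i) (by linarith)
      have f2 : |l / Λ * (b i - z i)| ≤ l / Λ * (Ln * (Λ * h)) := by
        rw [abs_mul, abs_of_nonneg θ0]
        exact mul_le_mul_of_nonneg_left D1 θ0
      have f3 : |(l - l') / Λ * (b i - z i)| ≤ C * (2 * L * (Λ * h)) / Λ * (2 * L * (Λ * h)) := by
        rw [abs_mul, abs_div, abs_of_pos hΛ]
        refine mul_le_mul (div_le_div_of_nonneg_right hll hΛ.le)
          (D1.trans (mul_le_mul_of_nonneg_right hLn2 hΔ)) (abs_nonneg _) (by positivity)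
      have f4 : |h * (G (n * h) a i - G (n * h) b i)| ≤ h * (C * (2 * L * (Λ * h))) := by
        rw [abs_mul, abs_of_pos hh]; exact mul_le_mul_of_nonneg_left hGG hh.le
      have f5 : C * (2 * L * (Λ * h)) / Λ * (2 * L * (Λ * h)) + h * (C * (2 * L * (Λ * h))) =
          h * c * (Λ * h) := by rw [hc]; field_simp; ring
      have g1 := abs_add_le ((1 - l / Λ) * (a i - b i) + l / Λ * (b i - z i) -
        (l - l') / Λ * (b i - z i)) (h * (G (n * h) a i - G (n * h) b i))
      have g2 := abs_sub ((1 - l / Λ) * (a i - b i) + l / Λ * (b i - z i))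
        ((l - l') / Λ * (b i - z i))
      have g3 := abs_add_le ((1 - l / Λ) * (a i - b i)) (l / Λ * (b i - z i))
      linarith

theorem isUpwind_upwind (hb : TransportBounds lam G (Metric.closedBall u₀ r) T₁ lmin Λ C)
    (hh : 0 < h) (hT : T ≤ T₁) (hTC : T * C ≤ r / 2)
    (hg₀ : ∀ x ∈ Ici (0 : ℝ), dist (g x) u₀ ≤ r / 2)
    (hd₀ : ∀ t ∈ Icc 0 T, dist (d t) u₀ ≤ r / 2) (hg : LipschitzOnWith K g (Ici 0))
    (hd : LipschitzOnWith K d (Icc 0 T)) (hgd : g 0 = d 0) {L : ℝ} (hKL : K ≤ L)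
    (hL : K + C ≤ L * lmin) (hTL : T * (4 * C * L ^ 2 + 2 * C * L) ≤ L) :
    IsUpwind lam G (Metric.closedBall u₀ r) Λ h T (2 * L) (2 * L * Λ + C + K)
      (upwind lam G Λ h g d) := by
  have hC := hb.C_nonneg
  have hΛ := hb.Λ_pos
  have hK0 : (0 : ℝ) ≤ K := K.2
  have hL0 : 0 ≤ L := hK0.trans hKL
  have hnear := upwind_near hb hh.le hT hTC hg₀ hd₀
  have hdiff := abs_upwind_diff_le hb hh hT hg hd hgd hKL hL hTL fun n hn j => (hnear n hn j).1
  have hspace : ∀ n : ℕ, n * h ≤ T → ∀ j i,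
      |upwind lam G Λ h g d n (j + 1) i - upwind lam G Λ h g d n j i| ≤ 2 * L * (Λ * h) := by
    intro n hn j i
    have h1 : n * h * (4 * C * L ^ 2 + 2 * C * L) ≤ L :=
      (mul_le_mul_of_nonneg_right hn (by positivity)).trans hTL
    exact (hdiff n hn j i).trans (mul_le_mul_of_nonneg_right (by linarith) (by positivity))
  refine ⟨fun n hn j => (hnear n hn j).1, hspace, ?_, fun n j i => by simp only [upwind]⟩
  intro n hn j i
  have hnn : (n : ℝ) * h ≤ T := by push_cast at hn; nlinarith
  have hnT : (n : ℝ) * h ∈ Icc 0 T₁ := ⟨by positivity, hnn.trans hT⟩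
  cases j with
  | zero =>
    have e0 : upwind lam G Λ h g d n 0 = d (n * h) := by
      cases n with
      | zero => simpa [upwind] using hgd
      | succ n => simp only [upwind]
    have h1 := hd.dist_le_mul ((n + 1 : ℕ) * h) ⟨by positivity, hn⟩ (n * h)
      ⟨by positivity, hnn⟩
    have h2 := (dist_le_pi_dist _ _ i).trans h1
    have h3 : dist (((n + 1 : ℕ) : ℝ) * h) (n * h) = h := by
      rw [Real.dist_eq]
      have : ((n + 1 : ℕ) : ℝ) * h - n * h = h := by push_cast; ring
      rw [this, abs_of_pos hh]
    rw [h3, Real.dist_eq] at h2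
    rw [e0, upwind]
    refine h2.trans (mul_le_mul_of_nonneg_right ?_ hh.le)
    have : 0 ≤ 2 * L * Λ := by positivity
    linarith
  | succ j =>
    have ha := (hnear n hnn (j + 1)).1
    have D := hspace n hnn j i
    simp only [upwind]
    set a := upwind lam G Λ h g d n (j + 1)
    set b := upwind lam G Λ h g d n j
    set l := lam (n * h) a i with hl
    have l0 : lmin ≤ l := hb.lam_lower _ hnT _ ha i
    have l1 : l ≤ Λ := hb.lam_upper _ hnT _ ha i
    have θ0 : 0 ≤ l / Λ := div_nonneg (hb.lmin_pos.le.trans l0) hΛ.le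
    have θ1 : l / Λ ≤ 1 := (div_le_one hΛ).2 l1
    have e : (1 - l / Λ) * a i + l / Λ * b i + h * G (n * h) a i - a i =
        h * G (n * h) a i - l / Λ * (a i - b i) := by ring
    rw [e]
    have f1 : |h * G (n * h) a i| ≤ h * C := by
      rw [abs_mul, abs_of_pos hh]
      exact mul_le_mul_of_nonneg_left (hb.G_bound _ hnT _ ha i) hh.le
    have f2 : |l / Λ * (a i - b i)| ≤ 1 * (2 * L * (Λ * h)) := by
      rw [abs_mul, abs_of_nonneg θ0]
      exact mul_le_mul θ1 D (abs_nonneg _) zero_le_one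
    have := abs_sub (h * G (n * h) a i) (l / Λ * (a i - b i))
    have : 0 ≤ K * h := by positivity
    linarith

end Bounds

theorem abs_sub_le_mul_of_succ {f : ℕ → ℝ} {a : ℝ} {N : ℕ}
    (hf : ∀ n, n < N → |f (n + 1) - f n| ≤ a) {m n : ℕ} (hm : m ≤ N) (hn : n ≤ N) :
    |f m - f n| ≤ a * |(m : ℝ) - n| := by
  wlog h : n ≤ m generalizing m n
  · rw [abs_sub_comm, abs_sub_comm (m : ℝ)]
    exact this hn hm (by omega)
  induction m, h using Nat.le_induction with
  | base => simp
  | succ m hnm ih =>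
    have h1 := ih (by omega)
    have h2 := hf m (by omega)
    have h3 : (n : ℝ) ≤ m := by exact_mod_cast hnm
    have h3' : (n : ℝ) ≤ ((m + 1 : ℕ) : ℝ) := by push_cast; linarith
    rw [abs_of_nonneg (sub_nonneg.2 h3)] at h1
    rw [abs_of_nonneg (sub_nonneg.2 h3')]
    have h4 := abs_sub_le (f (m + 1)) (f m) (f n)
    push_cast
    linarith

theorem IsUpwind.abs_sub_le {ι : Type*} {lam G : ℝ → (ι → ℝ) → ι → ℝ} {B : Set (ι → ℝ)}
    {Λ h T L M : ℝ} {U : ℕ → ℕ → ι → ℝ} (hU : IsUpwind lam G B Λ h T L M U) (hh : 0 ≤ h)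
    {m n : ℕ} (hm : m * h ≤ T) (hn : n * h ≤ T) (j l : ℕ) (i : ι) :
    |U m j i - U n l i| ≤ L * (Λ * h) * |(j : ℝ) - l| + M * h * |(m : ℝ) - n| := by
  have h1 : |U m j i - U m l i| ≤ L * (Λ * h) * |(j : ℝ) - l| :=
    abs_sub_le_mul_of_succ (f := fun j => U m j i) (N := max j l)
      (fun k _ => hU.space m hm k i) (le_max_left _ _) (le_max_right _ _)
  have h2 : |U m l i - U n l i| ≤ M * h * |(m : ℝ) - n| := by
    refine abs_sub_le_mul_of_succ (f := fun m => U m l i) (N := max m n)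
      (fun k hk => hU.time k ?_ l i) (le_max_left _ _) (le_max_right _ _)
    have h3 : ((k + 1 : ℕ) : ℝ) ≤ max (m : ℝ) n := by
      rw [← Nat.cast_max]; exact_mod_cast hk
    rcases le_max_iff.1 h3 with h4 | h4
    · exact (mul_le_mul_of_nonneg_right h4 hh).trans hm
    · exact (mul_le_mul_of_nonneg_right h4 hh).trans hn
  linarith [_root_.abs_sub_le (U m j i) (U m l i) (U n l i)]

/-! ### Comparison with transport at constant speed -/

/-- Quadratic barrier for the constant-coefficient upwind scheme. -/
theorem abs_le_barrier {a : ℕ → ℕ → ℝ} {θ v c₀ c Δ y e : ℝ} {M J : ℕ} (hθ0 : 0 ≤ θ) (hθ1 : θ ≤ 1)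
    (hc : 0 ≤ c) (hMJ : M ≤ J)
    (h0 : ∀ j, |a 0 j - v| ≤ c₀ + c * (j * Δ - y) ^ 2)
    (hstep : ∀ m j, m < M → J ≤ j + (M - m) → j + 1 ≤ J →
      |a (m + 1) (j + 1) - (1 - θ) * a m (j + 1) - θ * a m j| ≤ e) :
    |a M J - v| ≤ c₀ + c * ((J * Δ - y - M * (θ * Δ)) ^ 2 + M * Δ ^ 2) + M * e := by
  have key : ∀ m, m ≤ M → ∀ j, J ≤ j + (M - m) → j ≤ J →
      |a m j - v| ≤ c₀ + c * ((j * Δ - y - m * (θ * Δ)) ^ 2 + m * Δ ^ 2) + m * e := by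
    intro m
    induction m with
    | zero => intro _ j _ _; simpa using h0 j
    | succ m ih =>
      intro hm j hj1 hj2
      obtain ⟨j, rfl⟩ : ∃ j', j = j' + 1 := ⟨j - 1, by omega⟩
      have h1 := ih (by omega) (j + 1) (by omega) hj2
      have h2 := ih (by omega) j (by omega) (by omega)
      have h3 := hstep m j (by omega) (by omega) hj2
      have e1 : a (m + 1) (j + 1) - v = (a (m + 1) (j + 1) - (1 - θ) * a m (j + 1) - θ * a m j) +
        ((1 - θ) * (a m (j + 1) - v) + θ * (a m j - v)) := by ring
      have f1 := mul_le_mul_of_nonneg_left h1 (sub_nonneg.2 hθ1)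
      have f2 := mul_le_mul_of_nonneg_left h2 hθ0
      rw [← abs_of_nonneg (sub_nonneg.2 hθ1), ← abs_mul, abs_of_nonneg (sub_nonneg.2 hθ1)] at f1
      rw [← abs_of_nonneg hθ0, ← abs_mul, abs_of_nonneg hθ0] at f2
      rw [e1]
      refine (abs_add_le _ _).trans ((add_le_add h3 ((abs_add_le _ _).trans
        (add_le_add f1 f2))).trans ?_)
      -- The scheme averages over a random walk which moves by Δ with probability θ. One step adds
      -- the variance θ(1 - θ)Δ² to the mean square displacement, and the barrier allows Δ².
      have hvar : 0 ≤ c * ((1 - θ * (1 - θ)) * Δ ^ 2) :=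
        mul_nonneg hc (mul_nonneg (by nlinarith) (sq_nonneg _))
      push_cast
      linear_combination hvar
  exact key M le_rfl J (by omega) le_rfl

/-- In the backward cone of the node, speed and source are within `e` of constants. Subtracting the
accumulated constant source leaves the constant-coefficient scheme with a small defect, to which the
quadratic barrier applies. -/
theorem IsUpwind.abs_sub_transport_le {ι : Type*} {lam G : ℝ → (ι → ℝ) → ι → ℝ} {B : Set (ι → ℝ)}
    {Λ h T L M : ℝ} {U : ℕ → ℕ → ι → ℝ} (hU : IsUpwind lam G B Λ h T L M U) (hh : 0 < h)
    (hΛ : 0 < Λ) (hL : 0 ≤ L) {n₀ k J j₀ : ℕ} (hk : (n₀ + k : ℕ) * h ≤ T) (hkJ : k ≤ J) {i : ι}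
    {l G₀ e ε : ℝ} (hl0 : 0 ≤ l) (hl1 : l ≤ Λ) (hε : 0 < ε)
    (hwin : ∀ m j : ℕ, m < k → J ≤ j + (k - m) → j + 1 ≤ J →
      |lam ((n₀ + m : ℕ) * h) (U (n₀ + m) (j + 1)) i - l| ≤ e ∧
        |G ((n₀ + m : ℕ) * h) (U (n₀ + m) (j + 1)) i - G₀| ≤ e) :
    |U (n₀ + k) J i - k * h * G₀ - U n₀ j₀ i| ≤ L * ε / 2 +
      L / (2 * ε) * ((J * (Λ * h) - j₀ * (Λ * h) - k * h * l) ^ 2 + k * h * (Λ ^ 2 * h)) +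
        k * h * ((L + 1) * e) := by
  have hn : ∀ m ≤ k, ((n₀ + m : ℕ) : ℝ) * h ≤ T := fun m hm =>
    (mul_le_mul_of_nonneg_right (by exact_mod_cast (by omega : n₀ + m ≤ n₀ + k)) hh.le).trans hk
  have := abs_le_barrier (a := fun m j => U (n₀ + m) j i - m * h * G₀) (θ := l / Λ)
    (v := U n₀ j₀ i) (c₀ := L * ε / 2) (c := L / (2 * ε)) (Δ := Λ * h) (y := j₀ * (Λ * h))
    (e := h * ((L + 1) * e)) (M := k) (J := J) (by positivity) ((div_le_one hΛ).2 hl1)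
    (by positivity) hkJ ?_ ?_
  · have e1 : l / Λ * (Λ * h) = h * l := by field_simp
    rw [e1] at this
    refine this.trans (le_of_eq ?_)
    ring
  · intro j
    have h1 := hU.abs_sub_le hh.le (hn 0 (by omega)) (hn 0 (by omega)) j j₀ i
    simp only [add_zero, sub_self, abs_zero, mul_zero, Nat.cast_zero, zero_mul, sub_zero] at h1 ⊢
    set z := (j : ℝ) * (Λ * h) - j₀ * (Λ * h) with hz
    have e1 : L * (Λ * h) * |(j : ℝ) - j₀| = L * |z| := by
      rw [hz, ← sub_mul, abs_mul, abs_of_pos (by positivity : 0 < Λ * h)]; ring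
    rw [e1] at h1
    -- Young's inequality puts the Lipschitz bound L|z| under a parabola, as the barrier requires.
    have e2 : L * ε / 2 + L / (2 * ε) * z ^ 2 - L * |z| = L / (2 * ε) * (ε - |z|) ^ 2 := by
      rw [← sq_abs z]; field_simp; ring
    have : 0 ≤ L / (2 * ε) * (ε - |z|) ^ 2 := by positivity
    linarith
  · intro m j hm hj1 hj2
    obtain ⟨w1, w2⟩ := hwin m j hm hj1 hj2
    have hs := hU.space (n₀ + m) (hn m hm.le) j i
    have hup := hU.update (n₀ + m) j i
    have e1 : U (n₀ + (m + 1)) (j + 1) i - ((m + 1 : ℕ) : ℝ) * h * G₀ -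
        (1 - l / Λ) * (U (n₀ + m) (j + 1) i - m * h * G₀) - l / Λ * (U (n₀ + m) j i - m * h * G₀) =
        h * (G ((n₀ + m : ℕ) * h) (U (n₀ + m) (j + 1)) i - G₀) -
        (lam ((n₀ + m : ℕ) * h) (U (n₀ + m) (j + 1)) i - l) / Λ *
          (U (n₀ + m) (j + 1) i - U (n₀ + m) j i) := by
      rw [← add_assoc, hup]; push_cast; ring
    rw [e1]
    refine (abs_sub _ _).trans ?_
    have f1 : |h * (G ((n₀ + m : ℕ) * h) (U (n₀ + m) (j + 1)) i - G₀)| ≤ h * e := by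
      rw [abs_mul, abs_of_pos hh]; exact mul_le_mul_of_nonneg_left w2 hh.le
    have f2 : |(lam ((n₀ + m : ℕ) * h) (U (n₀ + m) (j + 1)) i - l) / Λ *
          (U (n₀ + m) (j + 1) i - U (n₀ + m) j i)| ≤ e / Λ * (L * (Λ * h)) := by
      rw [abs_mul, abs_div, abs_of_pos hΛ]
      exact mul_le_mul (div_le_div_of_nonneg_right w1 hΛ.le) hs (abs_nonneg _)
        (div_nonneg ((abs_nonneg _).trans w1) hΛ.le)
    have f3 : e / Λ * (L * (Λ * h)) = h * (L * e) := by field_simp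
    linarith

/-! ### Limits of grid functions -/

/-- The piecewise constant extension of a grid function. -/
noncomputable def gridValue {ι : Type*} (U : ℕ → ℕ → ι → ℝ) (Λ h : ℝ) (p : ℝ × ℝ) : ι → ℝ :=
  U ⌊p.2 / h⌋₊ ⌊p.1 / (Λ * h)⌋₊

theorem floor_div_mul_le {a h : ℝ} (ha : 0 ≤ a) (hh : 0 < h) : (⌊a / h⌋₊ : ℝ) * h ≤ a := by
  have := Nat.floor_le (div_nonneg ha hh.le)
  rwa [le_div_iff₀ hh] at this

theorem lt_floor_div_mul_add (a : ℝ) {h : ℝ} (hh : 0 < h) : a < (⌊a / h⌋₊ : ℝ) * h + h := by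
  have := Nat.lt_floor_add_one (a / h)
  rw [div_lt_iff₀ hh] at this
  linarith

theorem abs_floor_div_sub_mul_le {a b h : ℝ} (ha : 0 ≤ a) (hb : 0 ≤ b) (hh : 0 < h) :
    h * |(⌊a / h⌋₊ : ℝ) - ⌊b / h⌋₊| ≤ |a - b| + h := by
  have h1 := floor_div_mul_le ha hh
  have h2 := floor_div_mul_le hb hh
  have h3 := lt_floor_div_mul_add a hh
  have h4 := lt_floor_div_mul_add b hh
  have e : h * |(⌊a / h⌋₊ : ℝ) - ⌊b / h⌋₊| = |(⌊a / h⌋₊ : ℝ) * h - ⌊b / h⌋₊ * h| := by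
    rw [← sub_mul, abs_mul, abs_of_pos hh, mul_comm]
  rw [e, abs_le]
  have h5 := le_abs_self (a - b)
  have h6 := neg_abs_le (a - b)
  constructor <;> linarith

theorem tendsto_floor_div_mul {α : Type*} {F : Filter α} {h : α → ℝ} (hpos : ∀ m, 0 < h m)
    (hF : Filter.Tendsto h F (𝓝 0)) {a : ℝ} (ha : 0 ≤ a) :
    Filter.Tendsto (fun m => (⌊a / h m⌋₊ : ℝ) * h m) F (𝓝 a) := by
  have h1 : Filter.Tendsto (fun m => a - h m) F (𝓝 a) := by simpa using hF.const_sub a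
  refine tendsto_of_tendsto_of_tendsto_of_le_of_le h1 tendsto_const_nhds (fun m => ?_) fun m =>
    floor_div_mul_le ha (hpos m)
  have := lt_floor_div_mul_add a (hpos m)
  simp only
  linarith

section Limit

variable {ι : Type*} [Fintype ι] {lam G : ℝ → (ι → ℝ) → ι → ℝ} {B : Set (ι → ℝ)}
  {T₁ lmin Λ C T L M : ℝ} {h : ℕ → ℝ} {U : ℕ → ℕ → ℕ → ι → ℝ} {F : Filter ℕ} [F.NeBot]
  {u : ℝ × ℝ → ι → ℝ}

theorem lipschitzOnWith_limit (hΛ : 0 < Λ) (hL : 0 ≤ L) (hM : 0 ≤ M)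
    (hU : ∀ m, IsUpwind lam G B Λ (h m) T L M (U m))
    (hpos : ∀ m, 0 < h m) (hF : Filter.Tendsto h F (𝓝 0))
    (hu : ∀ p ∈ slab T, Filter.Tendsto (fun m => gridValue (U m) Λ (h m) p) F (𝓝 (u p))) :
    LipschitzOnWith (Real.toNNReal (L + M)) u (slab T) := by
  refine LipschitzOnWith.of_dist_le_mul fun p hp q hq => ?_
  rw [Real.coe_toNNReal _ (by positivity), dist_pi_le_iff (by positivity)]
  intro i
  rw [Real.dist_eq]
  have hmain : |u p i - u q i| ≤ L * |p.1 - q.1| + M * |p.2 - q.2| := by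
    have h1 : Filter.Tendsto (fun m => |gridValue (U m) Λ (h m) p i - gridValue (U m) Λ (h m) q i|) F
        (𝓝 |u p i - u q i|) :=
      (((tendsto_pi_nhds.1 (hu p hp)) i).sub ((tendsto_pi_nhds.1 (hu q hq)) i)).abs
    have h2 : Filter.Tendsto (fun m => L * (|p.1 - q.1| + Λ * h m) + M * (|p.2 - q.2| + h m)) F
        (𝓝 (L * (|p.1 - q.1| + Λ * 0) + M * (|p.2 - q.2| + 0))) :=
      (((hF.const_mul Λ).const_add _).const_mul L).add ((hF.const_add _).const_mul M)
    simp only [mul_zero, add_zero] at h2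
    refine le_of_tendsto_of_tendsto' h1 h2 fun m => ?_
    have hΔ : 0 < Λ * h m := mul_pos hΛ (hpos m)
    have := (hU m).abs_sub_le (hpos m).le
      ((floor_div_mul_le hp.2.1 (hpos m)).trans hp.2.2)
      ((floor_div_mul_le hq.2.1 (hpos m)).trans hq.2.2)
      ⌊p.1 / (Λ * h m)⌋₊ ⌊q.1 / (Λ * h m)⌋₊ i
    have a1 := abs_floor_div_sub_mul_le hp.1 hq.1 hΔ
    have a2 := abs_floor_div_sub_mul_le hp.2.1 hq.2.1 (hpos m)
    have b1 := mul_le_mul_of_nonneg_left a1 hL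
    have b2 := mul_le_mul_of_nonneg_left a2 hM
    simp only [gridValue]
    linarith
  refine hmain.trans ?_
  have d1 : |p.1 - q.1| ≤ dist p q := by rw [Prod.dist_eq, ← Real.dist_eq]; exact le_max_left _ _
  have d2 : |p.2 - q.2| ≤ dist p q := by rw [Prod.dist_eq, ← Real.dist_eq]; exact le_max_right _ _
  have := mul_le_mul_of_nonneg_left d1 hL
  have := mul_le_mul_of_nonneg_left d2 hM
  linarith

/-- The limit obeys the transport equation to first order in `k`, without any differentiability. By
the uniform bounds on the grid functions, speed and source are nearly constant in the backward cone
of height about `k`. -/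
theorem abs_limit_transport_le (hb : TransportBounds lam G B T₁ lmin Λ C) (hT : T ≤ T₁)
    (hL : 0 ≤ L) (hM : 0 ≤ M) (hU : ∀ m, IsUpwind lam G B Λ (h m) T L M (U m))
    (hpos : ∀ m, 0 < h m) (hF : Filter.Tendsto h F (𝓝 0))
    (huB : ∀ p ∈ slab T, u p ∈ B)
    (hu : ∀ p ∈ slab T, Filter.Tendsto (fun m => gridValue (U m) Λ (h m) p) F (𝓝 (u p)))
    {x t : ℝ} (hx : 0 < x) (ht : 0 < t) (htT : t < T) (i : ι) {η : ℝ} (hη : 0 < η) :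
    ∀ᶠ k in 𝓝[>] (0 : ℝ), |u (x, t + k) i - k * G t (u (x, t)) i -
      u (x - k * lam t (u (x, t)) i, t) i| ≤ k * η := by
  have hC := hb.C_nonneg
  have hΛ := hb.Λ_pos
  have hp : (x, t) ∈ slab T := ⟨hx.le, ht.le, htT.le⟩
  have htt : t ∈ Icc 0 T₁ := ⟨ht.le, htT.le.trans hT⟩
  have hpB := huB _ hp
  set l := lam t (u (x, t)) i with hl
  set G₀ := G t (u (x, t)) i with hG₀
  have l0 : 0 ≤ l := hb.lmin_pos.le.trans (hb.lam_lower t htt _ hpB i)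
  have l1 : l ≤ Λ := hb.lam_upper t htt _ hpB i
  set e := η / (L + 1) with he
  have he0 : 0 < e := by positivity
  obtain ⟨δ, hδ, hcont⟩ : ∃ δ > 0, ∀ s ∈ Icc 0 T₁, ∀ v ∈ B, |s - t| < δ → dist v (u (x, t)) < δ →
      |lam s v i - l| ≤ e ∧ |G s v i - G₀| ≤ e := by
    obtain ⟨δ₁, hδ₁, h1⟩ := Metric.continuousWithinAt_iff.1 (hb.G_cont _ hpB i t htt) (e / 2)
      (by positivity)
    refine ⟨min δ₁ (e / (2 * (C + 1))), by positivity, fun s hs v hv hst hvu => ⟨?_, ?_⟩⟩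
    · have h2 := hb.lam_lip s hs t htt v hv _ hpB i
      have h3 := hst.le.trans (min_le_right _ _)
      have h4 := hvu.le.trans (min_le_right _ _)
      rw [le_div_iff₀ (by positivity)] at h3 h4
      have := abs_nonneg (s - t)
      have : 0 ≤ dist v (u (x, t)) := dist_nonneg
      nlinarith
    · have h2 := hb.G_lip s hs v hv _ hpB i
      have h3 := (h1 hs (hst.trans_le (min_le_left _ _))).le
      rw [Real.dist_eq] at h3
      have h4 := hvu.le.trans (min_le_right _ _)
      rw [le_div_iff₀ (by positivity)] at h4
      have : 0 ≤ dist v (u (x, t)) := dist_nonneg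
      have := abs_sub_le (G s v i) (G s (u (x, t)) i) G₀
      nlinarith
  -- Within time κ and the corresponding space distance Λκ, grid values change by at most (LΛ + M)κ.
  -- The summand 1 makes κR also bound the time itself.
  set R := 1 + L * Λ + M with hR
  have hR0 : 0 < R := by positivity
  -- The three bounds keep `t + k` below `T`, the backward cone away from x = 0, and the values in
  -- the cone within δ of `u (x, t)`. The bounds on `h m` below use up the remaining slack.
  have hκ : ∀ᶠ k in 𝓝[>] (0 : ℝ), k < min (T - t) (min (x / (2 * Λ)) (δ / (4 * R))) :=
    Filter.Eventually.filter_mono nhdsWithin_le_nhds (Iio_mem_nhds (by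
      refine lt_min (by linarith) (lt_min (by positivity) (by positivity))))
  filter_upwards [hκ, self_mem_nhdsWithin] with k hk hk0
  simp only [mem_Ioi] at hk0
  rw [lt_min_iff, lt_min_iff, lt_div_iff₀ (by positivity), lt_div_iff₀ (by positivity)] at hk
  obtain ⟨hkT, hkx, hkδ⟩ := hk
  have hkl : k * l ≤ k * Λ := mul_le_mul_of_nonneg_left l1 hk0.le
  have hxl : 0 ≤ x - k * l := by linarith
  have hp1 : (x, t + k) ∈ slab T := ⟨hx.le, by simp only; linarith, by simp only; linarith⟩
  have hp2 : (x - k * l, t) ∈ slab T := ⟨hxl, ht.le, htT.le⟩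
  have hsmall : ∀ᶠ m in F, h m < min (x / (4 * Λ)) (δ / (4 * R)) :=
    hF.eventually (Iio_mem_nhds (lt_min (by positivity) (by positivity)))
  have hnear : ∀ᶠ m in F, dist (gridValue (U m) Λ (h m) (x, t)) (u (x, t)) < δ / 2 :=
    (hu _ hp).eventually (Metric.ball_mem_nhds _ (by positivity))
  -- For fixed ε the step size tends to 0 first, which removes the square and the variance from the
  -- barrier; ε tends to 0 afterwards.
  have main : ∀ ε > 0, |u (x, t + k) i - k * G₀ - u (x - k * l, t) i| ≤
      L * ε / 2 + k * η := by
    intro ε hε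
    set n₀ : ℕ → ℕ := fun m => ⌊t / h m⌋₊ with hn₀
    set n₁ : ℕ → ℕ := fun m => ⌊(t + k) / h m⌋₊ with hn₁
    set J : ℕ → ℕ := fun m => ⌊x / (Λ * h m)⌋₊ with hJ
    set j₀ : ℕ → ℕ := fun m => ⌊(x - k * l) / (Λ * h m)⌋₊ with hj₀
    have hΔpos : ∀ m, 0 < Λ * h m := fun m => mul_pos hΛ (hpos m)
    have hFΔ : Filter.Tendsto (fun m => Λ * h m) F (𝓝 0) := by simpa using hF.const_mul Λ
    have t0 : Filter.Tendsto (fun m => (n₀ m : ℝ) * h m) F (𝓝 t) :=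
      tendsto_floor_div_mul hpos hF ht.le
    have t1 : Filter.Tendsto (fun m => (n₁ m : ℝ) * h m) F (𝓝 (t + k)) :=
      tendsto_floor_div_mul hpos hF (by linarith)
    have t2 : Filter.Tendsto (fun m => (J m : ℝ) * (Λ * h m)) F (𝓝 x) :=
      tendsto_floor_div_mul hΔpos hFΔ hx.le
    have t3 : Filter.Tendsto (fun m => (j₀ m : ℝ) * (Λ * h m)) F (𝓝 (x - k * l)) :=
      tendsto_floor_div_mul hΔpos hFΔ hxl
    have hle : ∀ m, n₀ m ≤ n₁ m := fun m =>
      Nat.floor_le_floor (div_le_div_of_nonneg_right (by linarith) (hpos m).le)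
    have t4 : Filter.Tendsto (fun m => ((n₁ m - n₀ m : ℕ) : ℝ) * h m) F (𝓝 k) := by
      have := t1.sub t0
      rw [add_sub_cancel_left] at this
      refine this.congr fun m => ?_
      rw [Nat.cast_sub (hle m)]; ring
    have tl : Filter.Tendsto (fun m => |U m (n₀ m + (n₁ m - n₀ m)) (J m) i -
        ((n₁ m - n₀ m : ℕ) : ℝ) * h m * G₀ - U m (n₀ m) (j₀ m) i|) F
        (𝓝 |u (x, t + k) i - k * G₀ - u (x - k * l, t) i|) := by
      refine Filter.Tendsto.abs (Filter.Tendsto.sub (Filter.Tendsto.sub ?_ (t4.mul_const _)) ?_)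
      · have := tendsto_pi_nhds.1 (hu _ hp1) i
        refine this.congr fun m => ?_
        rw [Nat.add_sub_cancel' (hle m)]; rfl
      · exact tendsto_pi_nhds.1 (hu _ hp2) i
    have tr : Filter.Tendsto (fun m => L * ε / 2 + L / (2 * ε) *
        (((J m : ℝ) * (Λ * h m) - j₀ m * (Λ * h m) - ((n₁ m - n₀ m : ℕ) : ℝ) * h m * l) ^ 2 +
          ((n₁ m - n₀ m : ℕ) : ℝ) * h m * (Λ ^ 2 * h m)) +
        ((n₁ m - n₀ m : ℕ) : ℝ) * h m * ((L + 1) * e)) F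
        (𝓝 (L * ε / 2 + L / (2 * ε) * ((x - (x - k * l) - k * l) ^ 2 + k * (Λ ^ 2 * 0)) +
          k * ((L + 1) * e))) :=
      (((((t2.sub t3).sub (t4.mul_const l)).pow 2).add
        (t4.mul (hF.const_mul _))).const_mul _ |>.const_add _).add (t4.mul_const _)
    have e1 : L * ε / 2 + L / (2 * ε) * ((x - (x - k * l) - k * l) ^ 2 + k * (Λ ^ 2 * 0)) +
          k * ((L + 1) * e) = L * ε / 2 + k * η := by
      rw [he]; field_simp; ring
    rw [e1] at tr
    refine le_of_tendsto_of_tendsto tl tr ?_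
    filter_upwards [hsmall, hnear] with m hm hmn
    rw [lt_min_iff, lt_div_iff₀ (by positivity), lt_div_iff₀ (by positivity)] at hm
    have hh := hpos m
    have q0 : (n₀ m : ℝ) * h m ≤ t := floor_div_mul_le ht.le hh
    have q0' : t < n₀ m * h m + h m := lt_floor_div_mul_add t hh
    have q1 : (n₁ m : ℝ) * h m ≤ t + k := floor_div_mul_le (by linarith) hh
    have qJ : x < J m * (Λ * h m) + Λ * h m := lt_floor_div_mul_add x (hΔpos m)
    have qk : ((n₁ m - n₀ m : ℕ) : ℝ) * h m ≤ k + h m := by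
      rw [Nat.cast_sub (hle m)]; linarith
    refine (hU m).abs_sub_transport_le hh hΛ hL ?_ ?_ l0 l1 hε ?_
    · rw [Nat.add_sub_cancel' (hle m)]; linarith
    · have : ((n₁ m - n₀ m : ℕ) : ℝ) * (Λ * h m) ≤ J m * (Λ * h m) := by
        have := mul_le_mul_of_nonneg_left qk hΛ.le
        linarith
      exact_mod_cast le_of_mul_le_mul_right this (hΔpos m)
    · intro a j ha hj1 hj2
      have haR : (a : ℝ) ≤ ((n₁ m - n₀ m : ℕ) : ℝ) := by exact_mod_cast ha.le
      have hah : (a : ℝ) * h m ≤ k + h m := (mul_le_mul_of_nonneg_right haR hh.le).trans qk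
      have ha0 : 0 ≤ (a : ℝ) * h m := by positivity
      have hnT : ((n₀ m + a : ℕ) : ℝ) * h m ≤ T := by
        have h1 : ((n₀ m + a : ℕ) : ℝ) ≤ n₁ m := by
          exact_mod_cast (by have := hle m; omega : n₀ m + a ≤ n₁ m)
        have := mul_le_mul_of_nonneg_right h1 hh.le
        linarith
      have hsplit : ((n₀ m + a : ℕ) : ℝ) * h m = n₀ m * h m + a * h m := by push_cast; ring
      have hRk : (k + h m) * R < δ / 2 := by linarith
      have hR1 : k + h m ≤ (k + h m) * R := by
        refine le_mul_of_one_le_right (by linarith) ?_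
        have : 0 ≤ L * Λ := by positivity
        linarith
      refine hcont _ ⟨by positivity, hnT.trans hT⟩ _ ((hU m).mem _ hnT _) ?_ ?_
      · rw [hsplit, abs_lt]; constructor <;> linarith
      · have d1 : dist (U m (n₀ m + a) (j + 1)) (gridValue (U m) Λ (h m) (x, t)) ≤
            (k + h m) * R := by
          rw [dist_pi_le_iff (by positivity)]
          intro i'
          rw [Real.dist_eq]
          have h1 := (hU m).abs_sub_le hh.le hnT (q0.trans htT.le) (j + 1) (J m) i'
          have h2 : |((j + 1 : ℕ) : ℝ) - J m| ≤ ((n₁ m - n₀ m : ℕ) : ℝ) := by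
            have h3 : (J m : ℝ) ≤ j + ((n₁ m - n₀ m : ℕ) : ℝ) := by
              exact_mod_cast (by omega : J m ≤ j + (n₁ m - n₀ m))
            have h4 : ((j + 1 : ℕ) : ℝ) ≤ J m := by exact_mod_cast hj2
            rw [abs_le]; push_cast at h4 ⊢
            constructor <;> linarith [(Nat.cast_nonneg (n₁ m - n₀ m) : (0 : ℝ) ≤ _)]
          have h5 : |((n₀ m + a : ℕ) : ℝ) - n₀ m| = a := by
            push_cast; rw [add_sub_cancel_left]; exact abs_of_nonneg (Nat.cast_nonneg a)
          rw [h5] at h1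
          refine h1.trans ?_
          have h6 := mul_le_mul_of_nonneg_left h2 (by positivity : 0 ≤ L * (Λ * h m))
          have h7 := mul_le_mul_of_nonneg_left qk (by positivity : 0 ≤ L * Λ)
          have h8 := mul_le_mul_of_nonneg_left hah hM
          rw [hR]
          linarith
        have := dist_triangle (U m (n₀ m + a) (j + 1)) (gridValue (U m) Λ (h m) (x, t)) (u (x, t))
        linarith
  refine le_of_forall_pos_le_add fun ε hε => ?_
  have := main (ε / (L + 1)) (by positivity)
  have h2 : L * (ε / (L + 1)) / 2 ≤ ε := by
    rw [mul_div_assoc', div_div, div_le_iff₀ (by positivity)]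
    nlinarith
  linarith

/-- At a point of differentiability, the first-order estimate divided by `k` bounds the defect of
the equation by every η > 0. -/
theorem pde_of_limit (hb : TransportBounds lam G B T₁ lmin Λ C) (hT : T ≤ T₁)
    (hL : 0 ≤ L) (hM : 0 ≤ M) (hU : ∀ m, IsUpwind lam G B Λ (h m) T L M (U m))
    (hpos : ∀ m, 0 < h m) (hF : Filter.Tendsto h F (𝓝 0))
    (huB : ∀ p ∈ slab T, u p ∈ B)
    (hu : ∀ p ∈ slab T, Filter.Tendsto (fun m => gridValue (U m) Λ (h m) p) F (𝓝 (u p)))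
    {p : ℝ × ℝ} (hp : slab T ∈ 𝓝 p) {D : ℝ × ℝ →L[ℝ] (ι → ℝ)} (hD : HasFDerivAt u D p) (i : ι) :
    D (0, 1) i + lam p.2 (u p) i * D (1, 0) i = G p.2 (u p) i := by
  obtain ⟨x, t⟩ := p
  rw [← mem_interior_iff_mem_nhds, slab, interior_prod_eq, interior_Ici, interior_Icc] at hp
  obtain ⟨hx, ht, htT⟩ := hp
  simp only [mem_Ioi] at hx ht htT
  simp only
  set l := lam t (u (x, t)) i with hl
  have c1 : HasDerivAt (fun k : ℝ => (x, t + k)) ((0, 1) : ℝ × ℝ) 0 :=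
    (hasDerivAt_const _ _).prodMk ((hasDerivAt_id _).const_add t)
  have c2 : HasDerivAt (fun k : ℝ => (x - k * l, t)) ((-l, 0) : ℝ × ℝ) 0 := by
    refine HasDerivAt.prodMk ?_ (hasDerivAt_const _ _)
    simpa using ((hasDerivAt_id (0 : ℝ)).mul_const l).const_sub x
  have d1 : HasDerivAt (fun k : ℝ => u (x, t + k) i) (D (0, 1) i) 0 := by
    have hD1 : HasFDerivAt u D (x, t + 0) := by rw [add_zero]; exact hD
    have := HasFDerivAt.comp_hasDerivAt (f := fun k : ℝ => (x, t + k)) (0 : ℝ) hD1 c1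
    exact hasDerivAt_pi.1 this i
  have d2 : HasDerivAt (fun k : ℝ => u (x - k * l, t) i) (D (-l, 0) i) 0 := by
    have hD1 : HasFDerivAt u D (x - 0 * l, t) := by rw [zero_mul, sub_zero]; exact hD
    have := HasFDerivAt.comp_hasDerivAt (f := fun k : ℝ => (x - k * l, t)) (0 : ℝ) hD1 c2
    exact hasDerivAt_pi.1 this i
  have d3 := (d1.sub ((hasDerivAt_id (0 : ℝ)).mul_const (G t (u (x, t)) i))).sub d2
  have hs := d3.tendsto_slope_zero_right
  have e1 : D (-l, 0) i = -(l * D (1, 0) i) := by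
    have : ((-l, 0) : ℝ × ℝ) = (-l) • (1, 0) := by simp
    rw [this, map_smul]; simp
  refine eq_of_abs_sub_le_all fun η hη => ?_
  have hlim := abs_limit_transport_le hb hT hL hM hU hpos hF huB hu hx ht htT i hη
  have h1 : |D (0, 1) i - 1 * G t (u (x, t)) i - D (-l, 0) i| ≤ η := by
    refine le_of_tendsto hs.abs ?_
    filter_upwards [hlim, self_mem_nhdsWithin] with k hk hk0
    simp only [mem_Ioi] at hk0
    simp only [Pi.sub_apply, id, zero_add, zero_mul, sub_zero, add_zero, smul_eq_mul, sub_self]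
    rw [abs_mul, abs_of_pos (inv_pos.2 hk0), inv_mul_le_iff₀ hk0]
    exact hk
  rw [e1] at h1
  refine le_trans (le_of_eq ?_) h1
  congr 1; ring

end Limit

/-! ### Local existence for diagonal systems -/

/-- Local existence of Lipschitz solutions of diagonal systems with positive speeds, on a time
interval which depends on the data only through their Lipschitz constant. -/
theorem exists_isDiagSolution {ι : Type*} [Fintype ι] {lam G : ℝ → (ι → ℝ) → ι → ℝ} {u₀ : ι → ℝ}
    {r T₁ lmin Λ C : ℝ} (hb : TransportBounds lam G (Metric.closedBall u₀ r) T₁ lmin Λ C)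
    (hT₁ : 0 < T₁) (hr : 0 < r) (K : ℝ≥0) :
    ∃ T₀ > 0, T₀ ≤ T₁ ∧ ∃ L : ℝ≥0, ∀ T, 0 < T → T ≤ T₀ → ∀ g d : ℝ → ι → ℝ,
      LipschitzOnWith K g (Ici 0) → LipschitzOnWith K d (Icc 0 T) → g 0 = d 0 →
      (∀ x ∈ Ici (0 : ℝ), dist (g x) u₀ ≤ r / 2) → (∀ t ∈ Icc 0 T, dist (d t) u₀ ≤ r / 2) →
      ∃ u, IsDiagSolution lam G (Metric.closedBall u₀ r) T u ∧ LipschitzOnWith L u (slab T) ∧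
        (∀ x ∈ Ici (0 : ℝ), u (x, 0) = g x) ∧ ∀ t ∈ Icc 0 T, u (0, t) = d t := by
  have hC := hb.C_nonneg
  have hΛ := hb.Λ_pos
  have hK0 : (0 : ℝ) ≤ K := K.2
  have hl := hb.lmin_pos
  -- Here `K` covers the slope of the initial data, and `(K + C) / lmin` the slope which the
  -- equation forces at x = 0. The 1 makes `L` positive.
  set L := K + 1 + (K + C) / lmin with hLdef
  have hL0 : 0 < L := by positivity
  have hKL : K ≤ L := by
    have : 0 ≤ (K + C) / lmin := by positivity
    linarith
  have hLl : K + C ≤ L * lmin := by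
    rw [hLdef, add_mul, div_mul_cancel₀ _ hl.ne']
    have : 0 ≤ (K + 1 : ℝ) * lmin := by positivity
    linarith
  set c := 4 * C * L ^ 2 + 2 * C * L with hc
  have hc0 : 0 ≤ c := by positivity
  set M := 2 * L * Λ + C + K with hMdef
  have hM0 : 0 ≤ M := by positivity
  -- The time is limited by the validity of the bounds, by the drift `r / 2` that the source may
  -- cause, and by the doubling of the slope `L`. The added 1's avoid zero denominators.
  refine ⟨min T₁ (min (r / (2 * (C + 1))) (L / (c + 1))), by positivity, min_le_left _ _,
    Real.toNNReal (2 * L + M), ?_⟩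
  intro T hT0 hTle g d hg hd hgd hg₀ hd₀
  rw [le_min_iff, le_min_iff, le_div_iff₀ (by positivity), le_div_iff₀ (by positivity)] at hTle
  obtain ⟨hTT, hTr, hTL⟩ := hTle
  have hTC : T * C ≤ r / 2 := by linarith
  have hTc : T * c ≤ L := by linarith
  set h : ℕ → ℝ := fun m => T / (m + 1) with hh
  have hpos : ∀ m, 0 < h m := fun m => by positivity
  have hlim : Filter.Tendsto h Filter.atTop (𝓝 0) :=
    (tendsto_const_div_atTop_nhds_zero_nat T).comp (Filter.tendsto_add_atTop_nat 1) |>.congr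
      fun m => by simp [hh]
  set U : ℕ → ℕ → ℕ → ι → ℝ := fun m => upwind lam G Λ (h m) g d with hUdef
  have hU : ∀ m, IsUpwind lam G (Metric.closedBall u₀ r) Λ (h m) T (2 * L) M (U m) := fun m =>
    isUpwind_upwind hb (hpos m) hTT hTC hg₀ hd₀ hg hd hgd hKL hLl hTc
  -- Along a free ultrafilter the grid values, which lie in a compact ball, converge at every point
  -- of the slab at once; no subsequence has to be extracted.
  set F : Ultrafilter ℕ := Filter.hyperfilter ℕ with hFdef
  have hF : Filter.Tendsto h F (𝓝 0) := by
    refine hlim.mono_left ?_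
    rw [← Nat.cofinite_eq_atTop]
    exact Filter.hyperfilter_le_cofinite
  have hex : ∀ p : ℝ × ℝ, ∃ a : ι → ℝ, p ∈ slab T → a ∈ Metric.closedBall u₀ r ∧
      Filter.Tendsto (fun m => gridValue (U m) Λ (h m) p) F (𝓝 a) := by
    intro p
    by_cases hp : p ∈ slab T
    · have hmem : ∀ m, gridValue (U m) Λ (h m) p ∈ Metric.closedBall u₀ r := fun m =>
        (hU m).mem _ ((floor_div_mul_le hp.2.1 (hpos m)).trans hp.2.2) _
      obtain ⟨a, ha, hFa⟩ := (isCompact_closedBall u₀ r).ultrafilter_le_nhds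
        (F.map fun m => gridValue (U m) Λ (h m) p)
        (Filter.tendsto_principal.2 (Filter.Eventually.of_forall hmem))
      exact ⟨a, fun _ => ⟨ha, hFa⟩⟩
    · exact ⟨u₀, fun h => absurd h hp⟩
  choose u hu' using hex
  have huB : ∀ p ∈ slab T, u p ∈ Metric.closedBall u₀ r := fun p hp => (hu' p hp).1
  have hu : ∀ p ∈ slab T, Filter.Tendsto (fun m => gridValue (U m) Λ (h m) p) F (𝓝 (u p)) :=
    fun p hp => (hu' p hp).2
  have hLip := lipschitzOnWith_limit hΛ (by positivity) hM0 hU hpos hF hu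
  refine ⟨u, ⟨⟨_, hLip⟩, huB, ?_⟩, hLip, ?_, ?_⟩
  · have hrad := hLip.ae_differentiableWithinAt (μ := volume) (measurableSet_slab T)
    filter_upwards [hrad, ae_slab_mem_nhds T] with p hp hpn
    have hD := (hp.differentiableAt hpn).hasFDerivAt
    exact ⟨_, hD, fun i =>
      pde_of_limit hb hTT (by positivity) hM0 hU hpos hF huB hu hpn hD i⟩
  · intro x hx
    have h1 := hu (x, 0) ⟨hx, le_rfl, hT0.le⟩
    refine tendsto_nhds_unique h1 ?_
    have h2 : Filter.Tendsto (fun m => (⌊x / (Λ * h m)⌋₊ : ℝ) * (Λ * h m)) F (𝓝[Ici 0] x) :=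
      tendsto_nhdsWithin_of_tendsto_nhds_of_eventually_within _
        (tendsto_floor_div_mul (fun m => mul_pos hΛ (hpos m))
          (by simpa using hF.const_mul Λ) hx)
        (Filter.Eventually.of_forall fun m => by
          have := hpos m
          simp only [mem_Ici]; positivity)
    refine ((hg.continuousOn x hx).tendsto.comp h2).congr fun m => ?_
    simp [gridValue, hUdef, upwind]
  · intro t ht
    have h1 := hu (0, t) ⟨by simp, ht.1, ht.2⟩
    refine tendsto_nhds_unique h1 ?_
    have h2 : Filter.Tendsto (fun m => (⌊t / h m⌋₊ : ℝ) * h m) F (𝓝[Icc 0 T] t) :=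
      tendsto_nhdsWithin_of_tendsto_nhds_of_eventually_within _
        (tendsto_floor_div_mul hpos hF ht.1)
        (Filter.Eventually.of_forall fun m => ⟨by have := hpos m; positivity,
          (floor_div_mul_le ht.1 (hpos m)).trans ht.2⟩)
    refine ((hd.continuousOn t ht).tendsto.comp h2).congr fun m => ?_
    -- In row 0 the scheme takes its corner value from `g`, so the compatibility of the data is
    -- needed here.
    have e0 : ∀ n : ℕ, U m n 0 = d (n * h m) := by
      intro n
      cases n with
      | zero => simpa [hUdef, upwind] using hgd
      | succ n => simp only [hUdef, upwind]
    simp [gridValue, e0]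

/-! ### Hyperbolicity -/

namespace Params

variable (P : Params)

theorem A_pos : 0 < P.A := by
  have := P.R_pos
  unfold A; positivity

theorem ρ₂_pos : 0 < P.ρ₂ := by
  have h1 := P.ρw_pos
  have h2 := P.ρw_lt_ρs
  have h3 := P.β_pos
  have h4 := P.β_lt_one
  unfold ρ₂; nlinarith

variable {P} {q : ℝ} {Ω : Fin 3 → ℝ}

theorem Physical.A₂_pos (h : P.Physical q Ω) : 0 < P.A₂ Ω := sub_pos.2 h.A₁_lt

theorem Physical.ρ₁_pos (h : P.Physical q Ω) : 0 < P.ρ₁ Ω := by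
  have h1 := P.ρw_pos
  have h2 := P.ρw_lt_ρs
  have h3 := h.α_pos
  have h4 := h.α_lt.trans P.β_lt_one
  unfold ρ₁; nlinarith

theorem Physical.inertia_pos (h : P.Physical q Ω) : 0 < P.A₂ Ω * P.ρ₁ Ω + Ω 1 * P.ρ₂ := by
  have h1 := h.A₂_pos
  have h2 := h.ρ₁_pos
  have h3 := h.A₁_pos
  have h4 := P.ρ₂_pos
  positivity

theorem Physical.momentum_pos (h : P.Physical q Ω) :
    0 < P.A₂ Ω * P.ρ₁ Ω * Ω 2 + Ω 1 * P.ρ₂ * P.V q Ω := by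
  have h1 := h.A₂_pos
  have h2 := h.ρ₁_pos
  have h3 := h.A₁_pos
  have h4 := P.ρ₂_pos
  have h5 := h.U_pos
  have h6 := h.V_pos
  positivity

theorem Physical.speed₃_pos (h : P.Physical q Ω) : 0 < P.speed₃ q Ω :=
  div_pos h.momentum_pos h.inertia_pos

theorem speed₃_sub_U (h : P.A₂ Ω * P.ρ₁ Ω + Ω 1 * P.ρ₂ ≠ 0) :
    P.speed₃ q Ω - Ω 2 = Ω 1 * P.ρ₂ * (P.V q Ω - Ω 2) / (P.A₂ Ω * P.ρ₁ Ω + Ω 1 * P.ρ₂) := by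
  unfold speed₃
  rw [div_sub' h]
  ring

theorem inv_M_mul_N (h : P.A₂ Ω * P.ρ₁ Ω + Ω 1 * P.ρ₂ ≠ 0) :
    (P.M Ω)⁻¹ * P.N q Ω = !![Ω 2, 0, 0; 0, Ω 2, Ω 1; 0, 0, P.speed₃ q Ω] := by
  have hM : (P.M Ω).det ≠ 0 := by
    simpa [M, Matrix.det_fin_three] using h
  have hN : P.N q Ω = P.M Ω * !![Ω 2, 0, 0; 0, Ω 2, Ω 1; 0, 0, P.speed₃ q Ω] := by
    ext i j
    fin_cases i <;> fin_cases j <;>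
      simp [M, N, Matrix.mul_apply, Fin.sum_univ_three, speed₃, mul_div_cancel₀ _ h]
  rw [hN, Matrix.nonsing_inv_mul_cancel_left _ _ (isUnit_iff_ne_zero.2 hM)]

theorem Physical.hyperbolic (h : P.Physical q Ω) : P.Hyperbolic q Ω where
  det_M := by
    simpa [M, Matrix.det_fin_three] using h.inertia_pos.ne'
  det_N := by
    have h1 := h.momentum_pos
    have h2 := h.U_pos
    simp [N, Matrix.det_fin_three, h1.ne', h2.ne']
  charpoly := by
    rw [inv_M_mul_N h.inertia_pos.ne', Matrix.charpoly, Matrix.det_fin_three]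
    simp
    exact Or.inl (by ring)
  U_pos := h.U_pos
  speed₃_pos := h.speed₃_pos
  diagonalizable := by
    intro hUV
    have hne : P.speed₃ q Ω - Ω 2 ≠ 0 := by
      rw [speed₃_sub_U h.inertia_pos.ne']
      exact div_ne_zero (mul_ne_zero (mul_ne_zero h.A₁_pos.ne' P.ρ₂_pos.ne')
        (sub_ne_zero.2 hUV.symm)) h.inertia_pos.ne'
    -- The third column is the eigenvector (0, A₁, c - U) for c; the first two are eigenvectors for
    -- U.
    refine ⟨!![1, 0, 0; 0, 1, Ω 1; 0, 0, P.speed₃ q Ω - Ω 2], ?_, ?_⟩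
    · simpa [Matrix.det_fin_three] using hne
    · rw [inv_M_mul_N h.inertia_pos.ne']
      ext i j
      fin_cases i <;> fin_cases j <;>
        simp [Matrix.mul_apply, Fin.sum_univ_three] <;> ring

/-! ### The diagonal coordinates -/

variable (P)

/-- Coordinates in which the system is diagonal: the third characteristic speed belongs to `U`, the
speed `U` to `α` and to the second coordinate. -/
noncomputable def toDiag (q : ℝ) (Ω : Fin 3 → ℝ) : Fin 3 → ℝ :=
  ![Ω 0, (P.ρ₁ Ω + P.ρ₂ * (Ω 1 / P.A₂ Ω)) * (P.A * Ω 2 - q), Ω 2]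

/-- The ratio of `A` to the area of the lower layer, in diagonal coordinates. -/
noncomputable def areaRatio (q : ℝ) (u : Fin 3 → ℝ) : ℝ :=
  1 + (u 1 / (P.A * u 2 - q) - P.ρ₁ u) / P.ρ₂

/-- The inverse of `toDiag`. -/
noncomputable def ofDiag (q : ℝ) (u : Fin 3 → ℝ) : Fin 3 → ℝ :=
  ![u 0, P.A - P.A / P.areaRatio q u, u 2]

/-- The derivative of `toDiag q Ω` along a curve where `q` and `Ω` have derivatives `q'`, `Ω'`. -/
noncomputable def toDiagDeriv (q q' : ℝ) (Ω Ω' : Fin 3 → ℝ) : Fin 3 → ℝ :=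
  ![Ω' 0, (P.A * Ω 2 - q) * ((P.ρs - P.ρw) * Ω' 0 + P.ρ₂ * P.A / P.A₂ Ω ^ 2 * Ω' 1) +
    (P.ρ₁ Ω + P.ρ₂ * (Ω 1 / P.A₂ Ω)) * (P.A * Ω' 2 - q'), Ω' 2]

/-- The characteristic speeds in the order of the diagonal coordinates. -/
noncomputable def diagSpeed (q : ℝ) (Ω : Fin 3 → ℝ) : Fin 3 → ℝ :=
  ![Ω 2, Ω 2, P.speed₃ q Ω]

/-- The source of the diagonal system. -/
noncomputable def diagSource (q q' : ℝ) (Ω : Fin 3 → ℝ) : Fin 3 → ℝ :=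
  P.toDiagDeriv q q' Ω
    ![P.F q q' Ω 0, P.F q q' Ω 1, P.f q q' Ω / (P.A₂ Ω * P.ρ₁ Ω + Ω 1 * P.ρ₂)]

variable {P}

theorem areaRatio_toDiag (h2 : P.A₂ Ω ≠ 0) (hq : P.A * Ω 2 - q ≠ 0) :
    P.areaRatio q (P.toDiag q Ω) = P.A / P.A₂ Ω := by
  have e0 : P.ρ₁ (P.toDiag q Ω) = P.ρ₁ Ω := by simp [ρ₁, toDiag]
  rw [areaRatio, e0]
  simp only [toDiag, Matrix.cons_val]
  rw [mul_div_cancel_right₀ _ hq, add_sub_cancel_left, mul_div_cancel_left₀ _ P.ρ₂_pos.ne',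
    one_add_div h2]
  simp [A₂]

theorem ofDiag_toDiag (h2 : P.A₂ Ω ≠ 0) (hq : P.A * Ω 2 - q ≠ 0) :
    P.ofDiag q (P.toDiag q Ω) = Ω := by
  have hA := P.A_pos.ne'
  have e := areaRatio_toDiag h2 hq
  ext i
  fin_cases i
  · simp [ofDiag, toDiag]
  · simp only [ofDiag, e, Fin.mk_one, Matrix.cons_val]
    rw [div_div_cancel₀ hA, A₂]; ring
  · simp [ofDiag, toDiag]

theorem toDiag_ofDiag {u : Fin 3 → ℝ} (hs : P.areaRatio q u ≠ 0) (hq : P.A * u 2 - q ≠ 0) :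
    P.toDiag q (P.ofDiag q u) = u := by
  have hA := P.A_pos.ne'
  have hρ := P.ρ₂_pos.ne'
  have e : P.ρ₂ * ((P.A - P.A / P.areaRatio q u) / (P.A - (P.A - P.A / P.areaRatio q u))) =
      u 1 / (P.A * u 2 - q) - P.ρ₁ u := by
    have e1 : (P.A - P.A / P.areaRatio q u) / (P.A - (P.A - P.A / P.areaRatio q u)) =
        P.areaRatio q u - 1 := by
      rw [sub_sub_cancel]; field_simp
    rw [e1, areaRatio, add_sub_cancel_left, mul_div_cancel₀ _ hρ]
  have e0 : P.ρ₁ (P.ofDiag q u) = P.ρ₁ u := by simp [ρ₁, ofDiag]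
  ext i
  fin_cases i
  · simp [ofDiag, toDiag]
  · simp only [toDiag, e0, Fin.mk_one, Matrix.cons_val]
    simp only [ofDiag, A₂, Matrix.cons_val]
    rw [e, add_sub_cancel, div_mul_cancel₀ _ hq]
  · simp [ofDiag, toDiag]

theorem hasDerivAt_toDiag {q : ℝ → ℝ} {q' : ℝ} {Ω : ℝ → Fin 3 → ℝ} {Ω' : Fin 3 → ℝ} {s : ℝ}
    (hq : HasDerivAt q q' s) (hΩ : HasDerivAt Ω Ω' s) (h2 : P.A₂ (Ω s) ≠ 0) :
    HasDerivAt (fun s => P.toDiag (q s) (Ω s)) (P.toDiagDeriv (q s) q' (Ω s) Ω') s := by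
  have h := hasDerivAt_pi.1 hΩ
  rw [hasDerivAt_pi]
  intro i
  fin_cases i
  · simpa [toDiag, toDiagDeriv] using h 0
  · have d1 : HasDerivAt (fun s => P.ρ₁ (Ω s)) ((P.ρs - P.ρw) * Ω' 0) s := by
      have := ((h 0).mul_const P.ρs).add (((h 0).const_sub 1).mul_const P.ρw)
      unfold ρ₁
      refine this.congr_deriv ?_
      ring
    have d2 : HasDerivAt (fun s => P.A₂ (Ω s)) (-Ω' 1) s := (h 1).const_sub P.A
    have d3 := (d1.add (((h 1).div d2 h2).const_mul P.ρ₂)).mul (((h 2).const_mul P.A).sub hq)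
    simp only [toDiag, toDiagDeriv, Fin.mk_one, Matrix.cons_val]
    refine d3.congr_deriv ?_
    have e : Ω' 1 * P.A₂ (Ω s) - Ω s 1 * -Ω' 1 = P.A * Ω' 1 := by unfold A₂; ring
    rw [e]
    simp only [Pi.add_apply, Pi.sub_apply, Pi.div_apply]
    ring
  · simpa [toDiag, toDiagDeriv] using h 2

/-- Everything rests on m(c - U) = -A₁ρ₂(A U - q)/A₂, where m = A₂ρ₁ + A₁ρ₂. It turns the term by
which transport of W at speed U differs from the third equation into the term A₁ ∂ₓU of the second
one. The equivalence needs A U - q ≠ 0, as this factor multiplies the second equation. -/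
theorem pde_iff_diag (h2 : P.A₂ Ω ≠ 0) (hm : P.A₂ Ω * P.ρ₁ Ω + Ω 1 * P.ρ₂ ≠ 0)
    (hq : P.A * Ω 2 - q ≠ 0) (q' : ℝ) (Ωx Ωt : Fin 3 → ℝ) :
    (P.M Ω).mulVec Ωt + (P.N q Ω).mulVec Ωx = P.F q q' Ω ↔
      ∀ i, P.toDiagDeriv q q' Ω Ωt i + P.diagSpeed q Ω i * P.toDiagDeriv q 0 Ω Ωx i =
        P.diagSource q q' Ω i := by
  have hA := P.A_pos.ne'
  have hρ := P.ρ₂_pos.ne'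
  set m := P.A₂ Ω * P.ρ₁ Ω + Ω 1 * P.ρ₂ with hmdef
  set c := P.speed₃ q Ω with hc
  have hcm : P.A₂ Ω * P.ρ₁ Ω * Ω 2 + Ω 1 * P.ρ₂ * P.V q Ω = m * c := by
    rw [hc, speed₃, ← hmdef, mul_div_cancel₀ _ hm]
  have hy : P.ρ₁ Ω + P.ρ₂ * (Ω 1 / P.A₂ Ω) = m / P.A₂ Ω := by
    rw [hmdef]; field_simp
  have hcU : m * (c - Ω 2) = - (Ω 1 * P.ρ₂ * (P.A * Ω 2 - q) / P.A₂ Ω) := by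
    rw [hc, speed₃_sub_U hm, ← hmdef, mul_div_cancel₀ _ hm, V]
    field_simp
    unfold A₂; ring
  have e1 : (P.M Ω).mulVec Ωt + (P.N q Ω).mulVec Ωx = P.F q q' Ω ↔
      (Ωt 0 + Ω 2 * Ωx 0 = P.F q q' Ω 0 ∧ Ωt 1 + Ω 2 * Ωx 1 + Ω 1 * Ωx 2 = P.F q q' Ω 1 ∧
        m * (Ωt 2 + c * Ωx 2) = P.f q q' Ω) := by
    have e2 : P.F q q' Ω 2 = P.f q q' Ω := by simp [F]
    rw [funext_iff, Fin.forall_fin_succ, Fin.forall_fin_two, ← e2]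
    simp only [M, N, hcm, Matrix.mulVec, dotProduct, Fin.sum_univ_three, Pi.add_apply,
      Matrix.of_apply, Matrix.cons_val', Matrix.cons_val, Fin.succ_zero_eq_one, Fin.succ_one_eq_two,
      ← hmdef]
    refine and_congr (Eq.congr_left (by ring)) (and_congr (Eq.congr_left (by ring))
      (Eq.congr_left (by ring)))
  rw [e1, Fin.forall_fin_succ, Fin.forall_fin_two]
  simp only [toDiagDeriv, diagSpeed, diagSource, Matrix.cons_val, Fin.succ_zero_eq_one,
    Fin.succ_one_eq_two, hy, ← hmdef, ← hc]
  -- With the third equation substituted into the source, the defect of the equation for W is a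
  -- combination of the defects of the first two equations. The terms with `q'` cancel.
  have key : ∀ F₀ F₁ : ℝ, (P.A * Ω 2 - q) * ((P.ρs - P.ρw) * Ωt 0 + P.ρ₂ * P.A / P.A₂ Ω ^ 2 * Ωt 1) +
        m / P.A₂ Ω * (P.A * Ωt 2 - q') +
      Ω 2 * ((P.A * Ω 2 - q) * ((P.ρs - P.ρw) * Ωx 0 + P.ρ₂ * P.A / P.A₂ Ω ^ 2 * Ωx 1) +
        m / P.A₂ Ω * (P.A * Ωx 2 - 0)) -
      ((P.A * Ω 2 - q) * ((P.ρs - P.ρw) * F₀ + P.ρ₂ * P.A / P.A₂ Ω ^ 2 * F₁) +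
        m / P.A₂ Ω * (P.A * (Ωt 2 + c * Ωx 2) - q')) =
      (P.A * Ω 2 - q) * ((P.ρs - P.ρw) * (Ωt 0 + Ω 2 * Ωx 0 - F₀) +
        P.ρ₂ * P.A / P.A₂ Ω ^ 2 * (Ωt 1 + Ω 2 * Ωx 1 + Ω 1 * Ωx 2 - F₁)) := by
    intro F₀ F₁
    have : m / P.A₂ Ω * P.A * ((Ω 2 - c) * Ωx 2) =
        (P.A * Ω 2 - q) * (P.ρ₂ * P.A / P.A₂ Ω ^ 2 * (Ω 1 * Ωx 2)) := by
      have e3 : m / P.A₂ Ω * P.A * ((Ω 2 - c) * Ωx 2) =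
        -(m * (c - Ω 2)) * P.A * Ωx 2 / P.A₂ Ω := by ring
      rw [e3, hcU]; field_simp
    linear_combination this
  have hcoef : (P.A * Ω 2 - q) * (P.ρ₂ * P.A / P.A₂ Ω ^ 2) ≠ 0 :=
    mul_ne_zero hq (div_ne_zero (mul_ne_zero hρ hA) (pow_ne_zero 2 h2))
  constructor
  · rintro ⟨h0, h1, h3⟩
    have h3' : Ωt 2 + c * Ωx 2 = P.f q q' Ω / m := by rw [← h3, mul_div_cancel_left₀ _ hm]
    refine ⟨h0, ?_, h3'⟩
    have := key (P.F q q' Ω 0) (P.F q q' Ω 1)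
    rw [h0, h1, h3', sub_self, sub_self, mul_zero, mul_zero, add_zero, mul_zero] at this
    exact sub_eq_zero.1 this
  · rintro ⟨h0, h1, h3⟩
    refine ⟨h0, ?_, by rw [h3, mul_div_cancel₀ _ hm]⟩
    have := key (P.F q q' Ω 0) (P.F q q' Ω 1)
    rw [h3, sub_eq_zero.2 h1, h0, sub_self, mul_zero, zero_add, ← mul_assoc, eq_comm] at this
    exact sub_eq_zero.1 ((mul_eq_zero.1 this).resolve_left hcoef)

end Params

/-! ### Smoothness of the coefficients -/

section General

variable {E : Type*} [NormedAddCommGroup E] [NormedSpace ℝ E]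

theorem contDiffAt_hydraulicDiameter {a s si v w : E → ℝ} {x : E} (ha : ContDiffAt ℝ 1 a x)
    (hs : ContDiffAt ℝ 1 s x) (hsi : ContDiffAt ℝ 1 si x) (hv : ContDiffAt ℝ 1 v x)
    (hw : ContDiffAt ℝ 1 w x) (h1 : 0 < s x) (h2 : 0 < si x) (hvw : v x ≠ w x) :
    ContDiffAt ℝ 1 (fun y => hydraulicDiameter (a y) (s y) (si y) (v y) (w y)) x := by
  rcases lt_or_gt_of_ne hvw with h | h
  · refine ((contDiffAt_const.mul ha).div hs h1.ne').congr_of_eventuallyEq (f := fun y => 4 * a y / s y) ?_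
    filter_upwards [hv.continuousAt.eventually_lt hw.continuousAt h] with y hy
    simp [hydraulicDiameter, hy.not_gt]
  · refine ((contDiffAt_const.mul ha).div (hs.add hsi) (add_pos h1 h2).ne').congr_of_eventuallyEq
      (f := fun y => 4 * a y / (s y + si y)) ?_
    filter_upwards [hw.continuousAt.eventually_lt hv.continuousAt h] with y hy
    simp [hydraulicDiameter, hy]

theorem hydraulicDiameter_pos {a s si v w : ℝ} (ha : 0 < a) (hs : 0 < s) (hsi : 0 < si) :
    0 < hydraulicDiameter a s si v w := by
  unfold hydraulicDiameter
  split_ifs <;> positivity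

theorem contDiffAt_frictionFactor (c n : ℝ) {D v ν : E → ℝ} {x : E} (hD : ContDiffAt ℝ 1 D x)
    (hv : ContDiffAt ℝ 1 v x) (hν : ContDiffAt ℝ 1 ν x) (h1 : 0 < D x) (h2 : 0 < v x)
    (h3 : 0 < ν x) : ContDiffAt ℝ 1 (fun y => frictionFactor c n (D y) (v y) (ν y)) x :=
  contDiffAt_const.mul (((hD.mul hv).div hν h3.ne').rpow_const_of_ne
    (div_pos (mul_pos h1 h2) h3).ne')

theorem contDiffAt_sign {g : E → ℝ} {x : E} (hg : ContinuousAt g x) (h0 : g x ≠ 0) :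
    ContDiffAt ℝ 1 (fun y => ((SignType.sign (g y) : SignType) : ℝ)) x := by
  rcases lt_or_gt_of_ne h0 with h | h
  · refine (contDiffAt_const (c := (-1 : ℝ))).congr_of_eventuallyEq ?_
    filter_upwards [hg.eventually (Iio_mem_nhds h)] with y hy
    simp [sign_neg hy]
  · refine (contDiffAt_const (c := (1 : ℝ))).congr_of_eventuallyEq ?_
    filter_upwards [hg.eventually (Ioi_mem_nhds h)] with y hy
    simp [sign_pos hy]

theorem contDiffAt_ite_lt {a b f g : E → ℝ} {x : E} (ha : ContinuousAt a x)
    (hb : ContinuousAt b x) (hab : a x ≠ b x) (hf : ContDiffAt ℝ 1 f x) (hg : ContDiffAt ℝ 1 g x) :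
    ContDiffAt ℝ 1 (fun y => if a y < b y then f y else g y) x := by
  rcases lt_or_gt_of_ne hab with h | h
  · refine hf.congr_of_eventuallyEq ?_
    filter_upwards [ha.eventually_lt hb h] with y hy
    simp [hy]
  · refine hg.congr_of_eventuallyEq ?_
    filter_upwards [hb.eventually_lt ha h] with y hy
    simp [hy.not_gt]

end General

namespace Params

variable (P : Params)

theorem hasDerivAt_segmentArea (φ : ℝ) :
    HasDerivAt P.segmentArea (P.R ^ 2 * (2 * Real.sin φ ^ 2)) φ := by
  have := (((hasDerivAt_id φ).sub ((Real.hasDerivAt_sin φ).mul (Real.hasDerivAt_cos φ))).const_mul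
    (P.R ^ 2))
  refine this.congr_deriv ?_
  linear_combination P.R ^ 2 * (-Real.sin_sq_add_cos_sq φ)

theorem contDiff_segmentArea : ContDiff ℝ 1 P.segmentArea := by
  unfold segmentArea
  fun_prop

theorem strictMonoOn_segmentArea : StrictMonoOn P.segmentArea (Icc 0 Real.pi) := by
  refine strictMonoOn_of_deriv_pos (convex_Icc _ _) P.contDiff_segmentArea.continuous.continuousOn
    fun φ hφ => ?_
  rw [interior_Icc] at hφ
  rw [(P.hasDerivAt_segmentArea φ).deriv]
  have h1 := Real.sin_pos_of_pos_of_lt_pi hφ.1 hφ.2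
  have h2 := P.R_pos
  positivity

theorem invFunOn_segmentArea {φ : ℝ} (hφ : φ ∈ Icc 0 Real.pi) :
    Function.invFunOn P.segmentArea (Icc 0 Real.pi) (P.segmentArea φ) = φ :=
  P.strictMonoOn_segmentArea.injOn.leftInvOn_invFunOn hφ

theorem exists_segmentArea_eq {y : ℝ} (hy : y ∈ Ioo 0 P.A) :
    ∃ φ ∈ Ioo 0 Real.pi, P.segmentArea φ = y := by
  have h0 : P.segmentArea 0 = 0 := by simp [segmentArea]
  have h1 : P.segmentArea Real.pi = P.A := by simp [segmentArea, A, mul_comm]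
  have := intermediate_value_Ioo Real.pi_pos.le P.contDiff_segmentArea.continuous.continuousOn
  rw [h0, h1] at this
  exact this hy

/-- The derivative 2R² sin²φ is nonzero inside (0, π), so there is a C¹ local inverse. Near the
point its values stay in (0, π), where injectivity identifies it with `Function.invFunOn`. -/
theorem contDiffAt_invFunOn_segmentArea {φ : ℝ} (hφ : φ ∈ Ioo 0 Real.pi) :
    ContDiffAt ℝ 1 (Function.invFunOn P.segmentArea (Icc 0 Real.pi)) (P.segmentArea φ) := by
  have h1 := Real.sin_pos_of_pos_of_lt_pi hφ.1 hφ.2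
  have h2 := P.R_pos
  have hd : P.R ^ 2 * (2 * Real.sin φ ^ 2) ≠ 0 := by positivity
  have hc := P.contDiff_segmentArea.contDiffAt (x := φ)
  have hd' := (P.hasDerivAt_segmentArea φ).hasFDerivAt_equiv hd
  have hs := hc.hasStrictFDerivAt' hd' one_ne_zero
  refine (hc.to_localInverse hd' one_ne_zero).congr_of_eventuallyEq ?_
  have e1 : ∀ᶠ y in 𝓝 (P.segmentArea φ), hs.localInverse P.segmentArea _ φ y ∈ Ioo 0 Real.pi := by
    refine hs.localInverse_continuousAt.eventually (Ioo_mem_nhds ?_ ?_) <;>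
      rw [hs.localInverse_apply_image]
    exacts [hφ.1, hφ.2]
  filter_upwards [e1, hs.eventually_right_inverse] with y hy1 hy2
  have := P.invFunOn_segmentArea (Ioo_subset_Icc_self hy1)
  rw [hy2] at this
  exact this

variable {P} {q : ℝ} {Ω : Fin 3 → ℝ}

theorem Physical.exists_φ (h : P.Physical q Ω) :
    P.φ Ω ∈ Ioo 0 Real.pi ∧ P.segmentArea (P.φ Ω) = P.A₂ Ω := by
  obtain ⟨φ, hφ, e⟩ := P.exists_segmentArea_eq (y := P.A₂ Ω)
    ⟨h.A₂_pos, by unfold A₂; linarith [h.A₁_pos]⟩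
  have : P.φ Ω = φ := by
    unfold Params.φ
    rw [← e, P.invFunOn_segmentArea (Ioo_subset_Icc_self hφ)]
  rw [this]
  exact ⟨hφ, e⟩

theorem contDiffAt_coord (i : Fin 3) (x : ℝ × (Fin 3 → ℝ)) :
    ContDiffAt ℝ 1 (fun p : ℝ × (Fin 3 → ℝ) => p.2 i) x :=
  (contDiff_apply ℝ ℝ i).contDiffAt.comp x contDiffAt_snd

theorem contDiffAt_A₂ (P : Params) (x : ℝ × (Fin 3 → ℝ)) :
    ContDiffAt ℝ 1 (fun p : ℝ × (Fin 3 → ℝ) => P.A₂ p.2) x :=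
  contDiffAt_const.sub (contDiffAt_coord 1 x)

theorem contDiffAt_ρ₁ (P : Params) (x : ℝ × (Fin 3 → ℝ)) :
    ContDiffAt ℝ 1 (fun p : ℝ × (Fin 3 → ℝ) => P.ρ₁ p.2) x :=
  ((contDiffAt_coord 0 x).mul contDiffAt_const).add
    ((contDiffAt_const.sub (contDiffAt_coord 0 x)).mul contDiffAt_const)

theorem contDiffAt_V {x : ℝ × (Fin 3 → ℝ)} (h : P.A₂ x.2 ≠ 0) :
    ContDiffAt ℝ 1 (fun p : ℝ × (Fin 3 → ℝ) => P.V p.1 p.2) x :=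
  (contDiffAt_fst.sub ((contDiffAt_coord 1 x).mul (contDiffAt_coord 2 x))).div
    (P.contDiffAt_A₂ x) h

theorem contDiffAt_inertia (P : Params) (x : ℝ × (Fin 3 → ℝ)) :
    ContDiffAt ℝ 1 (fun p : ℝ × (Fin 3 → ℝ) => P.A₂ p.2 * P.ρ₁ p.2 + p.2 1 * P.ρ₂) x :=
  ((P.contDiffAt_A₂ x).mul (P.contDiffAt_ρ₁ x)).add ((contDiffAt_coord 1 x).mul contDiffAt_const)

theorem contDiffAt_speed₃ {x : ℝ × (Fin 3 → ℝ)} (h : P.A₂ x.2 ≠ 0)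
    (hm : P.A₂ x.2 * P.ρ₁ x.2 + x.2 1 * P.ρ₂ ≠ 0) :
    ContDiffAt ℝ 1 (fun p : ℝ × (Fin 3 → ℝ) => P.speed₃ p.1 p.2) x :=
  ((((P.contDiffAt_A₂ x).mul (P.contDiffAt_ρ₁ x)).mul (contDiffAt_coord 2 x)).add
    (((contDiffAt_coord 1 x).mul contDiffAt_const).mul (contDiffAt_V h))).div
      (P.contDiffAt_inertia x) hm

theorem contDiffAt_diagSpeed {x : ℝ × (Fin 3 → ℝ)} (h : P.A₂ x.2 ≠ 0)
    (hm : P.A₂ x.2 * P.ρ₁ x.2 + x.2 1 * P.ρ₂ ≠ 0) :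
    ContDiffAt ℝ 1 (fun p : ℝ × (Fin 3 → ℝ) => P.diagSpeed p.1 p.2) x := by
  rw [contDiffAt_pi]
  intro i
  fin_cases i
  exacts [contDiffAt_coord 2 x, contDiffAt_coord 2 x, contDiffAt_speed₃ h hm]

theorem η_pos (P : Params) (a : ℝ) : 0 < P.η a :=
  mul_pos P.ηw_pos (Real.rpow_pos_of_pos (div_pos P.η₂_pos P.ηw_pos) _)

theorem Physical.contDiffAt_φ {x : ℝ × (Fin 3 → ℝ)} (h : P.Physical x.1 x.2) :
    ContDiffAt ℝ 1 (fun p : ℝ × (Fin 3 → ℝ) => P.φ p.2) x := by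
  obtain ⟨h1, h2⟩ := h.exists_φ
  have := P.contDiffAt_invFunOn_segmentArea h1
  rw [h2] at this
  exact this.comp x (P.contDiffAt_A₂ x)

theorem Physical.contDiffAt_S₁ {x : ℝ × (Fin 3 → ℝ)} (h : P.Physical x.1 x.2) :
    ContDiffAt ℝ 1 (fun p : ℝ × (Fin 3 → ℝ) => P.S₁ p.2) x :=
  contDiffAt_const.mul (contDiffAt_const.sub h.contDiffAt_φ)

theorem Physical.contDiffAt_S₂ {x : ℝ × (Fin 3 → ℝ)} (h : P.Physical x.1 x.2) :
    ContDiffAt ℝ 1 (fun p : ℝ × (Fin 3 → ℝ) => P.S₂ p.2) x :=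
  contDiffAt_const.mul h.contDiffAt_φ

theorem Physical.contDiffAt_Sᵢ {x : ℝ × (Fin 3 → ℝ)} (h : P.Physical x.1 x.2) :
    ContDiffAt ℝ 1 (fun p : ℝ × (Fin 3 → ℝ) => P.Sᵢ p.2) x :=
  contDiffAt_const.mul h.contDiffAt_φ.sin

theorem Physical.S₁_pos (h : P.Physical q Ω) : 0 < P.S₁ Ω :=
  mul_pos (mul_pos two_pos P.R_pos) (sub_pos.2 h.exists_φ.1.2)

theorem Physical.S₂_pos (h : P.Physical q Ω) : 0 < P.S₂ Ω :=
  mul_pos (mul_pos two_pos P.R_pos) h.exists_φ.1.1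

theorem Physical.Sᵢ_pos (h : P.Physical q Ω) : 0 < P.Sᵢ Ω :=
  mul_pos (mul_pos two_pos P.R_pos) (Real.sin_pos_of_pos_of_lt_pi h.exists_φ.1.1 h.exists_φ.1.2)

theorem Physical.contDiffAt_η {x : ℝ × (Fin 3 → ℝ)} (h : P.Physical x.1 x.2) :
    ContDiffAt ℝ 1 (fun p : ℝ × (Fin 3 → ℝ) => P.η (p.2 0)) x := by
  refine contDiffAt_const.mul (ContDiffAt.rpow contDiffAt_const ?_
    (div_pos P.η₂_pos P.ηw_pos).ne')
  exact ((contDiffAt_coord 0 x).div contDiffAt_const P.β_pos.ne').rpow_const_of_ne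
    (div_pos h.α_pos P.β_pos).ne'

theorem Physical.contDiffAt_friction₁ {x : ℝ × (Fin 3 → ℝ)} (h : P.Physical x.1 x.2)
    (hUV : x.2 2 ≠ P.V x.1 x.2) :
    ContDiffAt ℝ 1 (fun p : ℝ × (Fin 3 → ℝ) => P.friction₁ p.1 p.2) x :=
  contDiffAt_frictionFactor _ _
    (contDiffAt_hydraulicDiameter (contDiffAt_coord 1 x) h.contDiffAt_S₁ h.contDiffAt_Sᵢ
      (contDiffAt_coord 2 x) (contDiffAt_V h.A₂_pos.ne') h.S₁_pos h.Sᵢ_pos hUV)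
    (contDiffAt_coord 2 x) (h.contDiffAt_η.div (P.contDiffAt_ρ₁ x) h.ρ₁_pos.ne')
    (hydraulicDiameter_pos h.A₁_pos h.S₁_pos h.Sᵢ_pos) h.U_pos (div_pos (P.η_pos _) h.ρ₁_pos)

theorem Physical.contDiffAt_friction₂ {x : ℝ × (Fin 3 → ℝ)} (h : P.Physical x.1 x.2)
    (hUV : x.2 2 ≠ P.V x.1 x.2) :
    ContDiffAt ℝ 1 (fun p : ℝ × (Fin 3 → ℝ) => P.friction₂ p.1 p.2) x :=
  contDiffAt_frictionFactor _ _
    (contDiffAt_hydraulicDiameter (P.contDiffAt_A₂ x) h.contDiffAt_S₂ h.contDiffAt_Sᵢ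
      (contDiffAt_V h.A₂_pos.ne') (contDiffAt_coord 2 x) h.S₂_pos h.Sᵢ_pos hUV.symm)
    (contDiffAt_V h.A₂_pos.ne') contDiffAt_const
    (hydraulicDiameter_pos h.A₂_pos h.S₂_pos h.Sᵢ_pos) h.V_pos (div_pos (P.η_pos _) P.ρ₂_pos)

/-- The hydraulic diameters, the choice of the faster layer and the sign depend discontinuously only
on the order of U and V. Where U ≠ V all of them follow one branch nearby. -/
theorem Physical.contDiffAt_f {x : ℝ × (Fin 3 → ℝ)} (h : P.Physical x.1 x.2)
    (hUV : x.2 2 ≠ P.V x.1 x.2) :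
    ContDiffAt ℝ 1 (fun p : ℝ × (Fin 3 → ℝ) => P.f p.1 0 p.2) x := by
  have hV := contDiffAt_V (P := P) (x := x) h.A₂_pos.ne'
  have hU := contDiffAt_coord 2 x
  have hrel := hU.sub hV
  have hratio := (P.contDiffAt_A₂ x).div (contDiffAt_coord 1 x) h.A₁_pos.ne'
  have k₁ := ((h.contDiffAt_friction₁ hUV).div_const 2).mul (P.contDiffAt_ρ₁ x)
  have k₂ := ((h.contDiffAt_friction₂ hUV).div_const 2).mul (contDiffAt_const (c := P.ρ₂))
  have τ₁ := k₁.mul (hU.pow 2)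
  have τ₂ := k₂.mul (hV.pow 2)
  have τᵢ := (contDiffAt_ite_lt hV.continuousAt hU.continuousAt hUV.symm k₁ k₂).mul (hrel.pow 2)
  exact (((contDiffAt_const.sub ((hratio.mul τ₁).mul h.contDiffAt_S₁)).add
    (τ₂.mul h.contDiffAt_S₂))).sub ((contDiffAt_sign hrel.continuousAt (sub_ne_zero.2 hUV)).mul
      ((τᵢ.mul h.contDiffAt_Sᵢ).mul (hratio.add contDiffAt_const)))

variable (P) in
/-- The part of the source of the diagonal system which is proportional to `q'`. -/
noncomputable def diagSourceSlope (Ω : Fin 3 → ℝ) : Fin 3 → ℝ :=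
  ![0, (P.ρ₁ Ω + P.ρ₂ * (Ω 1 / P.A₂ Ω)) * (P.A * (P.ρ₂ / (P.A₂ Ω * P.ρ₁ Ω + Ω 1 * P.ρ₂)) - 1),
    P.ρ₂ / (P.A₂ Ω * P.ρ₁ Ω + Ω 1 * P.ρ₂)]

/-- `Q` is only C¹, so the source need not be Lipschitz in time. Splitting off the term linear in Q'
leaves C¹ functions of (Q, Ω) and one continuous factor. -/
theorem diagSource_eq (P : Params) (q q' : ℝ) (Ω : Fin 3 → ℝ) :
    P.diagSource q q' Ω = P.diagSource q 0 Ω + q' • P.diagSourceSlope Ω := by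
  have e : P.f q q' Ω = P.f q 0 Ω + P.ρ₂ * q' := by unfold f; ring
  ext i
  fin_cases i <;> simp [diagSource, toDiagDeriv, diagSourceSlope, e, F] <;> ring

theorem Physical.contDiffAt_diagSource {x : ℝ × (Fin 3 → ℝ)} (h : P.Physical x.1 x.2)
    (hUV : x.2 2 ≠ P.V x.1 x.2) :
    ContDiffAt ℝ 1 (fun p : ℝ × (Fin 3 → ℝ) => P.diagSource p.1 0 p.2) x := by
  have h0 := contDiffAt_coord 0 x
  have h1 := contDiffAt_coord 1 x
  have h2 := contDiffAt_coord 2 x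
  have hA := P.contDiffAt_A₂ x
  have hF0 : ContDiffAt ℝ 1 (fun p : ℝ × (Fin 3 → ℝ) => P.F p.1 0 p.2 0) x :=
    ((h0.mul (contDiffAt_const.sub (h0.div_const P.β))).mul contDiffAt_const).neg
  have hF1 : ContDiffAt ℝ 1 (fun p : ℝ × (Fin 3 → ℝ) => P.F p.1 0 p.2 1) x :=
    ((h1.mul (h0.div_const P.β)).mul contDiffAt_const).neg
  have hF2 := (h.contDiffAt_f hUV).div (P.contDiffAt_inertia x) h.inertia_pos.ne'
  rw [contDiffAt_pi]
  intro i
  fin_cases i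
  · exact hF0
  · exact ((((contDiffAt_const.mul h2).sub contDiffAt_fst).mul ((contDiffAt_const.mul hF0).add
      ((contDiffAt_const.div (hA.pow 2) (pow_ne_zero 2 h.A₂_pos.ne')).mul hF1))).add
      (((P.contDiffAt_ρ₁ x).add (contDiffAt_const.mul (h1.div hA h.A₂_pos.ne'))).mul
        ((contDiffAt_const.mul hF2).sub contDiffAt_const)))
  · exact hF2

theorem Physical.contDiffAt_diagSourceSlope {x : ℝ × (Fin 3 → ℝ)} (h : P.Physical x.1 x.2) :
    ContDiffAt ℝ 1 (fun p : ℝ × (Fin 3 → ℝ) => P.diagSourceSlope p.2) x := by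
  have h1 := contDiffAt_coord 1 x
  have hA := P.contDiffAt_A₂ x
  have h3 := (contDiffAt_const (c := P.ρ₂)).div (P.contDiffAt_inertia x) h.inertia_pos.ne'
  rw [contDiffAt_pi]
  intro i
  fin_cases i
  · exact contDiffAt_const
  · exact ((P.contDiffAt_ρ₁ x).add (contDiffAt_const.mul (h1.div hA h.A₂_pos.ne'))).mul
      ((contDiffAt_const.mul h3).sub contDiffAt_const)
  · exact h3

theorem contDiffAt_toDiag {x : ℝ × (Fin 3 → ℝ)} (h : P.A₂ x.2 ≠ 0) :
    ContDiffAt ℝ 1 (fun p : ℝ × (Fin 3 → ℝ) => P.toDiag p.1 p.2) x := by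
  rw [contDiffAt_pi]
  intro i
  fin_cases i
  · exact contDiffAt_coord 0 x
  · exact ((P.contDiffAt_ρ₁ x).add (contDiffAt_const.mul ((contDiffAt_coord 1 x).div
      (P.contDiffAt_A₂ x) h))).mul ((contDiffAt_const.mul (contDiffAt_coord 2 x)).sub
        contDiffAt_fst)
  · exact contDiffAt_coord 2 x

theorem contDiffAt_areaRatio {x : ℝ × (Fin 3 → ℝ)} (h : P.A * x.2 2 - x.1 ≠ 0) :
    ContDiffAt ℝ 1 (fun p : ℝ × (Fin 3 → ℝ) => P.areaRatio p.1 p.2) x :=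
  contDiffAt_const.add ((((contDiffAt_coord 1 x).div ((contDiffAt_const.mul
    (contDiffAt_coord 2 x)).sub contDiffAt_fst) h).sub (P.contDiffAt_ρ₁ x)).div_const _)

theorem contDiffAt_ofDiag {x : ℝ × (Fin 3 → ℝ)} (h : P.A * x.2 2 - x.1 ≠ 0)
    (hs : P.areaRatio x.1 x.2 ≠ 0) :
    ContDiffAt ℝ 1 (fun p : ℝ × (Fin 3 → ℝ) => P.ofDiag p.1 p.2) x := by
  rw [contDiffAt_pi]
  intro i
  fin_cases i
  exacts [contDiffAt_coord 0 x, contDiffAt_const.sub (contDiffAt_const.div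
    (contDiffAt_areaRatio h) hs), contDiffAt_coord 2 x]

/-- This is where U ≠ V becomes the condition for the diagonal coordinates to be invertible. -/
theorem A_mul_sub (h2 : P.A₂ Ω ≠ 0) : P.A * Ω 2 - q = P.A₂ Ω * (Ω 2 - P.V q Ω) := by
  unfold V
  rw [mul_sub, mul_div_cancel₀ _ h2]
  unfold A₂; ring

theorem A_mul_sub_ne (h2 : P.A₂ Ω ≠ 0) (hUV : Ω 2 ≠ P.V q Ω) : P.A * Ω 2 - q ≠ 0 := by
  rw [A_mul_sub h2]
  exact mul_ne_zero h2 (sub_ne_zero.2 hUV)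

end Params

/-! ### Uniform bounds near the initial state -/

section Cylinder

variable {ι : Type*} [Fintype ι] {Q : ℝ → ℝ} {v : ι → ℝ}

theorem eventually_forall_Icc {p : ℝ → Prop} (h : ∀ᶠ t in 𝓝 (0 : ℝ), p t) :
    ∀ᶠ ρ in 𝓝[>] (0 : ℝ), ∀ t ∈ Icc 0 ρ, p t := by
  obtain ⟨ε, hε, he⟩ := Metric.eventually_nhds_iff.1 h
  filter_upwards [nhdsWithin_le_nhds (Iio_mem_nhds hε)] with ρ hρ t ht
  refine he ?_
  rw [Real.dist_eq, sub_zero, abs_of_nonneg ht.1]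
  exact ht.2.trans_lt hρ

/-- The conclusion holds for all small ρ, so that finitely many local conditions can be intersected
before one radius is chosen. -/
theorem eventually_forall_cylinder (hQ : ContinuousAt Q 0) {p : ℝ × (ι → ℝ) → Prop}
    (h : ∀ᶠ x in 𝓝 (Q 0, v), p x) :
    ∀ᶠ ρ in 𝓝[>] (0 : ℝ), ∀ t ∈ Icc 0 ρ, ∀ u ∈ Metric.closedBall v ρ, p (Q t, u) := by
  rw [nhds_prod_eq] at h
  obtain ⟨pa, ha, pb, hb, hab⟩ := Filter.eventually_prod_iff.1 h
  obtain ⟨ε, hε, he⟩ := Metric.eventually_nhds_iff.1 hb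
  filter_upwards [eventually_forall_Icc (hQ.eventually ha),
    nhdsWithin_le_nhds (Iio_mem_nhds hε)] with ρ h1 h2 t ht u hu
  exact hab (h1 t ht) (he ((Metric.mem_closedBall.1 hu).trans_lt h2))

theorem eventually_cylinder_lipschitz {κ : Type*} [Fintype κ] (hQ : ContDiff ℝ 1 Q)
    {f : ℝ × (ι → ℝ) → κ → ℝ} (hf : ContDiffAt ℝ 1 f (Q 0, v)) :
    ∃ K : ℝ≥0, ∀ᶠ ρ in 𝓝[>] (0 : ℝ), ∀ t ∈ Icc 0 ρ, ∀ s ∈ Icc 0 ρ, ∀ u ∈ Metric.closedBall v ρ,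
      ∀ w ∈ Metric.closedBall v ρ, dist (f (Q t, u)) (f (Q s, w)) ≤ K * (|t - s| + dist u w) := by
  obtain ⟨K, W, hW, hK⟩ := hf.exists_lipschitzOnWith
  obtain ⟨KQ, V, hV, hKQ⟩ := (hQ.contDiffAt (x := 0)).exists_lipschitzOnWith
  refine ⟨K * (KQ + 1), ?_⟩
  filter_upwards [eventually_forall_cylinder hQ.continuous.continuousAt hW,
    eventually_forall_Icc hV] with ρ h1 h2 t ht s hs u hu w hw
  have h3 := hK.dist_le_mul _ (h1 t ht u hu) _ (h1 s hs w hw)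
  have h4 := hKQ.dist_le_mul _ (h2 t ht) _ (h2 s hs)
  rw [Real.dist_eq t s] at h4
  refine h3.trans ?_
  push_cast
  rw [mul_assoc]
  refine mul_le_mul_of_nonneg_left ?_ K.2
  rw [Prod.dist_eq]
  have h5 := abs_nonneg (t - s)
  have h6 : 0 ≤ dist u w := dist_nonneg
  have h7 : (0 : ℝ) ≤ KQ := KQ.2
  refine max_le ?_ ?_ <;> simp only <;> nlinarith

theorem eventually_transportBounds {lam S₀ S₁ : ℝ × (ι → ℝ) → ι → ℝ} (hQ : ContDiff ℝ 1 Q)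
    (hlam : ContDiffAt ℝ 1 lam (Q 0, v)) (hS₀ : ContDiffAt ℝ 1 S₀ (Q 0, v))
    (hS₁ : ContDiffAt ℝ 1 S₁ (Q 0, v)) {lmin : ℝ} (h0 : 0 < lmin)
    (hl : ∀ i, lmin < lam (Q 0, v) i) :
    ∃ Λ C : ℝ, ∀ᶠ ρ in 𝓝[>] (0 : ℝ), TransportBounds (fun t u => lam (Q t, u))
      (fun t u => S₀ (Q t, u) + deriv Q t • S₁ (Q t, u)) (Metric.closedBall v ρ) ρ lmin Λ C := by
  obtain ⟨K, hK⟩ := eventually_cylinder_lipschitz hQ hlam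
  obtain ⟨K₀, hK₀⟩ := eventually_cylinder_lipschitz hQ hS₀
  obtain ⟨K₁, hK₁⟩ := eventually_cylinder_lipschitz hQ hS₁
  have hQc := hQ.continuous.continuousAt (x := 0)
  have hdQ : Continuous (deriv Q) := hQ.continuous_deriv le_rfl
  set D := |deriv Q 0| + 1 with hD
  have hD0 : 0 ≤ D := by positivity
  have e1 := eventually_forall_Icc (hdQ.abs.continuousAt.eventually
    (Iio_mem_nhds (lt_add_one |deriv Q 0|)))
  have e2 := eventually_forall_cylinder hQc (Filter.eventually_all.2 fun i =>
    ((continuous_apply i).continuousAt.comp hlam.continuousAt).eventually (Ioi_mem_nhds (hl i)))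
  have e3 := eventually_forall_cylinder hQc (hlam.continuousAt.norm.eventually
    (Iio_mem_nhds (lt_add_one _)))
  have e4 := eventually_forall_cylinder hQc (hS₀.continuousAt.norm.eventually
    (Iio_mem_nhds (lt_add_one _)))
  have e5 := eventually_forall_cylinder hQc (hS₁.continuousAt.norm.eventually
    (Iio_mem_nhds (lt_add_one _)))
  set a₀ := ‖S₀ (Q 0, v)‖ + 1
  set a₁ := ‖S₁ (Q 0, v)‖ + 1
  have ha₀ : 0 ≤ a₀ := by positivity
  have ha₁ : 0 ≤ a₁ := by positivity
  have hKp : (0 : ℝ) ≤ K := K.2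
  have hK₀p : (0 : ℝ) ≤ K₀ := K₀.2
  have hK₁p : (0 : ℝ) ≤ K₁ := K₁.2
  have hDK : 0 ≤ D * K₁ := by positivity
  have hDa : 0 ≤ D * a₁ := by positivity
  refine ⟨‖lam (Q 0, v)‖ + 1, K + (K₀ + D * K₁) + (a₀ + D * a₁), ?_⟩
  filter_upwards [hK, hK₀, hK₁, e1, e2, e3, e4, e5] with ρ hK hK₀ hK₁ e1 e2 e3 e4 e5
  simp only [Function.comp_apply] at e1 e2 e3 e4 e5
  refine ⟨h0, by positivity, by positivity, fun t ht u hu i => (e2 t ht u hu i).le,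
    fun t ht u hu i => ?_, fun t ht s hs u hu w hw i => ?_, fun t ht u hu i => ?_,
    fun t ht u hu w hw i => ?_, fun u hu i => ?_⟩
  · exact (le_abs_self _).trans ((norm_le_pi_norm (lam (Q t, u)) i).trans (e3 t ht u hu).le)
  · rw [← Real.dist_eq]
    refine (dist_le_pi_dist _ _ i).trans ((hK t ht s hs u hu w hw).trans ?_)
    refine mul_le_mul_of_nonneg_right ?_ (by positivity)
    linarith
  · have b0 := (norm_le_pi_norm (S₀ (Q t, u)) i).trans (e4 t ht u hu).le
    have b1 := (norm_le_pi_norm (S₁ (Q t, u)) i).trans (e5 t ht u hu).le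
    rw [Real.norm_eq_abs] at b0 b1
    simp only [Pi.add_apply, Pi.smul_apply, smul_eq_mul]
    refine (abs_add_le _ _).trans ?_
    rw [abs_mul]
    have := mul_le_mul (e1 t ht).le b1 (abs_nonneg _) hD0
    linarith
  · have b0 := (dist_le_pi_dist _ _ i).trans (hK₀ t ht t ht u hu w hw)
    have b1 := (dist_le_pi_dist _ _ i).trans (hK₁ t ht t ht u hu w hw)
    rw [sub_self, abs_zero, zero_add, Real.dist_eq] at b0 b1
    simp only [Pi.add_apply, Pi.smul_apply, smul_eq_mul]
    have e : S₀ (Q t, u) i + deriv Q t * S₁ (Q t, u) i -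
        (S₀ (Q t, w) i + deriv Q t * S₁ (Q t, w) i) =
        (S₀ (Q t, u) i - S₀ (Q t, w) i) + deriv Q t * (S₁ (Q t, u) i - S₁ (Q t, w) i) := by ring
    rw [e]
    refine (abs_add_le _ _).trans ?_
    rw [abs_mul]
    have := mul_le_mul (e1 t ht).le b1 (abs_nonneg _) hD0
    have h7 : 0 ≤ dist u w := dist_nonneg
    have h8 : 0 ≤ (K + (a₀ + D * a₁)) * dist u w := by positivity
    linarith
  · have c0 : ContinuousOn (fun t => S₀ (Q t, u) i) (Icc 0 ρ) :=
      (LipschitzOnWith.of_dist_le_mul (K := K₀) fun t ht s hs => by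
        have := (dist_le_pi_dist _ _ i).trans (hK₀ t ht s hs u hu u hu)
        rwa [dist_self, add_zero, ← Real.dist_eq] at this).continuousOn
    have c1 : ContinuousOn (fun t => S₁ (Q t, u) i) (Icc 0 ρ) :=
      (LipschitzOnWith.of_dist_le_mul (K := K₁) fun t ht s hs => by
        have := (dist_le_pi_dist _ _ i).trans (hK₁ t ht s hs u hu u hu)
        rwa [dist_self, add_zero, ← Real.dist_eq] at this).continuousOn
    exact c0.add (hdQ.continuousOn.mul c1)

theorem TransportBounds.mono {lam G : ℝ → (ι → ℝ) → ι → ℝ} {B B' : Set (ι → ℝ)}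
    {T T' lmin Λ C : ℝ} (h : TransportBounds lam G B T lmin Λ C) (hB : B' ⊆ B) (hT : T' ≤ T) :
    TransportBounds lam G B' T' lmin Λ C where
  lmin_pos := h.lmin_pos
  Λ_pos := h.Λ_pos
  C_nonneg := h.C_nonneg
  lam_lower t ht u hu := h.lam_lower t (Icc_subset_Icc_right hT ht) u (hB hu)
  lam_upper t ht u hu := h.lam_upper t (Icc_subset_Icc_right hT ht) u (hB hu)
  lam_lip t ht s hs u hu v hv := h.lam_lip t (Icc_subset_Icc_right hT ht) s
    (Icc_subset_Icc_right hT hs) u (hB hu) v (hB hv)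
  G_bound t ht u hu := h.G_bound t (Icc_subset_Icc_right hT ht) u (hB hu)
  G_lip t ht u hu v hv := h.G_lip t (Icc_subset_Icc_right hT ht) u (hB hu) v (hB hv)
  G_cont u hu i := (h.G_cont u (hB hu) i).mono (Icc_subset_Icc_right hT)

end Cylinder

/-! ### The chart around the constant state -/

namespace Params

variable (P : Params) (Q : ℝ → ℝ) (Ω₀ : Fin 3 → ℝ)

/-- The speeds of the diagonal system as functions of time and of the diagonal coordinates. -/
noncomputable def chartSpeed (t : ℝ) (u : Fin 3 → ℝ) : Fin 3 → ℝ :=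
  P.diagSpeed (Q t) (P.ofDiag (Q t) u)

/-- The source of the diagonal system as a function of time and of the diagonal coordinates. -/
noncomputable def chartSource (t : ℝ) (u : Fin 3 → ℝ) : Fin 3 → ℝ :=
  P.diagSource (Q t) (deriv Q t) (P.ofDiag (Q t) u)

/-- Radii and constants for the change of coordinates near `Ω₀`, up to time `τ`: the diagonal
system is under control on the ball of radius `R` in diagonal coordinates, which contains the image
of the ball of radius `s` around `Ω₀`; the half of this ball contains the preimage of the ball of
radius `R'`, the half of which contains the image of the ball of radius `r`. -/
structure DiagChart (τ R s R' r lmin Λ C : ℝ) (K K' : ℝ≥0) : Prop where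
  bounds : TransportBounds (P.chartSpeed Q) (P.chartSource Q)
    (Metric.closedBall (P.toDiag (Q 0) Ω₀) R) τ lmin Λ C
  R'_pos : 0 < R'
  R'_le : R' ≤ R
  s_pos : 0 < s
  r_le : r ≤ s
  ofDiag_lip : ∀ t ∈ Icc 0 τ, ∀ t' ∈ Icc 0 τ, ∀ u ∈ Metric.closedBall (P.toDiag (Q 0) Ω₀) R,
    ∀ u' ∈ Metric.closedBall (P.toDiag (Q 0) Ω₀) R,
      dist (P.ofDiag (Q t) u) (P.ofDiag (Q t') u') ≤ K' * (|t - t'| + dist u u')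
  toDiag_lip : ∀ t ∈ Icc 0 τ, ∀ t' ∈ Icc 0 τ, ∀ Ω ∈ Metric.closedBall Ω₀ s,
    ∀ Ω' ∈ Metric.closedBall Ω₀ s,
      dist (P.toDiag (Q t) Ω) (P.toDiag (Q t') Ω') ≤ K * (|t - t'| + dist Ω Ω')
  areaRatio_ne : ∀ t ∈ Icc 0 τ, ∀ u ∈ Metric.closedBall (P.toDiag (Q 0) Ω₀) R,
    P.areaRatio (Q t) u ≠ 0
  chart_ne : ∀ t ∈ Icc 0 τ, ∀ u ∈ Metric.closedBall (P.toDiag (Q 0) Ω₀) R, P.A * u 2 - Q t ≠ 0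
  physical_ofDiag : ∀ t ∈ Icc 0 τ, ∀ u ∈ Metric.closedBall (P.toDiag (Q 0) Ω₀) R,
    P.Physical (Q t) (P.ofDiag (Q t) u)
  physical : ∀ t ∈ Icc 0 τ, ∀ Ω ∈ Metric.closedBall Ω₀ s, P.Physical (Q t) Ω
  ne : ∀ t ∈ Icc 0 τ, ∀ Ω ∈ Metric.closedBall Ω₀ s, P.A * Ω 2 - Q t ≠ 0
  toDiag_mem : ∀ t ∈ Icc 0 τ, ∀ Ω ∈ Metric.closedBall Ω₀ s,
    P.toDiag (Q t) Ω ∈ Metric.closedBall (P.toDiag (Q 0) Ω₀) R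
  ofDiag_mem : ∀ t ∈ Icc 0 τ, ∀ u ∈ Metric.closedBall (P.toDiag (Q 0) Ω₀) R',
    P.ofDiag (Q t) u ∈ Metric.closedBall Ω₀ (s / 2)
  toDiag_near : ∀ t ∈ Icc 0 τ, ∀ Ω ∈ Metric.closedBall Ω₀ r,
    P.toDiag (Q t) Ω ∈ Metric.closedBall (P.toDiag (Q 0) Ω₀) (R' / 2)

variable {P Q Ω₀}

theorem eventually_physical {x : ℝ × (Fin 3 → ℝ)} (h : P.Physical x.1 x.2) :
    ∀ᶠ y in 𝓝 x, P.Physical y.1 y.2 := by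
  have hc : ∀ i : Fin 3, ContinuousAt (fun y : ℝ × (Fin 3 → ℝ) => y.2 i) x := fun i =>
    (contDiffAt_coord i x).continuousAt
  have hV := (contDiffAt_V (P := P) h.A₂_pos.ne').continuousAt
  filter_upwards [(hc 0).eventually (Ioi_mem_nhds h.α_pos), (hc 0).eventually (Iio_mem_nhds h.α_lt),
    (hc 1).eventually (Ioi_mem_nhds h.A₁_pos), (hc 1).eventually (Iio_mem_nhds h.A₁_lt),
    (hc 2).eventually (Ioi_mem_nhds h.U_pos), hV.eventually (Ioi_mem_nhds h.V_pos)]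
    with y h1 h2 h3 h4 h5 h6
  exact ⟨h1, h2, h3, h4, h5, h6⟩

theorem exists_diagChart (hQ : ContDiff ℝ 1 Q) (h₀ : P.Physical (Q 0) Ω₀)
    (hUV : Ω₀ 2 ≠ P.V (Q 0) Ω₀) :
    ∃ (τ R s R' r lmin Λ C : ℝ) (K K' : ℝ≥0), 0 < τ ∧ 0 < r ∧
      P.DiagChart Q Ω₀ τ R s R' r lmin Λ C K K' := by
  have hA2 := h₀.A₂_pos.ne'
  have hne := A_mul_sub_ne hA2 hUV
  set u₀ := P.toDiag (Q 0) Ω₀ with hu₀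
  have hback : P.ofDiag (Q 0) u₀ = Ω₀ := ofDiag_toDiag hA2 hne
  have hu2 : P.A * u₀ 2 - Q 0 ≠ 0 := by simpa [hu₀, toDiag] using hne
  have hratio : P.areaRatio (Q 0) u₀ ≠ 0 := by
    rw [hu₀, areaRatio_toDiag hA2 hne]
    exact div_ne_zero P.A_pos.ne' hA2
  have hQc := hQ.continuous.continuousAt (x := 0)
  have hof := contDiffAt_ofDiag (P := P) (x := (Q 0, u₀)) hu2 hratio
  have hto := contDiffAt_toDiag (P := P) (x := (Q 0, Ω₀)) hA2
  have hpair : ContDiffAt ℝ 1 (fun p : ℝ × (Fin 3 → ℝ) => (p.1, P.ofDiag p.1 p.2)) (Q 0, u₀) :=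
    contDiffAt_fst.prodMk hof
  have hpv : (fun p : ℝ × (Fin 3 → ℝ) => (p.1, P.ofDiag p.1 p.2)) (Q 0, u₀) = (Q 0, Ω₀) := by
    simp [hback]
  have hspeed := (contDiffAt_diagSpeed (P := P) (x := (Q 0, Ω₀)) hA2 h₀.inertia_pos.ne')
  have hs0 := Physical.contDiffAt_diagSource (x := (Q 0, Ω₀)) h₀ hUV
  have hs1 := Physical.contDiffAt_diagSourceSlope (x := (Q 0, Ω₀)) h₀
  rw [← hpv] at hspeed hs0 hs1
  obtain ⟨lmin, hl0, hl⟩ : ∃ lmin > 0, ∀ i, lmin < P.diagSpeed (Q 0) (P.ofDiag (Q 0) u₀) i := by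
    rw [hback]
    have hU := h₀.U_pos
    have hc := h₀.speed₃_pos
    refine ⟨min (Ω₀ 2) (P.speed₃ (Q 0) Ω₀) / 2, by positivity, ?_⟩
    have h1 := min_le_left (Ω₀ 2) (P.speed₃ (Q 0) Ω₀)
    have h2 := min_le_right (Ω₀ 2) (P.speed₃ (Q 0) Ω₀)
    intro i
    fin_cases i <;> simp [diagSpeed] <;> linarith
  set ψ : ℝ × (Fin 3 → ℝ) → ℝ × (Fin 3 → ℝ) := fun p => (p.1, P.ofDiag p.1 p.2) with hψ
  obtain ⟨Λ, C, hb⟩ := eventually_transportBounds hQ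
    (lam := (fun p : ℝ × (Fin 3 → ℝ) => P.diagSpeed p.1 p.2) ∘ ψ)
    (ContDiffAt.comp (f := ψ) _ hspeed hpair) (ContDiffAt.comp (f := ψ) _ hs0 hpair)
    (ContDiffAt.comp (f := ψ) _ hs1 hpair) hl0 hl
  obtain ⟨K', hK'⟩ := eventually_cylinder_lipschitz hQ hof
  obtain ⟨K, hK⟩ := eventually_cylinder_lipschitz hQ hto
  have e1 := eventually_forall_cylinder hQc
    ((contDiffAt_areaRatio (P := P) (x := (Q 0, u₀)) hu2).continuousAt.eventually_ne hratio)
  have hlin : ∀ x : ℝ × (Fin 3 → ℝ),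
      ContinuousAt (fun y : ℝ × (Fin 3 → ℝ) => P.A * y.2 2 - y.1) x := fun x => by fun_prop
  have e2 := eventually_forall_cylinder hQc ((hlin (Q 0, u₀)).eventually_ne hu2)
  have e3 := eventually_forall_cylinder hQc (hpair.continuousAt.eventually
    (by rw [hpv]; exact eventually_physical (x := (Q 0, Ω₀)) h₀))
  have e4 := eventually_forall_cylinder hQc (eventually_physical (x := (Q 0, Ω₀)) h₀)
  have e5 := eventually_forall_cylinder hQc ((hlin (Q 0, Ω₀)).eventually_ne hne)
  -- The radii R, s, R', r are chosen in this order, each small enough for its ball to be mapped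
  -- into the preceding one, or into half of it. Finally the time is bounded by all four.
  obtain ⟨R, ⟨hbR, hK'R, e1R, e2R, e3R⟩, hR0⟩ :=
    ((hb.and (hK'.and (e1.and (e2.and e3)))).and self_mem_nhdsWithin).exists
  replace hR0 : 0 < R := hR0
  have e6 := eventually_forall_cylinder hQc (hto.continuousAt.eventually
    (Metric.closedBall_mem_nhds u₀ hR0))
  obtain ⟨s, ⟨hKs, e4s, e5s, e6s⟩, hs0⟩ :=
    ((hK.and (e4.and (e5.and e6))).and self_mem_nhdsWithin).exists
  replace hs0 : 0 < s := hs0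
  have e7 := eventually_forall_cylinder hQc (hof.continuousAt.eventually
    (by simp only [hback]; exact Metric.closedBall_mem_nhds Ω₀ (half_pos hs0)))
  obtain ⟨R', ⟨e7R', hR'R⟩, hR'0⟩ := ((e7.and (nhdsWithin_le_nhds (Iic_mem_nhds hR0))).and
    self_mem_nhdsWithin).exists
  replace hR'0 : 0 < R' := hR'0
  replace hR'R : R' ≤ R := hR'R
  have e8 := eventually_forall_cylinder hQc (hto.continuousAt.eventually
    (Metric.closedBall_mem_nhds u₀ (half_pos hR'0)))
  obtain ⟨r, ⟨e8r, hrs⟩, hr0⟩ := ((e8.and (nhdsWithin_le_nhds (Iic_mem_nhds hs0))).and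
    self_mem_nhdsWithin).exists
  replace hr0 : 0 < r := hr0
  replace hrs : r ≤ s := hrs
  have hτ : ∀ {t : ℝ}, t ∈ Icc 0 (min (min R s) (min R' r)) →
      t ∈ Icc 0 R ∧ t ∈ Icc 0 s ∧ t ∈ Icc 0 R' ∧ t ∈ Icc 0 r := by
    rintro t ⟨h1, h2⟩
    rw [le_min_iff, le_min_iff, le_min_iff] at h2
    exact ⟨⟨h1, h2.1.1⟩, ⟨h1, h2.1.2⟩, ⟨h1, h2.2.1⟩, ⟨h1, h2.2.2⟩⟩
  refine ⟨min (min R s) (min R' r), R, s, R', r, lmin, Λ, C, K, K', by positivity, hr0, ?_⟩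
  refine
    { bounds := ?_
      R'_pos := hR'0
      R'_le := hR'R
      s_pos := hs0
      r_le := hrs
      ofDiag_lip := fun t ht t' ht' => hK'R t (hτ ht).1 t' (hτ ht').1
      toDiag_lip := fun t ht t' ht' => hKs t (hτ ht).2.1 t' (hτ ht').2.1
      areaRatio_ne := fun t ht => e1R t (hτ ht).1
      chart_ne := fun t ht => e2R t (hτ ht).1
      physical_ofDiag := fun t ht => e3R t (hτ ht).1
      physical := fun t ht => e4s t (hτ ht).2.1
      ne := fun t ht => e5s t (hτ ht).2.1
      toDiag_mem := fun t ht => e6s t (hτ ht).2.1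
      ofDiag_mem := fun t ht => e7R' t (hτ ht).2.2.1
      toDiag_near := fun t ht => e8r t (hτ ht).2.2.2 }
  have hG : P.chartSource Q = fun t u => P.diagSource (Q t) 0 (P.ofDiag (Q t) u) +
      deriv Q t • P.diagSourceSlope (P.ofDiag (Q t) u) := by
    funext t u
    exact diagSource_eq P _ _ _
  rw [hG]
  exact hbR.mono subset_rfl ((min_le_left _ _).trans (min_le_left _ _))

end Params

/-! ### Transfer to the flow equations and conclusion -/

namespace Params

variable {P : Params} {Q : ℝ → ℝ} {Ω₀ : Fin 3 → ℝ}

theorem hasDerivAt_fst_of_hasFDerivAt {E : Type*} [NormedAddCommGroup E] [NormedSpace ℝ E]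
    {u : ℝ × ℝ → E} {p : ℝ × ℝ} {D : ℝ × ℝ →L[ℝ] E} (hD : HasFDerivAt u D p) :
    HasDerivAt (fun x => u (x, p.2)) (D (1, 0)) p.1 :=
  HasFDerivAt.comp_hasDerivAt (f := fun x : ℝ => (x, p.2)) p.1 hD
    ((hasDerivAt_id _).prodMk (hasDerivAt_const _ _))

theorem hasDerivAt_snd_of_hasFDerivAt {E : Type*} [NormedAddCommGroup E] [NormedSpace ℝ E]
    {u : ℝ × ℝ → E} {p : ℝ × ℝ} {D : ℝ × ℝ →L[ℝ] E} (hD : HasFDerivAt u D p) :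
    HasDerivAt (fun t => u (p.1, t)) (D (0, 1)) p.2 :=
  HasFDerivAt.comp_hasDerivAt (f := fun t : ℝ => (p.1, t)) p.2 hD
    ((hasDerivAt_const _ _).prodMk (hasDerivAt_id _))

theorem fderiv_toDiag_apply (hQ : ContDiff ℝ 1 Q) {u Y : ℝ × ℝ → Fin 3 → ℝ} {p : ℝ × ℝ}
    (hev : ∀ᶠ p' in 𝓝 p, u p' = P.toDiag (Q p'.2) (Y p')) {D : ℝ × ℝ →L[ℝ] (Fin 3 → ℝ)}
    (hD : HasFDerivAt u D p) {Yx Yt : Fin 3 → ℝ} (hx : HasDerivAt (fun x => Y (x, p.2)) Yx p.1)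
    (ht : HasDerivAt (fun t => Y (p.1, t)) Yt p.2) (h2 : P.A₂ (Y p) ≠ 0) :
    D (1, 0) = P.toDiagDeriv (Q p.2) 0 (Y p) Yx ∧
      D (0, 1) = P.toDiagDeriv (Q p.2) (deriv Q p.2) (Y p) Yt := by
  have c1 : ContinuousAt (fun x : ℝ => (x, p.2)) p.1 := by fun_prop
  have c2 : ContinuousAt (fun t : ℝ => (p.1, t)) p.2 := by fun_prop
  have e1 : (fun x => u (x, p.2)) =ᶠ[𝓝 p.1] fun x => P.toDiag (Q p.2) (Y (x, p.2)) :=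
    c1.eventually hev
  have e2 : (fun t => u (p.1, t)) =ᶠ[𝓝 p.2] fun t => P.toDiag (Q t) (Y (p.1, t)) :=
    c2.eventually hev
  have hq : HasDerivAt Q (deriv Q p.2) p.2 :=
    (hQ.differentiable one_ne_zero).differentiableAt.hasDerivAt
  exact ⟨((hasDerivAt_fst_of_hasFDerivAt hD).congr_of_eventuallyEq e1.symm).unique
      (hasDerivAt_toDiag (hasDerivAt_const _ _) hx h2),
    ((hasDerivAt_snd_of_hasFDerivAt hD).congr_of_eventuallyEq e2.symm).unique
      (hasDerivAt_toDiag hq ht h2)⟩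

variable {τ R s R' r lmin Λ C : ℝ} {K K' : ℝ≥0}

theorem DiagChart.ofDiag_toDiag (hc : P.DiagChart Q Ω₀ τ R s R' r lmin Λ C K K') {t : ℝ}
    (ht : t ∈ Icc 0 τ) {Ω : Fin 3 → ℝ} (hΩ : Ω ∈ Metric.closedBall Ω₀ s) :
    P.ofDiag (Q t) (P.toDiag (Q t) Ω) = Ω :=
  Params.ofDiag_toDiag (hc.physical t ht Ω hΩ).A₂_pos.ne' (hc.ne t ht Ω hΩ)

theorem lipschitzOnWith_comp_slab {h : ℝ → (Fin 3 → ℝ) → Fin 3 → ℝ} {B : Set (Fin 3 → ℝ)}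
    {κ L : ℝ≥0} {T τ : ℝ} (hT : T ≤ τ) (hh : ∀ t ∈ Icc 0 τ, ∀ t' ∈ Icc 0 τ, ∀ u ∈ B, ∀ u' ∈ B,
      dist (h t u) (h t' u') ≤ κ * (|t - t'| + dist u u')) {u : ℝ × ℝ → Fin 3 → ℝ}
    (hu : LipschitzOnWith L u (slab T)) (hB : ∀ p ∈ slab T, u p ∈ B) :
    LipschitzOnWith (κ * (1 + L)) (fun p => h p.2 (u p)) (slab T) := by
  refine LipschitzOnWith.of_dist_le_mul fun p hp q hq => ?_
  have hp2 : p.2 ∈ Icc 0 τ := Icc_subset_Icc_right hT hp.2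
  have hq2 : q.2 ∈ Icc 0 τ := Icc_subset_Icc_right hT hq.2
  refine (hh _ hp2 _ hq2 _ (hB p hp) _ (hB q hq)).trans ?_
  have h1 := hu.dist_le_mul p hp q hq
  have h2 : |p.2 - q.2| ≤ dist p q := by rw [Prod.dist_eq, ← Real.dist_eq]; exact le_max_right _ _
  push_cast
  rw [mul_assoc]
  refine mul_le_mul_of_nonneg_left ?_ κ.coe_nonneg
  linarith

/-- A solution is only required to have partial derivatives almost everywhere. Rademacher's theorem
gives the transformed function a full derivative, and the partial derivatives identify its entries.
-/
theorem DiagChart.isDiagSolution (hc : P.DiagChart Q Ω₀ τ R s R' r lmin Λ C K K')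
    (hQ : ContDiff ℝ 1 Q) {T : ℝ} (hT : T ≤ τ) {g d : ℝ → Fin 3 → ℝ} {Y : ℝ × ℝ → Fin 3 → ℝ}
    (hY : P.IsSolution Q T g d Y) (hnear : ∀ p ∈ slab T, Y p ∈ Metric.closedBall Ω₀ s) :
    IsDiagSolution (P.chartSpeed Q) (P.chartSource Q) (Metric.closedBall (P.toDiag (Q 0) Ω₀) R) T
      (fun p => P.toDiag (Q p.2) (Y p)) := by
  obtain ⟨L, hL⟩ := hY.lipschitz
  have hLip := lipschitzOnWith_comp_slab hT hc.toDiag_lip hL hnear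
  refine ⟨⟨_, hLip⟩, fun p hp => hc.toDiag_mem _ (Icc_subset_Icc_right hT hp.2) _ (hnear p hp), ?_⟩
  filter_upwards [hY.pde, hLip.ae_differentiableWithinAt (μ := volume) (measurableSet_slab T),
    ae_slab_mem_nhds T, ae_restrict_mem (measurableSet_slab T)] with p hpde hdiff hpn hps
  obtain ⟨Yx, Yt, hx, ht, heq⟩ := hpde
  have hD := (hdiff.differentiableAt hpn).hasFDerivAt
  have hpt : p.2 ∈ Icc 0 τ := Icc_subset_Icc_right hT hps.2
  have hph := hY.physical p hps
  obtain ⟨d1, d2⟩ := fderiv_toDiag_apply hQ (Filter.Eventually.of_forall fun _ => rfl) hD hx ht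
    hph.A₂_pos.ne'
  refine ⟨_, hD, fun i => ?_⟩
  have := (pde_iff_diag hph.A₂_pos.ne' hph.inertia_pos.ne' (hc.ne _ hpt _ (hnear p hps))
    (deriv Q p.2) Yx Yt).1 heq i
  rw [d1, d2, chartSpeed, chartSource, hc.ofDiag_toDiag hpt (hnear p hps)]
  exact this

theorem DiagChart.isSolution (hc : P.DiagChart Q Ω₀ τ R s R' r lmin Λ C K K')
    (hQ : ContDiff ℝ 1 Q) {T : ℝ} (hT0 : 0 ≤ T) (hT : T ≤ τ) {g d : ℝ → Fin 3 → ℝ}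
    {u : ℝ × ℝ → Fin 3 → ℝ}
    (hu : IsDiagSolution (P.chartSpeed Q) (P.chartSource Q)
      (Metric.closedBall (P.toDiag (Q 0) Ω₀) R) T u)
    (hg : ∀ x ∈ Ici (0 : ℝ), g x ∈ Metric.closedBall Ω₀ s)
    (hd : ∀ t ∈ Icc 0 T, d t ∈ Metric.closedBall Ω₀ s)
    (hin : ∀ x ∈ Ici (0 : ℝ), u (x, 0) = P.toDiag (Q 0) (g x))
    (hbd : ∀ t ∈ Icc 0 T, u (0, t) = P.toDiag (Q t) (d t)) :
    P.IsSolution Q T g d (fun p => P.ofDiag (Q p.2) (u p)) := by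
  obtain ⟨L, hL⟩ := hu.lipschitz
  have hLip := lipschitzOnWith_comp_slab hT hc.ofDiag_lip hL hu.mem
  have hsub : Icc 0 T ⊆ Icc 0 τ := Icc_subset_Icc_right hT
  refine ⟨⟨_, hLip⟩, fun p hp => hc.physical_ofDiag _ (hsub hp.2) _ (hu.mem p hp), fun x hx => ?_,
    fun t ht => ?_, ?_⟩
  · simp only
    rw [hin x hx, hc.ofDiag_toDiag ⟨le_rfl, hT0.trans hT⟩ (hg x hx)]
  · simp only
    rw [hbd t ht, hc.ofDiag_toDiag (hsub ht) (hd t ht)]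
  · filter_upwards [hu.pde, hLip.ae_differentiableWithinAt (μ := volume) (measurableSet_slab T),
      ae_slab_mem_nhds T, ae_restrict_mem (measurableSet_slab T)] with p hpde hdiff hpn hps
    obtain ⟨D, hD, heq⟩ := hpde
    have hE := (hdiff.differentiableAt hpn).hasFDerivAt
    have hx := hasDerivAt_fst_of_hasFDerivAt hE
    have ht := hasDerivAt_snd_of_hasFDerivAt hE
    refine ⟨_, _, hx, ht, ?_⟩
    have hph := hc.physical_ofDiag _ (hsub hps.2) _ (hu.mem p hps)
    have hne := hc.chart_ne _ (hsub hps.2) _ (hu.mem p hps)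
    have hev : ∀ᶠ p' in 𝓝 p, u p' = P.toDiag (Q p'.2) (P.ofDiag (Q p'.2) (u p')) := by
      filter_upwards [hpn] with p' hp'
      exact (toDiag_ofDiag (hc.areaRatio_ne _ (hsub hp'.2) _ (hu.mem p' hp'))
        (hc.chart_ne _ (hsub hp'.2) _ (hu.mem p' hp'))).symm
    obtain ⟨d1, d2⟩ := fderiv_toDiag_apply hQ (Y := fun p => P.ofDiag (Q p.2) (u p)) hev hD hx ht
      hph.A₂_pos.ne'
    refine (pde_iff_diag hph.A₂_pos.ne' hph.inertia_pos.ne' (by simpa [ofDiag] using hne)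
      (deriv Q p.2) _ _).2 fun i => ?_
    have := heq i
    rw [d1, d2, chartSpeed, chartSource] at this
    exact this

theorem IsSolution.mono {T T' : ℝ} (hT : T' ≤ T) {g d : ℝ → Fin 3 → ℝ} {Y : ℝ × ℝ → Fin 3 → ℝ}
    (hY : P.IsSolution Q T g d Y) : P.IsSolution Q T' g d Y where
  lipschitz := hY.lipschitz.imp fun _ hK => hK.mono (slab_mono hT)
  physical p hp := hY.physical p (slab_mono hT hp)
  initial := hY.initial
  boundary t ht := hY.boundary t (Icc_subset_Icc_right hT ht)
  pde := ae_restrict_of_ae_restrict_of_subset (slab_mono hT) hY.pde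

/-- The factor involves a Lipschitz constant of `Z` in diagonal coordinates but none of `Y`. For
constructed solutions it is uniform over all admissible data. -/
theorem DiagChart.dist_le (hc : P.DiagChart Q Ω₀ τ R s R' r lmin Λ C K K')
    (hQ : ContDiff ℝ 1 Q) {T : ℝ} (hT0 : 0 ≤ T) (hT : T ≤ τ) {g d g' d' : ℝ → Fin 3 → ℝ}
    {Y Z : ℝ × ℝ → Fin 3 → ℝ} (hY : P.IsSolution Q T g d Y) (hZ : P.IsSolution Q T g' d' Z)
    (hYs : ∀ p ∈ slab T, Y p ∈ Metric.closedBall Ω₀ s)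
    (hZs : ∀ p ∈ slab T, Z p ∈ Metric.closedBall Ω₀ s) {L : ℝ≥0}
    (hL : LipschitzOnWith L (fun p => P.toDiag (Q p.2) (Z p)) (slab T)) {δ : ℝ}
    (hg : ∀ x ∈ Ici (0 : ℝ), dist (g x) (g' x) ≤ δ) (hd : ∀ t ∈ Icc 0 T, dist (d t) (d' t) ≤ δ) :
    ∀ p ∈ slab T, dist (Y p) (Z p) ≤ K' * (K * δ * Real.exp (2 * (C * (1 + L)) * T)) := by
  have hsub : Icc 0 T ⊆ Icc 0 τ := Icc_subset_Icc_right hT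
  have hu := hc.isDiagSolution hQ hT hY hYs
  have hv := hc.isDiagSolution hQ hT hZ hZs
  have hmain : ∀ p ∈ slab T, dist (Y p) (Z p) ≤ δ →
      dist (P.toDiag (Q p.2) (Y p)) (P.toDiag (Q p.2) (Z p)) ≤ K * δ := by
    intro p hp hδ
    refine (hc.toDiag_lip _ (hsub hp.2) _ (hsub hp.2) _ (hYs p hp) _ (hZs p hp)).trans ?_
    rw [sub_self, abs_zero, zero_add]
    exact mul_le_mul_of_nonneg_left hδ K.coe_nonneg
  have hstab := dist_le_mul_exp_of_isDiagSolution hc.bounds hT hu hv hL (δ := K * δ)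
    (fun x hx => hmain (x, 0) ⟨hx, le_rfl, hT0⟩ (by
      rw [hY.initial x hx, hZ.initial x hx]; exact hg x hx))
    (fun t ht => hmain (0, t) ⟨by simp, ht⟩ (by
      rw [hY.boundary t ht, hZ.boundary t ht]; exact hd t ht))
  intro p hp
  have h1 := hc.ofDiag_lip _ (hsub hp.2) _ (hsub hp.2) _ (hu.mem p hp) _ (hv.mem p hp)
  rw [hc.ofDiag_toDiag (hsub hp.2) (hYs p hp), hc.ofDiag_toDiag (hsub hp.2) (hZs p hp), sub_self,
    abs_zero, zero_add] at h1
  exact h1.trans (mul_le_mul_of_nonneg_left (hstab p hp) K'.2)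

/-- A solution which stays well inside the domain of the chart is the only one with its data. -/
theorem DiagChart.eqOn (hc : P.DiagChart Q Ω₀ τ R s R' r lmin Λ C K K')
    (hQ : ContDiff ℝ 1 Q) {T : ℝ} (hT : T ≤ τ) {g d : ℝ → Fin 3 → ℝ}
    {Y Z : ℝ × ℝ → Fin 3 → ℝ} (hY : P.IsSolution Q T g d Y) (hZ : P.IsSolution Q T g d Z)
    (hZs : ∀ p ∈ slab T, Z p ∈ Metric.closedBall Ω₀ (s / 2)) : EqOn Y Z (slab T) := by
  obtain ⟨L, hL⟩ := hY.lipschitz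
  obtain ⟨LZ, hLZ⟩ := hZ.lipschitz
  have hs := hc.s_pos
  -- In a time η the solution `Y` moves by at most `s / 2`. Starting from a value of `Z`, it
  -- therefore stays in the ball of radius `s`, where the stability estimate applies.
  set η := s / (2 * (L + 1)) with hη
  have hη0 : 0 < η := by positivity
  have hLη : L * η ≤ s / 2 := by
    have h1 : (L + 1 : ℝ) * η = s / 2 := by rw [hη]; field_simp
    have h2 : (L : ℝ) * η ≤ (L + 1) * η := mul_le_mul_of_nonneg_right (by linarith) hη0.le
    linarith
  have step : ∀ n : ℕ, ∀ p ∈ slab T, p.2 ≤ n * η → Y p = Z p := by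
    intro n
    induction n with
    | zero =>
      rintro ⟨x, t⟩ ⟨hx, ht0, _⟩ ht
      have : t = 0 := le_antisymm (by simpa using ht) ht0
      subst this
      rw [hY.initial x hx, hZ.initial x hx]
    | succ n ih =>
      intro p hp hpn
      have hT' : p.2 ≤ T := hp.2.2
      have hsub := slab_mono hT'
      have hYs : ∀ p' ∈ slab p.2, Y p' ∈ Metric.closedBall Ω₀ s := by
        rintro ⟨x, t⟩ hp'
        obtain ⟨hx, ht0, htp⟩ := hp'
        simp only at ht0 htp
        have hmem : (x, t) ∈ slab T := ⟨hx, ht0, htp.trans hT'⟩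
        -- At this earlier time `Y` and `Z` are already known to agree, and at most η has passed
        -- since.
        have hmin : (x, min t (n * η)) ∈ slab T :=
          ⟨hx, le_min ht0 (by positivity), (min_le_left _ _).trans (htp.trans hT')⟩
        have h1 := hL.dist_le_mul _ hmem _ hmin
        have h2 : dist (x, t) (x, min t (n * η)) ≤ η := by
          rw [Prod.dist_eq, dist_self, Real.dist_eq]
          refine max_le hη0.le ?_
          rw [abs_of_nonneg (sub_nonneg.2 (min_le_left _ _))]
          push_cast at hpn
          rcases min_choice t (n * η) with h | h <;> rw [h] <;> linarith
        rw [ih _ hmin (min_le_right _ _)] at h1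
        have h3 := hZs _ hmin
        rw [Metric.mem_closedBall] at h3 ⊢
        have h4 := dist_triangle (Y (x, t)) (Z (x, min t (n * η))) Ω₀
        have h5 := mul_le_mul_of_nonneg_left h2 L.coe_nonneg
        linarith
      have hZs' : ∀ p' ∈ slab p.2, Z p' ∈ Metric.closedBall Ω₀ s := fun p' hp' =>
        Metric.closedBall_subset_closedBall (by linarith) (hZs p' (hsub hp'))
      have hLip := lipschitzOnWith_comp_slab (hT'.trans hT) hc.toDiag_lip (hLZ.mono hsub) hZs'
      have := hc.dist_le hQ hp.2.1 (hT'.trans hT) (hY.mono hT') (hZ.mono hT') hYs hZs' hLip (δ := 0)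
        (by simp) (by simp) p ⟨hp.1, hp.2.1, le_rfl⟩
      rw [mul_zero, zero_mul, mul_zero] at this
      exact dist_le_zero.1 this
  intro p hp
  obtain ⟨n, hn⟩ := exists_nat_ge (p.2 / η)
  exact step n p hp ((div_le_iff₀ hη0).1 hn)

theorem DiagChart.exists_solution (hc : P.DiagChart Q Ω₀ τ R s R' r lmin Λ C K K')
    (hQ : ContDiff ℝ 1 Q) (hτ : 0 < τ) (k : ℝ≥0) :
    ∃ T₀ > 0, T₀ ≤ τ ∧ ∃ L : ℝ≥0, ∀ T, 0 < T → T ≤ T₀ → ∀ g d, IsData Ω₀ r k T g d →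
      ∃ Y, P.IsSolution Q T g d Y ∧ (∀ p ∈ slab T, Y p ∈ Metric.closedBall Ω₀ (s / 2)) ∧
        LipschitzOnWith L (fun p => P.toDiag (Q p.2) (Y p)) (slab T) := by
  -- The scheme is run in the smaller ball of radius `R'`, whose preimage lies in the ball of radius
  -- `s / 2`. This is the margin which `DiagChart.eqOn` requires.
  have hb := hc.bounds.mono (Metric.closedBall_subset_closedBall hc.R'_le) le_rfl
  obtain ⟨T₀, hT₀, hT₀τ, L, hex⟩ := exists_isDiagSolution hb hτ hc.R'_pos (K * (1 + k))
  refine ⟨T₀, hT₀, hT₀τ, L, fun T hT0 hTT₀ g d hgd => ?_⟩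
  have hT : T ≤ τ := hTT₀.trans hT₀τ
  have hsub : Icc 0 T ⊆ Icc 0 τ := Icc_subset_Icc_right hT
  have h0 : (0 : ℝ) ∈ Icc 0 τ := ⟨le_rfl, hτ.le⟩
  have hrs := Metric.closedBall_subset_closedBall (x := Ω₀) hc.r_le
  have hgr : ∀ x ∈ Ici (0 : ℝ), g x ∈ Metric.closedBall Ω₀ r := hgd.near_initial
  have hdr : ∀ t ∈ Icc 0 T, d t ∈ Metric.closedBall Ω₀ r := hgd.near_boundary
  obtain ⟨u, hu, hLu, hin, hbd⟩ := hex T hT0 hTT₀ (fun x => P.toDiag (Q 0) (g x))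
    (fun t => P.toDiag (Q t) (d t))
    (LipschitzOnWith.of_dist_le_mul fun x hx y hy => by
      have h1 := hc.toDiag_lip 0 h0 0 h0 _ (hrs (hgr x hx)) _ (hrs (hgr y hy))
      have h2 := hgd.lipschitz_initial.dist_le_mul x hx y hy
      rw [sub_self, abs_zero, zero_add] at h1
      refine h1.trans ?_
      push_cast
      rw [mul_assoc]
      refine mul_le_mul_of_nonneg_left ?_ K.coe_nonneg
      have : 0 ≤ dist x y := dist_nonneg
      linarith)
    (LipschitzOnWith.of_dist_le_mul fun x hx y hy => by
      have h1 := hc.toDiag_lip x (hsub hx) y (hsub hy) _ (hrs (hdr x hx)) _ (hrs (hdr y hy))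
      have h2 := hgd.lipschitz_boundary.dist_le_mul x hx y hy
      rw [← Real.dist_eq] at h1
      refine h1.trans ?_
      push_cast
      rw [mul_assoc]
      refine mul_le_mul_of_nonneg_left ?_ K.coe_nonneg
      linarith)
    (by simp only [hgd.corner])
    (fun x hx => hc.toDiag_near 0 h0 _ (hgr x hx))
    (fun t ht => hc.toDiag_near t (hsub ht) _ (hdr t ht))
  have hu' := hu.mono (Metric.closedBall_subset_closedBall hc.R'_le) le_rfl
  refine ⟨_, hc.isSolution hQ hT0.le hT hu' (fun x hx => hrs (hgr x hx))
    (fun t ht => hrs (hdr t ht)) hin hbd, fun p hp => hc.ofDiag_mem _ (hsub hp.2) _ (hu.mem p hp),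
    ?_⟩
  refine LipschitzOnWith.of_dist_le_mul fun p hp p' hp' => ?_
  have e : ∀ p ∈ slab T, P.toDiag (Q p.2) (P.ofDiag (Q p.2) (u p)) = u p := fun p hp =>
    toDiag_ofDiag (hc.areaRatio_ne _ (hsub hp.2) _ (hu'.mem p hp))
      (hc.chart_ne _ (hsub hp.2) _ (hu'.mem p hp))
  rw [e p hp, e p' hp']
  exact hLu.dist_le_mul p hp p' hp'

theorem wellPosed (hQ : ContDiff ℝ 1 Q) (h₀ : P.Physical (Q 0) Ω₀)
    (hUV : Ω₀ 2 ≠ P.V (Q 0) Ω₀) : P.WellPosed Q Ω₀ := by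
  obtain ⟨τ, R, s, R', r, lmin, Λ, C, K, K', hτ, hr, hc⟩ := exists_diagChart hQ h₀ hUV
  refine ⟨r, hr, fun k => ?_⟩
  obtain ⟨T₀, hT₀, hT₀τ, L, hex⟩ := hc.exists_solution hQ hτ k
  refine ⟨T₀, hT₀, fun T hT0 hTT₀ => ?_⟩
  have hT : T ≤ τ := hTT₀.trans hT₀τ
  have hs := hc.s_pos
  refine ⟨fun g d hgd => ?_, fun g d hgd Y Z hY hZ => ?_, fun ε hε => ?_⟩
  · obtain ⟨Y, hY, -⟩ := hex T hT0 hTT₀ g d hgd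
    exact ⟨Y, hY⟩
  · obtain ⟨W, hW, hWs, -⟩ := hex T hT0 hTT₀ g d hgd
    exact (hc.eqOn hQ hT hY hW hWs).trans (hc.eqOn hQ hT hZ hW hWs).symm
  · set E := (K' : ℝ) * (K * Real.exp (2 * (C * (1 + L)) * T)) with hE
    have hE0 : 0 ≤ E := by positivity
    refine ⟨ε / (E + 1), by positivity, fun g d g' d' hgd hgd' hg hd Y Z hY hZ p hp => ?_⟩
    obtain ⟨W, hW, hWs, -⟩ := hex T hT0 hTT₀ g d hgd
    obtain ⟨W', hW', hWs', hL⟩ := hex T hT0 hTT₀ g' d' hgd'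
    have hhalf := Metric.closedBall_subset_closedBall (x := Ω₀) (half_le_self hs.le)
    -- Both solutions are replaced by the constructed ones, whose Lipschitz constant `L` does not
    -- depend on the data; hence δ is uniform.
    rw [hc.eqOn hQ hT hY hW hWs hp, hc.eqOn hQ hT hZ hW' hWs' hp]
    refine (hc.dist_le hQ hT0.le hT hW hW' (fun p hp => hhalf (hWs p hp))
      (fun p hp => hhalf (hWs' p hp)) hL hg hd p hp).trans ?_
    have e : (K' : ℝ) * (K * (ε / (E + 1)) * Real.exp (2 * (C * (1 + L)) * T)) =
        E * (ε / (E + 1)) := by rw [hE]; ring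
    rw [e, mul_div_assoc', div_le_iff₀ (by positivity)]
    nlinarith

end Params

end TwoLayerFlow

theorem theorem3p1 (P : TwoLayerFlow.Params) (Q : ℝ → ℝ) (hQ : ContDiff ℝ 1 Q)
    (Ω₀ : Fin 3 → ℝ) (h₀ : P.Physical (Q 0) Ω₀) (hUV : Ω₀ 2 ≠ P.V (Q 0) Ω₀) :
    (∀ (q : ℝ) (Ω : Fin 3 → ℝ), P.Physical q Ω → P.Hyperbolic q Ω) ∧ P.WellPosed Q Ω₀ :=
  ⟨fun _ _ h => h.hyperbolic, TwoLayerFlow.Params.wellPosed hQ h₀ hUV⟩
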